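/- Let $\mu$ be a partition with $k=|\mu|$ boxes, let $\mu'$ be its conjugate partition, let $m\ge\mu_1$ (equivalently, $\mu'$ has at most $m$ parts) and $n\ge k$ be integers. Let $V=\mathbb{C}^m$, let $L$ be the free Lie algebra on $V$, and let $\mathfrak g=L\otimes\mathbb{C}^n=L^{\oplus n}$ be the direct sum of $n$ copies of the Lie algebra $L$. The group $GL(V)$ acts on $\mathfrak g$ by Lie algebra automorphisms of each copy of $L$ extending its action on $V$, $S_n$ acts on $\mathfrak g$ by permuting the copies, and $GL_n(\mathbb{C})$ acts linearly on $\mathfrak g$ through the factor $\mathbb{C}^n$. All these groups act contragrediently on the Chevalley–Eilenberg cochain spaces $\operatorname{Hom}_{\mathbb C}(\bigwedge^i\mathfrak g,\mathbb{C})$, whose differential is $$d(f)(x_1,\dots,x_{r+1})=\sum_{a<b}(-1)^{b-a}f([x_a,x_b],x_1,\dots,\hat x_a,\dots,\hat x_b,\dots,x_{r+1}).$$ Write $S^\mu=\mathbb{C}[S_k]c_\mu$ for the Specht module, where $c_\mu$ is the Young symmetrizer (the sum of the row permutations times the signed sum of the column permutations) of any tableau of shape $\mu$ (a numbering of its boxes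 by $1,\dots,k$), and $\mathbb{S}^{\lambda}(W)=c_\lambda W^{\otimes|\lambda|}$ for the Schur functor. Put $$X_i=\operatorname{Hom}_{GL(V)}\!\Big(\mathbb{S}^{\mu'}(V^*),\ \operatorname{Hom}_{\mathbb C}(\textstyle\bigwedge^i\mathfrak g,\mathbb{C})\Big),\qquad M_n^\mu=\operatorname{Ind}_{S_k\times S_{n-k}}^{S_n}(S^\mu\boxtimes\mathbf 1).$$ Then: 1. The maps induced by $d$ make $X_0\to X_1\to\cdots\to X_k$ a complex of $S_n$-representations which is a resolution of $M_n^\mu$: there is an $S_n$-equivariant map $X_k\to M_n^\mu$ such that $$0\to X_0\to X_1\to\cdots\to X_k\to M_n^\mu\to 0$$ is exact. 2. For $0\le i\le k$ the action of $GL_n(\mathbb{C})$ on $\mathfrak g$ makes $X_i$ a finite-dimensional algebraic representation of $GL_n(\mathbb{C})$, and the $S_n$-representation $X_i$ is its restriction to the subgroup $S_n\subset GL_n(\mathbb{C})$ of permutation matrices. 3. The representation $S^\mu$ of $S_k$ is irreducible, and for $n=k$ the complex $X_0\to\cdots\to X_k$ is a resolution of $S^\mu$: there is an exact sequence $0\to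 X_0\to\cdots\to X_k\to S^\mu\to0$ of $S_k$-representations. -/

import Mathlib

open Equiv (Perm)
open Representation (IntertwiningMap)
open scoped MatrixGroups TensorProduct

namespace FreeLieResolution

noncomputable section

/-! ### Specht modules, Schur functors and the modules `M_n^μ`

The symmetric group of a partition `μ` acts on the boxes of its Young diagram, in which the box
`(i, j)` lies in row `i` and column `j`. -/

/-- The sum of all permutations of the boxes of `μ` that preserve every row. -/
def rowSum (μ : YoungDiagram) : MonoidAlgebra ℂ (Perm μ.cells) :=
  ∑ p : Perm μ.cells with ∀ c, (p c).1.1 = c.1.1, MonoidAlgebra.single p 1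

/-- The signed sum of all permutations of the boxes of `μ` that preserve every column. -/
def colSum (μ : YoungDiagram) : MonoidAlgebra ℂ (Perm μ.cells) :=
  ∑ q : Perm μ.cells with ∀ c, (q c).1.2 = c.1.2,
    MonoidAlgebra.single q ((Perm.sign q : ℤ) : ℂ)

/-- The Young symmetrizer `c_μ = a_μ b_μ`. -/
def youngSymmetrizer (μ : YoungDiagram) : MonoidAlgebra ℂ (Perm μ.cells) :=
  rowSum μ * colSum μ

/-- Right multiplication by the Young symmetrizer on the left regular representation. -/
def mulYoungSymmetrizer (μ : YoungDiagram) :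
    IntertwiningMap (Representation.leftRegular ℂ (Perm μ.cells))
      (Representation.leftRegular ℂ (Perm μ.cells)) :=
  LinearMap.intertwiningMap_of_isIntertwiningMap _ _
    (LinearMap.mulRight ℂ (youngSymmetrizer μ)) (by
      intro g v
      have h : ∀ w : MonoidAlgebra ℂ (Perm μ.cells),
          Representation.leftRegular ℂ (Perm μ.cells) g w = MonoidAlgebra.single g 1 * w := by
        intro w
        induction w using MonoidAlgebra.induction_linear with
        | zero => simp
        | add a b ha hb => rw [map_add, ha, hb, mul_add]
        | single a r => simp [MonoidAlgebra.single_mul_single]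
      simp only [h, LinearMap.mulRight_apply, mul_assoc])

/-- The Specht module `ℂ[S_k] c_μ` as a representation of the permutations of the boxes of `μ`. -/
def boxSpecht (μ : YoungDiagram) :
    Representation ℂ (Perm μ.cells) (mulYoungSymmetrizer μ).range.toSubmodule :=
  (mulYoungSymmetrizer μ).range.toRepresentation

/-- The Specht module `S^μ` as a representation of `S_k`, `k = |μ|`, where the boxes of `μ` are
numbered by the tableau `T`. -/
def specht (μ : YoungDiagram) (T : μ.cells ≃ Fin μ.card) :
    Representation ℂ (Perm (Fin μ.card)) (mulYoungSymmetrizer μ).range.toSubmodule :=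
  (boxSpecht μ).comp T.symm.permCongrHom.toMonoidHom

/-- The embedding `S_k × S_{n-k} → S_n`, where `S_k` permutes the first `k` letters and `S_{n-k}`
the last `n - k` letters. -/
def youngEmbedding {k n : ℕ} (h : k ≤ n) : Perm (Fin k) × Perm (Fin (n - k)) →* Perm (Fin n) :=
  (finSumFinEquiv.trans (finCongr (Nat.add_sub_of_le h))).permCongrHom.toMonoidHom.comp
    (Perm.sumCongrHom (Fin k) (Fin (n - k)))

/-- `S^μ ⊠ 1`, on the space of `S^μ`: the second factor of `S_k × S_{n-k}` acts trivially. -/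
def spechtBoxTriv (μ : YoungDiagram) (T : μ.cells ≃ Fin μ.card) (n : ℕ) :
    Representation ℂ (Perm (Fin μ.card) × Perm (Fin (n - μ.card)))
      (mulYoungSymmetrizer μ).range.toSubmodule :=
  (specht μ T).comp (MonoidHom.fst _ _)

/-- `M_n^μ`, the representation of `S_n` induced from `S^μ ⊠ 1`. -/
def inducedM (μ : YoungDiagram) (T : μ.cells ≃ Fin μ.card) {n : ℕ} (h : μ.card ≤ n) :
    Representation ℂ (Perm (Fin n))
      (Representation.IndV (youngEmbedding h) (spechtBoxTriv μ T n)) :=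
  Representation.ind (youngEmbedding h) (spechtBoxTriv μ T n)

/-- The permutation action on a tensor power, `σ (⊗ w_c) = ⊗ w_{σ⁻¹ c}`. -/
def permTensor (ι W : Type) [AddCommGroup W] [Module ℂ W] :
    Representation ℂ (Perm ι) (⨂[ℂ] _ : ι, W) where
  toFun σ := (PiTensorProduct.reindex ℂ (fun _ : ι => W) σ).toLinearMap
  map_one' := by
    ext w
    simp [Perm.one_def]
  map_mul' σ τ := by
    ext w
    simp [Perm.mul_def, PiTensorProduct.reindex_tprod]
    rfl

section Schur

variable {G W : Type} [Group G] [AddCommGroup W] [Module ℂ W]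

/-- The diagonal action on a tensor power, `g (⊗ w_c) = ⊗ g w_c`. -/
def diagTensor (ι : Type) (ρ : Representation ℂ G W) :
    Representation ℂ G (⨂[ℂ] _ : ι, W) where
  toFun g := PiTensorProduct.map fun _ => ρ g
  map_one' := by
    ext w
    simp
  map_mul' g h := by
    ext w
    simp [PiTensorProduct.map_tprod]

/-- The action of the Young symmetrizer `c_μ` on the tensor power `W^{⊗ |μ|}`. -/
def tensorYoungSymmetrizer (μ : YoungDiagram) (ρ : Representation ℂ G W) :
    IntertwiningMap (diagTensor μ.cells ρ) (diagTensor μ.cells ρ) :=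
  LinearMap.intertwiningMap_of_isIntertwiningMap _ _
    ((permTensor μ.cells W).asAlgebraHom (youngSymmetrizer μ)) (by
      intro g v
      have h : ∀ a : MonoidAlgebra ℂ (Perm μ.cells),
          (permTensor μ.cells W).asAlgebraHom a ∘ₗ diagTensor μ.cells ρ g =
            diagTensor μ.cells ρ g ∘ₗ (permTensor μ.cells W).asAlgebraHom a := by
        intro a
        induction a using MonoidAlgebra.induction_linear with
        | zero => simp
        | add a b ha hb => rw [map_add, LinearMap.add_comp, LinearMap.comp_add, ha, hb]
        | single σ r =>
          ext w
          simp [Representation.asAlgebraHom_single, permTensor, diagTensor,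
            PiTensorProduct.map_tprod, PiTensorProduct.reindex_tprod]
      exact LinearMap.congr_fun (h _) v)

/-- The Schur functor `𝕊^μ(W) = c_μ W^{⊗ |μ|}` applied to a representation `W`. -/
def schur (μ : YoungDiagram) (ρ : Representation ℂ G W) :
    Representation ℂ G (tensorYoungSymmetrizer μ ρ).range.toSubmodule :=
  (tensorYoungSymmetrizer μ ρ).range.toRepresentation

end Schur

/-! ### The Chevalley–Eilenberg cochains of a Lie algebra

The space `Hom(⋀^k 𝔤, ℂ)` is the space of alternating `k`-forms on `𝔤`. -/

section Cochains

variable {𝔤 : Type} [LieRing 𝔤] [LieAlgebra ℂ 𝔤]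

/-- The expression `f([x, y], z_1, …, z_k)`, bilinear in `x, y` and alternating in `z`. -/
def insertBracket {k : ℕ} (f : 𝔤 [⋀^Fin (k + 1)]→ₗ[ℂ] ℂ) :
    𝔤 →ₗ[ℂ] 𝔤 →ₗ[ℂ] 𝔤 [⋀^Fin k]→ₗ[ℂ] ℂ :=
  LinearMap.mk₂ ℂ (fun x y => f.curryLeft ⁅x, y⁆)
    (by intros; simp) (by intros; simp) (by intros; simp) (by intros; simp)

/-- The value at `x` of the Chevalley–Eilenberg differential of a form of positive degree. The
pair `i ≤ j` in `Fin (k + 1)` encodes the pair of positions `a < b` in `Fin (k + 2)` with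
`a = i` and `b = j + 1`, so that `i + j + 1 = a + b`; the summand is
`(-1)^(a+b) f([x_a, x_b], x_0, …, x̂_a, …, x̂_b, …, x_{k+1})`. -/
def differentialFun {k : ℕ} (f : 𝔤 [⋀^Fin (k + 1)]→ₗ[ℂ] ℂ) (x : Fin (k + 2) → 𝔤) : ℂ :=
  ∑ i : Fin (k + 1), ∑ j ≥ i, (-1) ^ (i + j + 1 : ℕ) *
    f (Matrix.vecCons ⁅x i.castSucc, x j.succ⁆ (j.removeNth (i.castSucc.removeNth x)))

theorem differentialFun_eq {k : ℕ} (f : 𝔤 [⋀^Fin (k + 1)]→ₗ[ℂ] ℂ) (x : Fin (k + 2) → 𝔤) :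
    differentialFun f x = ((-1 / 2 : ℂ) • AlternatingMap.alternatizeUncurryFin
      (AlternatingMap.alternatizeUncurryFinLM ∘ₗ insertBracket f)) x := by
  rw [AlternatingMap.smul_apply,
    AlternatingMap.alternatizeUncurryFin_alternatizeUncurryFinLM_comp_apply, differentialFun,
    Finset.smul_sum]
  refine Finset.sum_congr rfl fun i _ => ?_
  rw [Finset.smul_sum]
  refine Finset.sum_congr rfl fun j _ => ?_
  have h : ⁅x j.succ, x i.castSucc⁆ = -⁅x i.castSucc, x j.succ⁆ := (lie_skew _ _).symm
  simp only [insertBracket, LinearMap.mk₂_apply, h, map_neg, AlternatingMap.neg_apply,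
    AlternatingMap.curryLeft_apply_apply, sub_neg_eq_add, zsmul_eq_mul, smul_eq_mul, pow_succ]
  push_cast
  ring

/-- The Chevalley–Eilenberg differential in positive degrees. -/
def differentialSucc (k : ℕ) : 𝔤 [⋀^Fin (k + 1)]→ₗ[ℂ] ℂ →ₗ[ℂ] 𝔤 [⋀^Fin (k + 2)]→ₗ[ℂ] ℂ where
  toFun f :=
    { toFun := differentialFun f
      map_update_add' := by
        intro _ x i a b
        simp only [differentialFun_eq]
        convert AlternatingMap.map_update_add _ x i a b
      map_update_smul' := by
        intro _ x i c a
        simp only [differentialFun_eq]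
        convert AlternatingMap.map_update_smul _ x i c a
      map_eq_zero_of_eq' := by
        intro x i j hx hij
        simp only [differentialFun_eq]
        exact AlternatingMap.map_eq_zero_of_eq _ x hx hij }
  map_add' f g := by
    ext x
    simp [differentialFun, mul_add, Finset.sum_add_distrib]
  map_smul' c f := by
    ext x
    simp [differentialFun, Finset.mul_sum, mul_left_comm]

/-- The Chevalley–Eilenberg differential with trivial coefficients; in degree `0` it vanishes,
being an empty sum. -/
def differential : (k : ℕ) → 𝔤 [⋀^Fin k]→ₗ[ℂ] ℂ →ₗ[ℂ] 𝔤 [⋀^Fin (k + 1)]→ₗ[ℂ] ℂ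
  | 0 => 0
  | k + 1 => differentialSucc k

end Cochains

/-! ### Representations on forms and on multiplicity spaces -/

/-- The contragredient action on alternating forms, `(g f)(x_1, …) = f(g⁻¹ x_1, …)`. -/
def formRep {G W : Type} [Group G] [AddCommGroup W] [Module ℂ W] (ρ : Representation ℂ G W)
    (k : ℕ) : Representation ℂ G (W [⋀^Fin k]→ₗ[ℂ] ℂ) where
  toFun g :=
    { toFun := fun f => f.compLinearMap (ρ g⁻¹)
      map_add' := fun _ _ => rfl
      map_smul' := fun _ _ => rfl }
  map_one' := by
    ext f x
    simp
  map_mul' g h := by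
    ext f x
    simp only [mul_inv_rev, map_mul]
    rfl

/-- If the actions `ρ` of `G` and `τ` of `H` on `C` commute, then `H` acts on
`Hom_G(S, C)` by composition. -/
def homRep {G H S C : Type} [Group G] [Group H] [AddCommMonoid S] [Module ℂ S] [AddCommGroup C]
    [Module ℂ C] (σ : Representation ℂ G S) (ρ : Representation ℂ G C) (τ : Representation ℂ H C)
    (comm : ∀ g h, ρ g ∘ₗ τ h = τ h ∘ₗ ρ g) :
    Representation ℂ H (IntertwiningMap σ ρ) where
  toFun h := IntertwiningMap.llcomp σ ρ ρ ⟨τ h, fun g => (comm g h).symm⟩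
  map_one' := by
    ext φ x
    change τ 1 (φ x) = φ x
    simp
  map_mul' g h := by
    ext φ x
    change τ (g * h) (φ x) = τ g (τ h (φ x))
    simp

/-! ### The free Lie algebra `L` on `V = ℂ^m` and `𝔤 = L ⊗ ℂ^n` -/

/-- The free Lie algebra on `V = ℂ^m`, that is, on the standard basis of `V`. -/
abbrev FreeLie (m : ℕ) : Type := FreeLieAlgebra ℂ (Fin m)

/-- The direct sum of `n` copies of the free Lie algebra `L`. -/
abbrev FreeLieSum (m n : ℕ) : Type := DirectSum (Fin n) fun _ => FreeLie m

/-- The standard representation of `GL(V)` on `V = ℂ^m`. -/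
def stdRep (m : ℕ) : Representation ℂ (GL (Fin m) ℂ) (Fin m → ℂ) :=
  (Units.coeHom _).comp Matrix.GeneralLinearGroup.toLin.toMonoidHom

/-- The endomorphism of the Lie algebra `L` extending the endomorphism
`x_j ↦ ∑ i, A i j • x_i` of `V`. -/
def freeMap {m : ℕ} (A : Matrix (Fin m) (Fin m) ℂ) : FreeLie m →ₗ⁅ℂ⁆ FreeLie m :=
  FreeLieAlgebra.lift ℂ fun j => ∑ i, A i j • FreeLieAlgebra.of ℂ i

theorem freeMap_one (m : ℕ) : freeMap (1 : Matrix (Fin m) (Fin m) ℂ) = LieHom.id := by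
  ext j
  simp [freeMap, Matrix.one_apply]

theorem freeMap_mul {m : ℕ} (A B : Matrix (Fin m) (Fin m) ℂ) :
    freeMap (A * B) = (freeMap A).comp (freeMap B) := by
  ext j
  simp only [freeMap, FreeLieAlgebra.lift_of_apply, LieHom.comp_apply, map_sum, map_smul,
    Matrix.mul_apply, Finset.sum_smul, Finset.smul_sum, smul_smul]
  rw [Finset.sum_comm]
  simp only [mul_comm]

/-- The action of `GL(V)` on `𝔤`, by automorphisms of each copy of `L`. -/
def glVRep (m n : ℕ) : Representation ℂ (GL (Fin m) ℂ) (FreeLieSum m n) where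
  toFun A := DirectSum.lmap fun _ => (freeMap A.val : FreeLie m →ₗ[ℂ] FreeLie m)
  map_one' := by
    ext
    simp [freeMap_one]
  map_mul' A B := by
    ext
    simp [freeMap_mul]

theorem glVRep_lie {m n : ℕ} (A : GL (Fin m) ℂ) (x y : FreeLieSum m n) :
    glVRep m n A ⁅x, y⁆ = ⁅glVRep m n A x, glVRep m n A y⁆ := by
  refine DFinsupp.ext fun i => ?_
  change freeMap A.val (⁅x, y⁆ i) = _
  rw [DirectSum.bracket_apply, DirectSum.bracket_apply, LieHom.map_lie]
  rfl

/-- The action of `S_n` on `𝔤` permuting the copies of `L`: `(σ x)_i = x_{σ⁻¹ i}`. -/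
def permRep (m n : ℕ) : Representation ℂ (Perm (Fin n)) (FreeLieSum m n) where
  toFun σ := (DirectSum.lequivCongrLeft ℂ σ).toLinearMap
  map_one' := LinearMap.ext fun _ => DFinsupp.ext fun _ => rfl
  map_mul' _ _ := LinearMap.ext fun _ => DFinsupp.ext fun _ => rfl

theorem permRep_lie {m n : ℕ} (σ : Perm (Fin n)) (x y : FreeLieSum m n) :
    permRep m n σ ⁅x, y⁆ = ⁅permRep m n σ x, permRep m n σ y⁆ := by
  refine DFinsupp.ext fun i => ?_
  rw [DirectSum.bracket_apply]
  change ⁅x, y⁆ (σ.symm i) = ⁅x (σ.symm i), y (σ.symm i)⁆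
  rw [DirectSum.bracket_apply]

/-- The linear map `(A x)_i = ∑ j, A i j • x_j` on `𝔤 = L ⊗ ℂ^n`. -/
def matrixMap {n : ℕ} (m : ℕ) (A : Matrix (Fin n) (Fin n) ℂ) :
    FreeLieSum m n →ₗ[ℂ] FreeLieSum m n :=
  ∑ i, ∑ j, A i j • (DirectSum.lof ℂ (Fin n) (fun _ => FreeLie m) i ∘ₗ
    DirectSum.component ℂ (Fin n) (fun _ => FreeLie m) j)

theorem matrixMap_apply {n : ℕ} (m : ℕ) (A : Matrix (Fin n) (Fin n) ℂ) (x : FreeLieSum m n)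
    (i : Fin n) : matrixMap m A x i = ∑ j, A i j • x j := by
  have h : ∀ k l, (A k l • DirectSum.lof ℂ (Fin n) (fun _ => FreeLie m) k (x l)) i =
      if k = i then A i l • x l else 0 := by
    intro k l
    by_cases hk : k = i
    · subst hk
      simp [DirectSum.smul_apply, DirectSum.lof_apply]
    · rw [DirectSum.smul_apply, DirectSum.lof_eq_of, DirectSum.of_eq_of_ne _ _ _ (Ne.symm hk)]
      simp [hk]
  simp only [DirectSum.apply_eq_component ℂ] at h ⊢
  simp only [matrixMap, LinearMap.sum_apply, LinearMap.smul_apply, LinearMap.comp_apply, map_sum, h]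
  rw [Finset.sum_eq_single i] <;> simp +contextual

/-- The action of `GL_n(ℂ)` on `𝔤 = L ⊗ ℂ^n` through its standard action on `ℂ^n`. -/
def glnRep (m n : ℕ) : Representation ℂ (GL (Fin n) ℂ) (FreeLieSum m n) where
  toFun A := matrixMap m A.val
  map_one' := LinearMap.ext fun x => DFinsupp.ext fun i => by
    change matrixMap m _ x i = x i
    simp [matrixMap_apply, Matrix.one_apply]
  map_mul' A B := LinearMap.ext fun x => DFinsupp.ext fun i => by
    change matrixMap m _ x i = matrixMap m _ (matrixMap m _ x) i
    simp only [matrixMap_apply, Units.val_mul, Matrix.mul_apply, Finset.sum_smul,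
      Finset.smul_sum, smul_smul]
    rw [Finset.sum_comm]

theorem glVRep_comm_permRep {m n : ℕ} (A : GL (Fin m) ℂ) (σ : Perm (Fin n)) :
    glVRep m n A ∘ₗ permRep m n σ = permRep m n σ ∘ₗ glVRep m n A :=
  LinearMap.ext fun _ => DFinsupp.ext fun _ => rfl

theorem glVRep_comm_glnRep {m n : ℕ} (A : GL (Fin m) ℂ) (B : GL (Fin n) ℂ) :
    glVRep m n A ∘ₗ glnRep m n B = glnRep m n B ∘ₗ glVRep m n A :=
  LinearMap.ext fun x => DFinsupp.ext fun i => by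
    change freeMap A.val (matrixMap m B.val x i) = matrixMap m B.val (glVRep m n A x) i
    simp only [matrixMap_apply, map_sum, map_smul]
    rfl

/-- The embedding of `S_n` into `GL_n(ℂ)` as the subgroup of permutation matrices,
`σ e_j = e_{σ j}`. -/
def permGL (n : ℕ) : Perm (Fin n) →* GL (Fin n) ℂ :=
  (Matrix.permMatrixHom (n := Fin n) (R := ℂ)).toHomUnits

/-! ### The complex of multiplicity spaces -/

/-- The representation `𝕊^{μ'}(V^*)` of `GL(V)`. -/
def schurDual (μ : YoungDiagram) (m : ℕ) :
    Representation ℂ (GL (Fin m) ℂ)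
      (tensorYoungSymmetrizer μ.transpose (stdRep m).dual).range.toSubmodule :=
  schur μ.transpose (stdRep m).dual

/-- The space `Hom_{GL(V)}(𝕊^{μ'}(V^*), Hom(⋀^i 𝔤, ℂ))`. -/
abbrev Mult (μ : YoungDiagram) (m n i : ℕ) : Type :=
  IntertwiningMap (schurDual μ m) (formRep (glVRep m n) i)

theorem formRep_comm {G H W : Type} [Group G] [Group H] [AddCommGroup W] [Module ℂ W]
    {ρ : Representation ℂ G W} {τ : Representation ℂ H W}
    (comm : ∀ g h, ρ g ∘ₗ τ h = τ h ∘ₗ ρ g) (i : ℕ) (g : G) (h : H) :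
    formRep ρ i g ∘ₗ formRep τ i h = formRep τ i h ∘ₗ formRep ρ i g := by
  ext f x
  change f (fun a => τ h⁻¹ (ρ g⁻¹ (x a))) = f (fun a => ρ g⁻¹ (τ h⁻¹ (x a)))
  congr 1
  funext a
  exact (LinearMap.congr_fun (comm g⁻¹ h⁻¹) (x a)).symm

/-- The action of `S_n` on the `i`-th multiplicity space. -/
def multPerm (μ : YoungDiagram) (m n i : ℕ) : Representation ℂ (Perm (Fin n)) (Mult μ m n i) :=
  homRep (schurDual μ m) (formRep (glVRep m n) i) (formRep (permRep m n) i)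
    (formRep_comm glVRep_comm_permRep i)

/-- The action of `GL_n(ℂ)` on the `i`-th multiplicity space. -/
def multGL (μ : YoungDiagram) (m n i : ℕ) : Representation ℂ (GL (Fin n) ℂ) (Mult μ m n i) :=
  homRep (schurDual μ m) (formRep (glVRep m n) i) (formRep (glnRep m n) i)
    (formRep_comm glVRep_comm_glnRep i)

/-- The Chevalley–Eilenberg differential commutes with automorphisms of the Lie algebra. -/
theorem differential_formRep {G 𝔤 : Type} [Group G] [LieRing 𝔤] [LieAlgebra ℂ 𝔤]
    {ρ : Representation ℂ G 𝔤} (hρ : ∀ g x y, ρ g ⁅x, y⁆ = ⁅ρ g x, ρ g y⁆) (k : ℕ) (g : G) :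
    differential k ∘ₗ formRep ρ k g = formRep ρ (k + 1) g ∘ₗ differential k := by
  cases k with
  | zero => ext f x; simp [differential]
  | succ k =>
    ext f x
    change differentialFun (f.compLinearMap (ρ g⁻¹)) x = differentialFun f (fun a => ρ g⁻¹ (x a))
    refine Finset.sum_congr rfl fun i _ => Finset.sum_congr rfl fun j _ => ?_
    congr 1
    rw [AlternatingMap.compLinearMap_apply]
    congr 1
    funext a
    refine Fin.cases ?_ (fun b => ?_) a
    · simp [hρ]
    · simp [Fin.removeNth]

/-- The map of multiplicity spaces induced by the Chevalley–Eilenberg differential, as a map of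
`S_n`-representations. -/
def multDifferential (μ : YoungDiagram) (m n i : ℕ) :
    IntertwiningMap (multPerm μ m n i) (multPerm μ m n (i + 1)) :=
  LinearMap.intertwiningMap_of_isIntertwiningMap _ _
    (IntertwiningMap.llcomp (schurDual μ m) (formRep (glVRep m n) i)
      (formRep (glVRep m n) (i + 1))
      ⟨differential i, differential_formRep glVRep_lie i⟩) (by
    intro σ φ
    ext1
    exact congrArg (· ∘ₗ φ.toLinearMap) (differential_formRep permRep_lie i σ))

/-! ### Resolutions and representations of `GL_n(ℂ)` -/

section Resolution

variable {G : Type} [Group G] {X : ℕ → Type} [∀ i, AddCommGroup (X i)] [∀ i, Module ℂ (X i)]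
  {ρ : ∀ i, Representation ℂ G (X i)}

/-- The image in `X i` of the preceding differential, with `X (-1) = 0`. -/
def incoming (d : ∀ i, IntertwiningMap (ρ i) (ρ (i + 1))) : ∀ i, Submodule ℂ (X i)
  | 0 => ⊥
  | i + 1 => LinearMap.range (d i).toLinearMap

/-- The sequence `0 → X 0 → X 1 → ⋯ → X k` with the maps `d` is a resolution of `τ`: for some
morphism of representations `ε` the sequence `0 → X 0 → X 1 → ⋯ → X k → τ → 0` is exact. -/
def IsResolution (d : ∀ i, IntertwiningMap (ρ i) (ρ (i + 1))) (k : ℕ) {M : Type}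
    [AddCommGroup M] [Module ℂ M] (τ : Representation ℂ G M) : Prop :=
  (∀ i < k, LinearMap.ker (d i).toLinearMap = incoming d i) ∧
    ∃ ε : IntertwiningMap (ρ k) τ,
      LinearMap.ker ε.toLinearMap = incoming d k ∧ Function.Surjective ε

end Resolution

/-- A finite-dimensional algebraic representation of `GL_n(ℂ)`: every matrix coefficient is a
regular function, that is, a polynomial in the entries of `A` and of `A⁻¹`. -/
def IsAlgebraicRep {n : ℕ} {M : Type} [AddCommGroup M] [Module ℂ M]
    (ρ : Representation ℂ (GL (Fin n) ℂ) M) : Prop :=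
  FiniteDimensional ℂ M ∧ ∀ (v : M) (l : Module.Dual ℂ M),
    ∃ P : MvPolynomial ((Fin n × Fin n) ⊕ (Fin n × Fin n)) ℂ, ∀ A : GL (Fin n) ℂ,
      l (ρ A v) = MvPolynomial.eval
        (Sum.elim (fun p => A.val p.1 p.2) (fun p => A⁻¹.val p.1 p.2)) P

end

end FreeLieResolution

open FreeLieResolution

/-! The scalars in `GL(V)` grade the Chevalley–Eilenberg complex of `𝔤 = L^{⊕n}` by weight, and
`Hom_{GL(V)}(𝕊^{μ'}(V^*), -)` sees only weight `k = |μ|`. A free Lie algebra has cohomology `ℂ` in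
degree 0 and `V^*` in degree 1, so by Künneth the weight-`k` cohomology of `𝔤` is concentrated in
degree `k`. There it consists of one copy of `(V^*)^{⊗k}` for every choice of `k` distinct colours
(copies of `L`). Degrees above `k` have no weight-`k` part, so the complex stops at `k` and resolves
its top cohomology. By Schur–Weyl duality the multiplicity space of `𝕊^{μ'}(V^*)` in `(V^*)^{⊗k}` is
a Specht module. The sign coming from alternating forms turns `μ'` into `μ`, and the choice of
colours produces the induction from `S_k × S_{n-k}`.

Künneth is replaced by an explicit homotopy on equivariant families `f : S → Hom(⋀^i 𝔤, ℂ)`, for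
arbitrary `GL(V)`-modules `S` on which the scalar 2 acts by `2^{-w}`. Primitives are again
equivariant, so exactness holds directly on multiplicity spaces. Two statements are proved together
by induction on `w`: `acyclic` for trivial coefficients, and `twAcyclic` for coefficients in the
dual of the enveloping algebra `U` of one copy of `L`, where `U` is the free associative algebra.
From twisted to trivial coefficients (`acyclic_succ`): contraction with `ad(u) x_j` turns a cocycle
of weight `w + 1` into twisted cocycles of weight `w`, indexed by `V ⊗ S`. Substituting Fox
derivatives for `u`, antisymmetrizing and summing over colours gives back `(w + 1) f`, because `∑
ad(∂_j x) x_j` is the Euler derivation of `L`. Both operations anticommute with the differentials,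
so twisted primitives yield a primitive of `f`. From trivial to twisted coefficients
(`isTwBoundary_of_restrictFamily`): the augmentation ideal of `U` is the free left module on the
`x_j`, so restricting the coefficients to it lowers the weight by one, and the remainder has trivial
coefficients.

The top term is identified by evaluating on vectors of prescribed distinct colours (`colorSpecht`).
These values vanish exactly on coboundaries (`mem_incoming_iff_colorSpecht`), and `spechtEquiv`
places them in the Specht module, using the double commutant theorem `exists_asAlgebraHom_eq` and
von Neumann's lemma `rowSum_mul_single_mul_colSum`. Algebraicity holds because `X_i` is
finite-dimensional and its matrix coefficients are combinations of values of multilinear forms. -/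

namespace FreeLieResolution

noncomputable section

/-! ### Cartan calculus for forms on a Lie algebra -/

section Cartan

open AlternatingMap

variable {𝔤 : Type} [AddCommGroup 𝔤] [Module ℂ 𝔤]

/-- The space of alternating `n`-forms. -/
abbrev Form (𝔤 : Type) [AddCommGroup 𝔤] [Module ℂ 𝔤] (n : ℕ) : Type := 𝔤 [⋀^Fin n]→ₗ[ℂ] ℂ

/-- Contraction of a form with a vector, inserted in the first place. -/
def contract {n : ℕ} (x : 𝔤) : Form 𝔤 (n + 1) →ₗ[ℂ] Form 𝔤 n :=
  LinearMap.applyₗ x ∘ₗ curryLeftLinearMap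

/-- The form obtained by antisymmetrizing a linear family of forms. -/
def wedge {n : ℕ} : (𝔤 →ₗ[ℂ] Form 𝔤 n) →ₗ[ℂ] Form 𝔤 (n + 1) := alternatizeUncurryFinLM

theorem contract_apply {n : ℕ} (x : 𝔤) (f : Form 𝔤 (n + 1)) (v : Fin n → 𝔤) :
    contract x f v = f (Matrix.vecCons x v) := rfl

theorem contract_eq {n : ℕ} (x : 𝔤) (f : Form 𝔤 (n + 1)) : contract x f = f.curryLeft x := rfl

theorem contract_add {n : ℕ} (x y : 𝔤) (f : Form 𝔤 (n + 1)) :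
    contract (x + y) f = contract x f + contract y f := map_add f.curryLeft x y

theorem contract_neg {n : ℕ} (x : 𝔤) (f : Form 𝔤 (n + 1)) :
    contract (-x) f = -contract x f := map_neg f.curryLeft x

theorem contract_sub {n : ℕ} (x y : 𝔤) (f : Form 𝔤 (n + 1)) :
    contract (x - y) f = contract x f - contract y f := map_sub f.curryLeft x y

theorem contract_smul {n : ℕ} (c : ℂ) (x : 𝔤) (f : Form 𝔤 (n + 1)) :
    contract (c • x) f = c • contract x f := map_smul f.curryLeft c x

theorem contract_zero {n : ℕ} (f : Form 𝔤 (n + 1)) :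
    contract (0 : 𝔤) f = 0 := map_zero f.curryLeft

/-- The operator identities below are proved by induction on the degree: contract both sides with an
arbitrary vector and commute the contraction inwards. -/
theorem form_ext {n : ℕ} {f g : Form 𝔤 (n + 1)} (h : ∀ x, contract x f = contract x g) :
    f = g := by
  ext v
  have := congrArg (fun F : Form 𝔤 n => F (Matrix.vecTail v)) (h (Matrix.vecHead v))
  simpa [contract_apply] using this

theorem contract_contract {n : ℕ} (x y : 𝔤) (f : Form 𝔤 (n + 2)) :
    contract x (contract y f) = -contract y (contract x f) := by
  have h : contract (x + y) (contract (x + y) f) = 0 := curryLeft_same f (x + y)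
  have hx : contract x (contract x f) = 0 := curryLeft_same f x
  have hy : contract y (contract y f) = 0 := curryLeft_same f y
  simp only [contract_add, map_add, hx, hy, zero_add, add_zero] at h
  exact eq_neg_of_add_eq_zero_right h

theorem wedge_apply {n : ℕ} (A : 𝔤 →ₗ[ℂ] Form 𝔤 n) (v : Fin (n + 1) → 𝔤) :
    wedge A v = ∑ i : Fin (n + 1), (-1 : ℤ) ^ (i : ℕ) • A (v i) (i.removeNth v) :=
  alternatizeUncurryFin_apply A v

theorem contract_wedge_zero (A : 𝔤 →ₗ[ℂ] Form 𝔤 0) (x : 𝔤) : contract x (wedge A) = A x := by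
  ext v
  rw [contract_apply, wedge_apply]
  rw [Fin.sum_univ_succ]
  simp

/-- For `A = ξ ⊗ ω` the form `wedge A` is `ξ ∧ ω`, so this is the antiderivation rule. The term
feeding `x` to `A` splits off; the others shift by one place and change sign. -/
theorem contract_wedge {n : ℕ} (A : 𝔤 →ₗ[ℂ] Form 𝔤 (n + 1)) (x : 𝔤) :
    contract x (wedge A) = A x - wedge (contract x ∘ₗ A) := by
  ext v
  rw [contract_apply, wedge_apply, Fin.sum_univ_succ, AlternatingMap.sub_apply, wedge_apply,
    sub_eq_add_neg, ← Finset.sum_neg_distrib]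
  congr 1
  · simp
  · refine Finset.sum_congr rfl fun i _ => ?_
    simp only [Fin.val_succ, Matrix.cons_val_succ, LinearMap.comp_apply, contract_apply, pow_succ,
      mul_neg, mul_one, neg_smul]
    congr 3
    funext j
    refine Fin.cases ?_ (fun k => ?_) j
    · simp [Fin.removeNth]
    · simp [Fin.removeNth]

theorem wedge_wedge_eq_neg {n : ℕ} (B : 𝔤 →ₗ[ℂ] 𝔤 →ₗ[ℂ] Form 𝔤 n) :
    wedge (wedge ∘ₗ B) = -wedge (wedge ∘ₗ B.flip) := by
  rw [eq_neg_iff_add_eq_zero, ← map_add, ← LinearMap.comp_add]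
  exact alternatizeUncurryFin_alternatizeUncurryFinLM_comp_of_symmetric fun x y => by
    simp [add_comm]

theorem wedge_compLinearMap {𝔥 : Type} [AddCommGroup 𝔥] [Module ℂ 𝔥] {n : ℕ} (p : 𝔥 →ₗ[ℂ] 𝔤)
    (A : 𝔤 →ₗ[ℂ] Form 𝔤 n) (B : 𝔥 →ₗ[ℂ] Form 𝔥 n) (h : ∀ x, (A (p x)).compLinearMap p = B x) :
    (wedge A).compLinearMap p = wedge B := by
  ext v
  rw [AlternatingMap.compLinearMap_apply, wedge_apply, wedge_apply]
  refine Finset.sum_congr rfl fun i _ => ?_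
  rw [← h]
  rfl

theorem contract_compLinearMap {𝔥 : Type} [AddCommGroup 𝔥] [Module ℂ 𝔥] {n : ℕ} (p : 𝔥 →ₗ[ℂ] 𝔤)
    (f : Form 𝔤 (n + 1)) (x : 𝔥) :
    contract x (f.compLinearMap p) = (contract (p x) f).compLinearMap p :=
  curryLeft_compLinearMap p f x

end Cartan

/-! ### Lie derivatives, Cartan's formula and the Leibniz rule for the differential. -/

section CartanLie

open AlternatingMap

variable {𝔤 : Type} [LieRing 𝔤] [LieAlgebra ℂ 𝔤]

/-- The linear family `y ↦ contract ⁅x, y⁆ f`. -/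
abbrev contractLie {n : ℕ} (x : 𝔤) (f : Form 𝔤 (n + 1)) : 𝔤 →ₗ[ℂ] Form 𝔤 n :=
  f.curryLeft ∘ₗ (LieAlgebra.ad ℂ 𝔤 x : 𝔤 →ₗ[ℂ] 𝔤)

/-- The Lie derivative of forms along `x`. -/
def lieDer (x : 𝔤) : (n : ℕ) → Form 𝔤 n →ₗ[ℂ] Form 𝔤 n
  | 0 => 0
  | _ + 1 => -(wedge ∘ₗ LinearMap.lcomp ℂ _ (LieAlgebra.ad ℂ 𝔤 x : 𝔤 →ₗ[ℂ] 𝔤) ∘ₗ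
      curryLeftLinearMap)

theorem lieDer_zero (x : 𝔤) (f : Form 𝔤 0) : lieDer x 0 f = 0 := rfl

theorem lieDer_succ {n : ℕ} (x : 𝔤) (f : Form 𝔤 (n + 1)) :
    lieDer x (n + 1) f = -wedge (contractLie x f) := rfl

/-- The commutation rule `[ι_z, L_x] = ι_{[z,x]}`, from which the other properties of `lieDer`
follow by induction on the degree. -/
theorem contract_lieDer {n : ℕ} (z x : 𝔤) (f : Form 𝔤 (n + 1)) :
    contract z (lieDer x (n + 1) f) = contract ⁅z, x⁆ f + lieDer x n (contract z f) := by
  rw [lieDer_succ, map_neg]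
  cases n with
  | zero =>
    rw [contract_wedge_zero, lieDer_zero, add_zero, ← lie_skew z x, contract_neg]
    rfl
  | succ n =>
    have h : contract z ∘ₗ contractLie x f = -contractLie x (contract z f) := by
      ext1 y
      exact contract_contract _ _ _
    rw [contract_wedge, lieDer_succ, h, map_neg, sub_neg_eq_add, neg_add, ← lie_skew z x,
      contract_neg]
    rfl

/-- The Lie derivatives of a form, as a linear family. -/
def lieDerHom (n : ℕ) (f : Form 𝔤 n) : 𝔤 →ₗ[ℂ] Form 𝔤 n where
  toFun x := lieDer x n f
  map_add' x y := by
    cases n with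
    | zero => simp [lieDer_zero]
    | succ n =>
      simp only [lieDer_succ]
      rw [← neg_add, ← map_add]
      congr 2
      ext1 z
      simp
  map_smul' c x := by
    cases n with
    | zero => simp [lieDer_zero]
    | succ n =>
      simp only [lieDer_succ, RingHom.id_apply]
      rw [smul_neg, ← map_smul]
      congr 2
      ext1 z
      simp

/-- Antisymmetrizing `y ↦ L_y f` meets every pair of arguments twice, hence the factor `1/2`. -/
theorem differential_succ_eq {n : ℕ} (f : Form 𝔤 (n + 1)) :
    differential (n + 1) f = (1 / 2 : ℂ) • wedge (lieDerHom (n + 1) f) := by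
  ext x
  change differentialFun f x = _
  rw [differentialFun_eq]
  have : lieDerHom (n + 1) f = -(alternatizeUncurryFinLM ∘ₗ insertBracket f) := by
    ext1 y
    change lieDer y (n + 1) f = _
    rw [lieDer_succ]
    rfl
  rw [this, map_neg, smul_neg, ← neg_smul, neg_div]
  rfl

theorem differential_zero (f : Form 𝔤 0) : differential 0 f = 0 := rfl

/-- Cartan's formula. One half of `L_x f` is the term split off by `contract_wedge`, the other half
is the bracket term of `contract_lieDer`. -/
theorem contract_differential {n : ℕ} (x : 𝔤) (f : Form 𝔤 (n + 1)) :
    contract x (differential (n + 1) f) = lieDer x (n + 1) f - differential n (contract x f) := by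
  rw [differential_succ_eq, map_smul, contract_wedge]
  have h : contract x ∘ₗ lieDerHom (n + 1) f = contractLie x f + lieDerHom n (contract x f) := by
    ext1 y
    exact contract_lieDer x y f
  have h2 : wedge (contractLie x f) = -lieDer x (n + 1) f := by rw [lieDer_succ, neg_neg]
  have h3 : (1 / 2 : ℂ) • wedge (lieDerHom n (contract x f)) = differential n (contract x f) := by
    cases n with
    | zero =>
      have : lieDerHom 0 (contract x f) = 0 := rfl
      rw [this, _root_.map_zero, smul_zero]
      rfl
    | succ n => rw [differential_succ_eq]
  rw [h, map_add, h2, smul_sub, smul_add, h3]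
  change (1 / 2 : ℂ) • lieDer x (n + 1) f - _ = _
  module

theorem lieDer_lie {n : ℕ} (x y : 𝔤) (f : Form 𝔤 n) :
    lieDer x n (lieDer y n f) - lieDer y n (lieDer x n f) = lieDer ⁅x, y⁆ n f := by
  induction n with
  | zero => simp [lieDer_zero]
  | succ n ih =>
    refine form_ext fun z => ?_
    simp only [map_sub, contract_lieDer, ← ih, map_add]
    have : ⁅z, ⁅x, y⁆⁆ = ⁅⁅z, x⁆, y⁆ - ⁅⁅z, y⁆, x⁆ := by
      rw [leibniz_lie z x y, ← lie_skew x ⁅z, y⁆, sub_eq_add_neg]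
    rw [this, contract_sub]
    abel

theorem lieDer_differential {n : ℕ} (x : 𝔤) (f : Form 𝔤 n) :
    lieDer x (n + 1) (differential n f) = differential n (lieDer x n f) := by
  induction n with
  | zero => simp [differential_zero]
  | succ n ih =>
    refine form_ext fun z => ?_
    rw [contract_lieDer, contract_differential, contract_differential, contract_differential,
      contract_lieDer, map_sub, map_add, ih, ← lieDer_lie z x f]
    abel

/-- By Cartan's formula `ι_z d d = L_z d - d L_z + d d ι_z`; the first two terms cancel and the last
vanishes by induction. -/
theorem differential_differential {n : ℕ} (f : Form 𝔤 n) :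
    differential (n + 1) (differential n f) = 0 := by
  induction n with
  | zero => simp [differential_zero]
  | succ n ih =>
    refine form_ext fun z => ?_
    rw [contract_differential, contract_differential, lieDer_differential, map_sub, ih]
    simp

/-- The family `x ↦ ⁅z, x⁆`-variation of a linear family of forms. -/
theorem lieDer_wedge {n : ℕ} (z : 𝔤) (A : 𝔤 →ₗ[ℂ] Form 𝔤 n) :
    lieDer z (n + 1) (wedge A) =
      wedge (lieDer z n ∘ₗ A) - wedge (A ∘ₗ (LieAlgebra.ad ℂ 𝔤 z : 𝔤 →ₗ[ℂ] 𝔤)) := by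
  induction n with
  | zero =>
    refine form_ext fun w => ?_
    rw [contract_lieDer, map_sub, contract_wedge_zero, contract_wedge_zero, contract_wedge_zero,
      contract_wedge_zero, lieDer_zero, ← lie_skew w z]
    simp only [lieDer_zero, LinearMap.comp_apply, map_neg, add_zero, zero_sub]
    rfl
  | succ n ih =>
    refine form_ext fun w => ?_
    rw [contract_lieDer, map_sub, contract_wedge, contract_wedge, contract_wedge,
      contract_wedge, map_sub, ih]
    have h1 : contract w ∘ₗ lieDer z (n + 1) ∘ₗ A =
        contract ⁅w, z⁆ ∘ₗ A + lieDer z n ∘ₗ contract w ∘ₗ A := by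
      ext1 y
      exact contract_lieDer w z (A y)
    rw [h1, map_add, LinearMap.comp_assoc, ← lie_skew w z]
    simp only [map_neg, LinearMap.comp_apply, LieAlgebra.ad_apply]
    abel

/-- The bilinear family `(x, y) ↦ A ⁅x, y⁆`. -/
def lieFamily {n : ℕ} (A : 𝔤 →ₗ[ℂ] Form 𝔤 n) : 𝔤 →ₗ[ℂ] 𝔤 →ₗ[ℂ] Form 𝔤 n :=
  LinearMap.llcomp ℂ 𝔤 𝔤 (Form 𝔤 n) A ∘ₗ (LieAlgebra.ad ℂ 𝔤 : 𝔤 →ₗ[ℂ] Module.End ℂ 𝔤)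

/-- The Leibniz rule `d(ξ ∧ ω) = dξ ∧ ω - ξ ∧ dω` in families. Since `dξ(x, y) = -ξ([x, y])`, the
bracket family accounts for `dξ ∧ ω`, with `1/2` because it runs over ordered pairs. -/
theorem differential_wedge {n : ℕ} (A : 𝔤 →ₗ[ℂ] Form 𝔤 n) :
    differential (n + 1) (wedge A) =
      -wedge (differential n ∘ₗ A) - (1 / 2 : ℂ) • wedge (wedge ∘ₗ lieFamily A) := by
  induction n with
  | zero =>
    refine form_ext fun z => ?_
    have h0 : differential 0 ∘ₗ A = 0 := LinearMap.ext fun x => rfl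
    have h1 : contract z ∘ₗ wedge ∘ₗ lieFamily A = -(lieFamily A z) := by
      ext1 y
      simp only [LinearMap.comp_apply, contract_wedge_zero, LinearMap.neg_apply]
      change A ⁅y, z⁆ = -A ⁅z, y⁆
      rw [← lie_skew y z, map_neg]
    rw [contract_differential, h0, _root_.map_zero, neg_zero, zero_sub, map_neg, map_smul,
      contract_wedge, h1, lieDer_succ, differential_zero, map_neg]
    have h2 : contractLie z (wedge A) = lieFamily A z := by
      ext1 y
      exact contract_wedge_zero A _
    rw [h2]
    change -wedge (lieFamily A z) - 0 = -((1 / 2 : ℂ) • (wedge (lieFamily A z) - _))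
    module
  | succ n ih =>
    refine form_ext fun z => ?_
    have h1 : contract z ∘ₗ wedge ∘ₗ lieFamily A =
        -(lieFamily A z) - wedge ∘ₗ lieFamily (contract z ∘ₗ A) := by
      ext1 y
      simp only [LinearMap.comp_apply, contract_wedge, LinearMap.sub_apply, LinearMap.neg_apply]
      congr 1
      change A ⁅y, z⁆ = -A ⁅z, y⁆
      rw [← lie_skew y z, map_neg]
    have h3 : contract z ∘ₗ differential (n + 1) ∘ₗ A =
        lieDer z (n + 1) ∘ₗ A - differential n ∘ₗ contract z ∘ₗ A := by
      ext1 y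
      exact contract_differential z (A y)
    have h4 : A ∘ₗ (LieAlgebra.ad ℂ 𝔤 z : 𝔤 →ₗ[ℂ] 𝔤) = lieFamily A z := rfl
    rw [contract_differential, contract_wedge, map_sub, ih, lieDer_wedge, map_sub, map_neg,
      map_smul, contract_wedge, contract_wedge, h1, h3, map_sub, map_sub, map_neg, h4]
    simp only [LinearMap.comp_apply]
    module

end CartanLie

end

end FreeLieResolution

namespace FreeLieResolution

noncomputable section

/-! ### The free associative algebra and Fox derivatives -/

/-- The free associative algebra on `m` generators, the enveloping algebra of `FreeLie m`. -/
abbrev FreeAssoc (m : ℕ) : Type := FreeAlgebra ℂ (Fin m)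

variable {m : ℕ}

theorem FreeAssoc.induction {P : FreeAssoc m → Prop} (h0 : ∀ r : ℂ, P (algebraMap ℂ _ r))
    (h1 : ∀ i, P (FreeAlgebra.ι ℂ i)) (hmul : ∀ a b, P a → P b → P (a * b))
    (hadd : ∀ a b, P a → P b → P (a + b)) (u : FreeAssoc m) : P u :=
  FreeAlgebra.induction ℂ (Fin m) h0 h1 hmul hadd u

/-- The augmentation of the free associative algebra. -/
def aug : FreeAssoc m →ₐ[ℂ] ℂ := FreeAlgebra.lift ℂ fun _ => 0

theorem aug_ι (i : Fin m) : aug (FreeAlgebra.ι ℂ i) = 0 := by simp [aug]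

/-- The representation of the free associative algebra from which Fox derivatives are read off. -/
def foxHom : FreeAssoc m →ₐ[ℂ] Module.End ℂ ((Fin m → FreeAssoc m) × ℂ) :=
  FreeAlgebra.lift ℂ fun j =>
    { toFun := fun p => (fun i => FreeAlgebra.ι ℂ j * p.1 i +
        p.2 • (Pi.single j 1 : Fin m → FreeAssoc m) i, 0)
      map_add' := fun p q => by
        ext i
        · simp [mul_add, add_smul]; abel
        · simp
      map_smul' := fun c p => by
        ext i
        · simp [mul_smul, smul_add]
        · simp }

/-- The Fox derivatives: `u = ε(u) + ∑ j, δ_j(u) x_j`. -/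
def fox (j : Fin m) : FreeAssoc m →ₗ[ℂ] FreeAssoc m :=
  LinearMap.proj j ∘ₗ LinearMap.fst ℂ _ _ ∘ₗ LinearMap.applyₗ (0, 1) ∘ₗ foxHom.toLinearMap

theorem fox_eq (j : Fin m) (u : FreeAssoc m) : fox j u = (foxHom u (0, 1)).1 j := rfl

/-- `foxHom` is an extension of the augmentation module `ℂ` by a free module of rank `m`, and `fox`
is its cocycle. The derivation rule `fox_mul` is the multiplicativity of `foxHom`. -/
theorem foxHom_apply (u : FreeAssoc m) (p : (Fin m → FreeAssoc m) × ℂ) :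
    foxHom u p = (fun i => u * p.1 i + p.2 • fox i u, aug u * p.2) := by
  induction u using FreeAssoc.induction generalizing p with
  | h0 r =>
    simp only [fox_eq, AlgHom.commutes, Module.algebraMap_end_apply]
    ext i
    · simp [Algebra.smul_def]
    · simp
  | h1 j =>
    simp only [fox_eq]
    simp [foxHom, aug]
  | hmul a b ha hb =>
    have h : ∀ i, fox i (a * b) = a * fox i b + aug b • fox i a := by
      intro i
      rw [fox_eq, map_mul, Module.End.mul_apply, hb, ha]
      simp
    rw [map_mul, Module.End.mul_apply, hb, ha]
    ext i
    · simp only [h, mul_add, smul_add, mul_assoc, mul_smul_comm, smul_smul]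
      rw [add_assoc, mul_comm]
    · simp [mul_assoc]
  | hadd a b ha hb =>
    rw [map_add, LinearMap.add_apply, ha, hb]
    ext i
    · simp only [Prod.fst_add, Pi.add_apply, map_add, add_mul, smul_add]
      abel
    · simp [add_mul]

theorem fox_mul (i : Fin m) (a b : FreeAssoc m) :
    fox i (a * b) = a * fox i b + aug b • fox i a := by
  rw [fox_eq, map_mul, Module.End.mul_apply, foxHom_apply b, foxHom_apply a]
  simp

theorem fox_algebraMap (i : Fin m) (r : ℂ) : fox i (algebraMap ℂ _ r) = 0 := by
  simp [fox_eq]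

theorem fox_one (i : Fin m) : fox i (1 : FreeAssoc m) = 0 := by
  simpa using fox_algebraMap i 1

theorem fox_ι (i j : Fin m) : fox i (FreeAlgebra.ι ℂ j) = (Pi.single j 1 : Fin m → FreeAssoc m) i := by
  simp [fox_eq, foxHom]

theorem fox_mul_ι (i j : Fin m) (u : FreeAssoc m) :
    fox i (u * FreeAlgebra.ι ℂ j) = (Pi.single j u : Fin m → FreeAssoc m) i := by
  rw [fox_mul, fox_ι, aug_ι, zero_smul, add_zero]
  by_cases h : i = j
  · subst h; simp
  · simp [h]

/-- With `fox_mul_ι` for uniqueness, this makes the augmentation ideal the free left module on the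
generators. The resulting resolution of `ℂ` of length one is what drives the induction on the
weight. -/
theorem eq_aug_add_sum_fox (u : FreeAssoc m) :
    u = algebraMap ℂ _ (aug u) + ∑ j, fox j u * FreeAlgebra.ι ℂ j := by
  induction u using FreeAssoc.induction with
  | h0 r => simp [fox_algebraMap]
  | h1 i =>
    rw [aug_ι, map_zero, zero_add, Finset.sum_eq_single i]
    · simp [fox_ι]
    · intro j _ hj; simp [fox_ι, hj]
    · simp
  | hmul a b _ hb =>
    rename_i ha
    conv_lhs => rw [hb, mul_add, Finset.mul_sum]
    simp only [fox_mul, add_mul, Finset.sum_add_distrib, smul_mul_assoc, ← Finset.smul_sum,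
      ← mul_assoc, map_mul]
    rw [add_comm, add_left_comm]
    congr 1
    conv_lhs => rw [ha, add_mul, ← map_mul]
    rw [Algebra.smul_def, map_mul, ← Algebra.commutes (aug b) (∑ j, _), Algebra.commutes (aug b)]
  | hadd a b ha hb =>
    conv_lhs => rw [ha, hb]
    simp only [map_add, add_mul, Finset.sum_add_distrib]
    abel

/-- The endomorphism of the free associative algebra given by a matrix. -/
def assocMap (A : Matrix (Fin m) (Fin m) ℂ) : FreeAssoc m →ₐ[ℂ] FreeAssoc m :=
  FreeAlgebra.lift ℂ fun j => ∑ i, A i j • FreeAlgebra.ι ℂ i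

theorem assocMap_ι (A : Matrix (Fin m) (Fin m) ℂ) (j : Fin m) :
    assocMap A (FreeAlgebra.ι ℂ j) = ∑ i, A i j • FreeAlgebra.ι ℂ i := by
  simp [assocMap]

theorem aug_assocMap (A : Matrix (Fin m) (Fin m) ℂ) (u : FreeAssoc m) :
    aug (assocMap A u) = aug u := by
  have : aug.comp (assocMap A) = aug := by
    ext j
    simp [assocMap_ι, aug_ι]
  exact DFunLike.congr_fun this u

theorem fox_assocMap (A : Matrix (Fin m) (Fin m) ℂ) (j : Fin m) (u : FreeAssoc m) :
    fox j (assocMap A u) = ∑ l, A j l • assocMap A (fox l u) := by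
  induction u using FreeAssoc.induction with
  | h0 r => simp [fox_algebraMap]
  | h1 i =>
    rw [assocMap_ι, map_sum, Finset.sum_eq_single j, Finset.sum_eq_single i]
    · simp [fox_ι]
    · intro l _ hl; simp [fox_ι, hl]
    · simp
    · intro l _ hl; simp [fox_ι, hl.symm]
    · simp
  | hmul a b ha hb =>
    simp only [map_mul, fox_mul, map_add, ha, hb, aug_assocMap, Finset.mul_sum, Finset.smul_sum,
      smul_add, Finset.sum_add_distrib, mul_smul_comm, map_smul]
    congr 1
    exact Finset.sum_congr rfl fun l _ => smul_comm _ _ _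
  | hadd a b ha hb => simp only [map_add, ha, hb, smul_add, Finset.sum_add_distrib]

/-! ### The free Lie algebra -/

attribute [local instance] LieRing.ofAssociativeRing

theorem freeLie_eq_top (K : LieSubalgebra ℂ (FreeLie m)) (h : ∀ i, FreeLieAlgebra.of ℂ i ∈ K) :
    K = ⊤ := by
  have h1 : K.incl.comp (FreeLieAlgebra.lift ℂ fun i => (⟨_, h i⟩ : K)) = LieHom.id := by
    ext i
    simp
  rw [eq_top_iff]
  intro x _
  rw [← LieHom.id_apply (R := ℂ) x, ← h1]
  exact (FreeLieAlgebra.lift ℂ (fun i => (⟨_, h i⟩ : K)) x).2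

theorem freeLie_induction {P : FreeLie m → Prop} (h1 : ∀ i, P (FreeLieAlgebra.of ℂ i)) (h0 : P 0)
    (hadd : ∀ a b, P a → P b → P (a + b)) (hsmul : ∀ (c : ℂ) a, P a → P (c • a))
    (hlie : ∀ a b, P a → P b → P ⁅a, b⁆) (x : FreeLie m) : P x := by
  let K : LieSubalgebra ℂ (FreeLie m) :=
    { carrier := {x | P x}
      add_mem' := fun ha hb => hadd _ _ ha hb
      zero_mem' := h0
      smul_mem' := fun c _ ha => hsmul c _ ha
      lie_mem' := fun ha hb => hlie _ _ ha hb }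
  have : x ∈ K := by rw [freeLie_eq_top K h1]; trivial
  exact this

/-- The embedding of the free Lie algebra into the free associative algebra, as a morphism of Lie
algebras. -/
def toAssocHom : FreeLie m →ₗ⁅ℂ⁆ FreeAssoc m := FreeLieAlgebra.lift ℂ (FreeAlgebra.ι ℂ)

/-- The embedding of the free Lie algebra into the free associative algebra. -/
def toAssoc : FreeLie m →ₗ[ℂ] FreeAssoc m := toAssocHom.toLinearMap

theorem toAssoc_of (i : Fin m) : toAssoc (FreeLieAlgebra.of ℂ i) = FreeAlgebra.ι ℂ i := by
  simp [toAssoc, toAssocHom]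

theorem toAssoc_lie (x y : FreeLie m) :
    toAssoc ⁅x, y⁆ = toAssoc x * toAssoc y - toAssoc y * toAssoc x := by
  change toAssocHom ⁅x, y⁆ = _
  rw [LieHom.map_lie, LieRing.of_associative_ring_bracket]
  rfl

theorem aug_toAssoc (x : FreeLie m) : aug (toAssoc x) = 0 := by
  induction x using freeLie_induction with
  | h1 i => rw [toAssoc_of, aug_ι]
  | h0 => simp
  | hadd a b ha hb => simp [ha, hb]
  | hsmul c a ha => simp [ha]
  | hlie a b ha hb => rw [toAssoc_lie, map_sub, map_mul, map_mul, ha, hb]; simp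

theorem toAssoc_freeMap (A : Matrix (Fin m) (Fin m) ℂ) (x : FreeLie m) :
    toAssoc (freeMap A x) = assocMap A (toAssoc x) := by
  induction x using freeLie_induction with
  | h1 i => simp [freeMap, toAssoc_of, assocMap_ι]
  | h0 => simp
  | hadd a b ha hb => simp [ha, hb]
  | hsmul c a ha => simp [ha]
  | hlie a b ha hb => simp only [LieHom.map_lie (freeMap A), toAssoc_lie, ha, hb, map_sub, map_mul]

/-- The adjoint action of the free associative algebra on the free Lie algebra. -/
def adHom : FreeAssoc m →ₐ[ℂ] Module.End ℂ (FreeLie m) :=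
  FreeAlgebra.lift ℂ fun j => LieAlgebra.ad ℂ (FreeLie m) (FreeLieAlgebra.of ℂ j)

theorem adHom_ι (j : Fin m) (y : FreeLie m) :
    adHom (FreeAlgebra.ι ℂ j) y = ⁅FreeLieAlgebra.of ℂ j, y⁆ := by
  simp [adHom]

theorem adHom_toAssoc (x y : FreeLie m) : adHom (toAssoc x) y = ⁅x, y⁆ := by
  induction x using freeLie_induction generalizing y with
  | h1 i => rw [toAssoc_of, adHom_ι]
  | h0 => simp
  | hadd a b ha hb => simp [ha, hb]
  | hsmul c a ha => simp [ha]
  | hlie a b ha hb =>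
    rw [toAssoc_lie, map_sub, map_mul, map_mul, LinearMap.sub_apply, Module.End.mul_apply,
      Module.End.mul_apply, hb, ha, ha, hb, lie_lie]

theorem freeMap_of (A : Matrix (Fin m) (Fin m) ℂ) (j : Fin m) :
    freeMap A (FreeLieAlgebra.of ℂ j) = ∑ i, A i j • FreeLieAlgebra.of ℂ i := by
  simp [freeMap]

theorem freeMap_adHom (A : Matrix (Fin m) (Fin m) ℂ) (u : FreeAssoc m) (y : FreeLie m) :
    freeMap A (adHom u y) = adHom (assocMap A u) (freeMap A y) := by
  induction u using FreeAssoc.induction generalizing y with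
  | h0 r => simp
  | h1 i =>
    rw [adHom_ι, LieHom.map_lie, freeMap_of, assocMap_ι]
    simp [adHom_ι, sum_lie, map_sum]
  | hmul a b ha hb => simp [ha, hb]
  | hadd a b ha hb => simp [ha, hb]

/-- The Euler derivation, multiplying by the degree, in terms of Fox derivatives. -/
def euler : FreeLie m →ₗ[ℂ] FreeLie m :=
  ∑ j, LinearMap.applyₗ (FreeLieAlgebra.of ℂ j) ∘ₗ adHom.toLinearMap ∘ₗ fox j ∘ₗ
    toAssoc

theorem euler_apply (x : FreeLie m) :
    euler x = ∑ j, adHom (fox j (toAssoc x)) (FreeLieAlgebra.of ℂ j) := by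
  simp [euler]

theorem fox_toAssoc_lie (j : Fin m) (x y : FreeLie m) :
    fox j (toAssoc ⁅x, y⁆) = toAssoc x * fox j (toAssoc y) - toAssoc y * fox j (toAssoc x) := by
  rw [toAssoc_lie, map_sub, fox_mul, fox_mul, aug_toAssoc, aug_toAssoc]
  simp

theorem euler_of (i : Fin m) : euler (FreeLieAlgebra.of ℂ i) = FreeLieAlgebra.of ℂ i := by
  rw [euler_apply, Finset.sum_eq_single i]
  · simp [toAssoc_of, fox_ι]
  · intro j _ hj; simp [toAssoc_of, fox_ι, hj]
  · simp

/-- Lie elements have no constant term, so the augmentation terms of the Fox rule drop out and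
`fox_toAssoc_lie` gives a derivation. Hence `euler` multiplies a bracket by its length, the number
later divided out. -/
theorem euler_lie (x y : FreeLie m) : euler ⁅x, y⁆ = ⁅x, euler y⁆ + ⁅euler x, y⁆ := by
  simp only [euler_apply, fox_toAssoc_lie, map_sub, LinearMap.sub_apply, map_mul,
    Module.End.mul_apply, adHom_toAssoc, Finset.sum_sub_distrib, ← lie_sum]
  rw [← lie_skew y, sub_neg_eq_add]

/-- Right-normed brackets of generators, indexed by nonempty words. -/
def lieWord (j : Fin m) : List (Fin m) → FreeLie m
  | [] => FreeLieAlgebra.of ℂ j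
  | i :: w => ⁅FreeLieAlgebra.of ℂ i, lieWord j w⁆

theorem euler_lieWord (j : Fin m) (w : List (Fin m)) :
    euler (lieWord j w) = ((w.length + 1 : ℕ) : ℂ) • lieWord j w := by
  induction w with
  | nil => simp [lieWord, euler_of]
  | cons i w ih =>
    rw [lieWord, euler_lie, ih, euler_of, lie_smul, List.length_cons]
    push_cast
    module

/-- The span is stable under `ad` of generators by construction, hence under `ad` of every element
by the Jacobi identity. -/
theorem span_lieWord :
    Submodule.span ℂ (Set.range fun p : Fin m × List (Fin m) => lieWord p.1 p.2) = ⊤ := by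
  set M := Submodule.span ℂ (Set.range fun p : Fin m × List (Fin m) => lieWord p.1 p.2)
  have hof : ∀ (i : Fin m) (y : FreeLie m), y ∈ M → ⁅(FreeLieAlgebra.of ℂ i : FreeLie m), y⁆ ∈ M := by
    intro i y hy
    induction hy using Submodule.span_induction with
    | mem x hx =>
      obtain ⟨⟨j, w⟩, rfl⟩ := hx
      exact Submodule.subset_span ⟨⟨j, i :: w⟩, rfl⟩
    | zero => simp
    | add x y _ _ hx hy => rw [lie_add]; exact add_mem hx hy
    | smul c x _ hx => rw [lie_smul]; exact M.smul_mem c hx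
  have hlie : ∀ x y : FreeLie m, y ∈ M → ⁅x, y⁆ ∈ M := by
    intro x
    induction x using freeLie_induction with
    | h1 i => exact hof i
    | h0 => simp
    | hadd a b ha hb => intro y hy; rw [add_lie]; exact add_mem (ha y hy) (hb y hy)
    | hsmul c a ha => intro y hy; rw [smul_lie]; exact M.smul_mem c (ha y hy)
    | hlie a b ha hb =>
      intro y hy
      rw [lie_lie]
      exact sub_mem (ha _ (hb y hy)) (hb _ (ha y hy))
  rw [eq_top_iff]
  intro x _
  induction x using freeLie_induction with
  | h1 i => exact Submodule.subset_span ⟨⟨i, []⟩, rfl⟩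
  | h0 => exact zero_mem _
  | hadd a b ha hb => exact add_mem (ha trivial) (hb trivial)
  | hsmul c a ha => exact M.smul_mem c (ha trivial)
  | hlie a b ha hb => exact hlie a b (hb trivial)

/-- Monomials of the free associative algebra. -/
def assocWord (w : List (Fin m)) : FreeAssoc m := (w.map (FreeAlgebra.ι ℂ)).prod

theorem span_assocWord :
    Submodule.span ℂ (Set.range (assocWord : List (Fin m) → FreeAssoc m)) = ⊤ := by
  set M := Submodule.span ℂ (Set.range (assocWord : List (Fin m) → FreeAssoc m))
  have h1 : (1 : FreeAssoc m) ∈ M := Submodule.subset_span ⟨[], by simp [assocWord]⟩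
  have hof : ∀ i y, y ∈ M → FreeAlgebra.ι ℂ i * y ∈ M := by
    intro i y hy
    induction hy using Submodule.span_induction with
    | mem x hx =>
      obtain ⟨w, rfl⟩ := hx
      exact Submodule.subset_span ⟨i :: w, by simp [assocWord]⟩
    | zero => simp
    | add x y _ _ hx hy => rw [mul_add]; exact add_mem hx hy
    | smul c x _ hx => rw [mul_smul_comm]; exact M.smul_mem c hx
  have hmul : ∀ x y, y ∈ M → x * y ∈ M := by
    intro x
    induction x using FreeAssoc.induction with
    | h0 r => intro y hy; rw [← Algebra.smul_def]; exact M.smul_mem r hy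
    | h1 i => exact hof i
    | hmul a b ha hb => intro y hy; rw [mul_assoc]; exact ha _ (hb y hy)
    | hadd a b ha hb => intro y hy; rw [add_mul]; exact add_mem (ha y hy) (hb y hy)
  rw [eq_top_iff]
  intro x _
  simpa using hmul x 1 h1

/-- The scalar matrix `2`, used to detect degrees. -/
def twoGL (m : ℕ) : GL (Fin m) ℂ :=
  Units.map (Matrix.scalar (Fin m)).toMonoidHom (Units.mk0 (2 : ℂ) two_ne_zero)

theorem twoGL_apply (i j : Fin m) :
    (twoGL m).val i j = if i = j then 2 else 0 := by
  change (Matrix.scalar (Fin m) (2 : ℂ)) i j = _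
  simp [Matrix.diagonal_apply]

theorem freeMap_twoGL_lieWord (j : Fin m) (w : List (Fin m)) :
    freeMap (twoGL m).val (lieWord j w) = (2 : ℂ) ^ (w.length + 1) • lieWord j w := by
  have h : ∀ i, freeMap (twoGL m).val (FreeLieAlgebra.of ℂ i) =
      (2 : ℂ) • FreeLieAlgebra.of ℂ i := by
    intro i
    rw [freeMap_of]
    simp [twoGL_apply]
  induction w with
  | nil => simp [lieWord, h]
  | cons i w ih =>
    rw [lieWord, LieHom.map_lie, ih, h, smul_lie, lie_smul, smul_smul, List.length_cons,
      pow_succ' _ (w.length + 1)]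

theorem assocMap_twoGL_assocWord (w : List (Fin m)) :
    assocMap (twoGL m).val (assocWord w) = (2 : ℂ) ^ w.length • assocWord w := by
  have h : ∀ i, assocMap (twoGL m).val (FreeAlgebra.ι ℂ i) = (2 : ℂ) • FreeAlgebra.ι ℂ i := by
    intro i
    rw [assocMap_ι]
    simp [twoGL_apply]
  induction w with
  | nil => simp [assocWord]
  | cons i w ih =>
    have hc : assocWord (i :: w) = FreeAlgebra.ι ℂ i * assocWord w := by simp [assocWord]
    rw [hc, map_mul, ih, h, smul_mul_smul_comm, List.length_cons, pow_succ']

end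

end FreeLieResolution

namespace FreeLieResolution

noncomputable section

/-! ### Sums of copies of the free Lie algebra -/

section FreeLieSumBasic

variable {m n : ℕ}

/-- The inclusion of the copy of colour `c`. -/
def inc (c : Fin n) : FreeLie m →ₗ[ℂ] FreeLieSum m n :=
  DirectSum.lof ℂ (Fin n) (fun _ => FreeLie m) c

/-- The projection to the copy of colour `c`. -/
def proj (c : Fin n) : FreeLieSum m n →ₗ[ℂ] FreeLie m :=
  DirectSum.component ℂ (Fin n) (fun _ => FreeLie m) c

theorem proj_apply (c : Fin n) (x : FreeLieSum m n) : proj c x = x c := rfl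

theorem proj_inc (c : Fin n) (x : FreeLie m) : proj c (inc c x) = x := by
  rw [proj_apply, inc, DirectSum.lof_apply]

theorem proj_inc_ne {c d : Fin n} (h : c ≠ d) (x : FreeLie m) : proj c (inc d x) = 0 := by
  rw [proj_apply, inc, DirectSum.lof_eq_of, DirectSum.of_eq_of_ne _ _ _ h]

theorem freeLieSum_ext {x y : FreeLieSum m n} (h : ∀ c, proj c x = proj c y) : x = y :=
  DFinsupp.ext h

theorem proj_lie (c : Fin n) (x y : FreeLieSum m n) : proj c ⁅x, y⁆ = ⁅proj c x, proj c y⁆ := by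
  rw [proj_apply, DirectSum.bracket_apply]
  rfl

theorem lie_inc (c : Fin n) (x : FreeLieSum m n) (b : FreeLie m) :
    ⁅x, inc c b⁆ = inc c ⁅proj c x, b⁆ := by
  refine freeLieSum_ext fun d => ?_
  rw [proj_lie]
  by_cases h : d = c
  · subst h; simp only [proj_inc]
  · simp only [proj_inc_ne h, lie_zero]

theorem lie_inc_inc_of_ne {c d : Fin n} (h : c ≠ d) (a b : FreeLie m) :
    ⁅(inc c a : FreeLieSum m n), (inc d b : FreeLieSum m n)⁆ = 0 := by
  rw [lie_inc, proj_inc_ne h.symm, zero_lie, map_zero]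

theorem sum_inc_proj (x : FreeLieSum m n) : ∑ c, inc c (proj c x) = x := by
  refine freeLieSum_ext fun d => ?_
  rw [map_sum, Finset.sum_eq_single d]
  · rw [proj_inc]
  · intro c _ hc; rw [proj_inc_ne hc.symm]
  · simp

theorem glVRep_inc (A : GL (Fin m) ℂ) (c : Fin n) (x : FreeLie m) :
    glVRep m n A (inc c x) = inc c (freeMap A.val x) := by
  refine freeLieSum_ext fun d => ?_
  change freeMap A.val (proj d (inc c x)) = _
  by_cases h : d = c
  · subst h; rw [proj_inc, proj_inc]
  · rw [proj_inc_ne h, proj_inc_ne h, map_zero]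

theorem proj_glVRep (A : GL (Fin m) ℂ) (c : Fin n) (x : FreeLieSum m n) :
    proj c (glVRep m n A x) = freeMap A.val (proj c x) := rfl

/-- The generators of the copy of colour `c`. -/
def gen (c : Fin n) (j : Fin m) : FreeLieSum m n := inc c (FreeLieAlgebra.of ℂ j)

theorem span_inc_lieWord :
    Submodule.span ℂ (Set.range fun p : Fin n × Fin m × List (Fin m) =>
      (inc p.1 (lieWord p.2.1 p.2.2) : FreeLieSum m n)) = ⊤ := by
  rw [eq_top_iff]
  intro x _
  rw [← sum_inc_proj x]
  refine sum_mem fun c _ => ?_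
  have h : proj c x ∈ Submodule.span ℂ
      (Set.range fun p : Fin m × List (Fin m) => lieWord p.1 p.2) := by
    rw [span_lieWord]; trivial
  generalize proj c x = y at h
  induction h using Submodule.span_induction with
  | mem x hx =>
    obtain ⟨⟨j, w⟩, rfl⟩ := hx
    exact Submodule.subset_span ⟨⟨c, j, w⟩, rfl⟩
  | zero => rw [map_zero]; exact zero_mem _
  | add x y _ _ hx hy => rw [map_add]; exact add_mem hx hy
  | smul a x _ hx => rw [map_smul]; exact Submodule.smul_mem _ a hx

theorem form_eq_zero_of_words {i : ℕ} (f : Form (FreeLieSum m n) i)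
    (h : ∀ p : Fin i → Fin n × Fin m × List (Fin m),
      f (fun a => inc (p a).1 (lieWord (p a).2.1 (p a).2.2)) = 0) : f = 0 := by
  have := MultilinearMap.ext_of_span_eq_top (R := ℂ) (φ := f.toMultilinearMap) (φ' := 0)
    (fun _ : Fin i => span_inc_lieWord (m := m) (n := n)) h
  ext x
  exact congrArg (fun F : MultilinearMap ℂ _ ℂ => F x) this

/-- The Euler derivation of a sum of copies of the free Lie algebra. -/
def gEuler : FreeLieSum m n →ₗ[ℂ] FreeLieSum m n := ∑ c, inc c ∘ₗ euler ∘ₗ proj c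

theorem gEuler_inc_lieWord (c : Fin n) (j : Fin m) (w : List (Fin m)) :
    (gEuler (inc c (lieWord j w)) : FreeLieSum m n) =
      ((w.length + 1 : ℕ) : ℂ) • inc c (lieWord j w) := by
  rw [gEuler, LinearMap.sum_apply, Finset.sum_eq_single c]
  · rw [LinearMap.comp_apply, LinearMap.comp_apply, proj_inc, euler_lieWord, map_smul]
  · intro d _ hd
    rw [LinearMap.comp_apply, LinearMap.comp_apply, proj_inc_ne hd, map_zero, map_zero]
  · simp

end FreeLieSumBasic

theorem differential_compLinearMap {𝔤 𝔥 : Type} [LieRing 𝔤] [LieAlgebra ℂ 𝔤] [LieRing 𝔥]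
    [LieAlgebra ℂ 𝔥] (p : 𝔥 →ₗ[ℂ] 𝔤) (hp : ∀ x y, p ⁅x, y⁆ = ⁅p x, p y⁆) {i : ℕ} (f : Form 𝔤 i) :
    differential i (f.compLinearMap p) = (differential i f).compLinearMap p := by
  cases i with
  | zero => rfl
  | succ i =>
    ext x
    change differentialFun (f.compLinearMap p) x = differentialFun f (fun a => p (x a))
    refine Finset.sum_congr rfl fun k _ => Finset.sum_congr rfl fun j _ => ?_
    congr 1
    rw [AlternatingMap.compLinearMap_apply]
    congr 1
    funext a
    refine Fin.cases ?_ (fun b => ?_) a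
    · simp [hp]
    · simp [Fin.removeNth]

/-- Elements of different copies of `L` commute, so values on tuples of distinct colours are
invariants of cohomology classes. -/
theorem differential_eq_zero_of_lie_eq_zero {𝔤 : Type} [LieRing 𝔤] [LieAlgebra ℂ 𝔤] {i : ℕ}
    (f : Form 𝔤 i) (x : Fin (i + 1) → 𝔤) (hx : ∀ a b, a ≠ b → ⁅x a, x b⁆ = 0) :
    differential i f x = 0 := by
  cases i with
  | zero => rfl
  | succ i =>
    change differentialFun f x = 0
    refine Finset.sum_eq_zero fun k _ => Finset.sum_eq_zero fun j hj => ?_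
    have hkj : k.castSucc ≠ j.succ := by
      rw [Finset.mem_Ici] at hj
      exact (Fin.castSucc_lt_succ_iff.2 hj).ne
    rw [hx _ _ hkj]
    have : f (Matrix.vecCons 0 (j.removeNth (k.castSucc.removeNth x))) = 0 :=
      f.map_coord_zero 0 rfl
    rw [this, mul_zero]

/-! ### Forms with coefficients in the free associative algebra -/

section Twisted

variable {m n : ℕ}

/-- The action of the copy of colour `c` by left multiplication on the coefficients. -/
def coeffAct {i : ℕ} (c : Fin n) (B : FreeAssoc m →ₗ[ℂ] Form (FreeLieSum m n) i)
    (u : FreeAssoc m) : FreeLieSum m n →ₗ[ℂ] Form (FreeLieSum m n) i :=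
  B ∘ₗ LinearMap.mulRight ℂ u ∘ₗ toAssoc ∘ₗ proj c

theorem coeffAct_apply {i : ℕ} (c : Fin n) (B : FreeAssoc m →ₗ[ℂ] Form (FreeLieSum m n) i)
    (u : FreeAssoc m) (y : FreeLieSum m n) :
    coeffAct c B u y = B (toAssoc (proj c y) * u) := rfl

/-- The Chevalley–Eilenberg differential with coefficients in the dual of the free associative
algebra, on which the copy of colour `c` acts. -/
def twDiff {i : ℕ} (c : Fin n) : (FreeAssoc m →ₗ[ℂ] Form (FreeLieSum m n) i) →ₗ[ℂ]
    FreeAssoc m →ₗ[ℂ] Form (FreeLieSum m n) (i + 1) :=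
  LinearMap.mk₂ ℂ (fun B u => differential i (B u) - wedge (coeffAct c B u))
    (fun B B' u => by
      have : coeffAct c (B + B') u = coeffAct c B u + coeffAct c B' u := rfl
      rw [this, map_add, LinearMap.add_apply, map_add]; abel)
    (fun a B u => by
      have : coeffAct c (a • B) u = a • coeffAct c B u := rfl
      rw [this, map_smul, LinearMap.smul_apply, map_smul, smul_sub])
    (fun B u u' => by
      have : coeffAct c B (u + u') = coeffAct c B u + coeffAct c B u' := by
        refine LinearMap.ext fun y => ?_; simp [coeffAct_apply, mul_add]
      rw [this, map_add, map_add, map_add]; abel)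
    (fun a B u => by
      have : coeffAct c B (a • u) = a • coeffAct c B u := by
        refine LinearMap.ext fun y => ?_; simp [coeffAct_apply]
      rw [this, map_smul, map_smul, map_smul, smul_sub])

theorem twDiff_apply {i : ℕ} (c : Fin n) (B : FreeAssoc m →ₗ[ℂ] Form (FreeLieSum m n) i)
    (u : FreeAssoc m) : twDiff c B u = differential i (B u) - wedge (coeffAct c B u) := rfl

/-- The two halves of a commutator contribute equally after double antisymmetrization, which absorbs
the `1/2` of `differential_wedge`. -/
theorem half_wedge_wedge {𝔤 : Type} [AddCommGroup 𝔤] [Module ℂ 𝔤] {i : ℕ}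
    (B : 𝔤 →ₗ[ℂ] 𝔤 →ₗ[ℂ] Form 𝔤 i) :
    (1 / 2 : ℂ) • wedge (wedge ∘ₗ (B - B.flip)) = wedge (wedge ∘ₗ B) := by
  rw [LinearMap.comp_sub, map_sub, wedge_wedge_eq_neg B.flip, LinearMap.flip_flip]
  module

theorem twDiff_twDiff {i : ℕ} (c : Fin n) (B : FreeAssoc m →ₗ[ℂ] Form (FreeLieSum m n) i) :
    twDiff c (twDiff c B) = 0 := by
  ext1 u
  -- Two successive actions on the coefficient. The commutator of `G` is the action of the bracket
  -- because `toAssoc` is a morphism of Lie algebras, so it cancels the bracket term of the Leibniz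
  -- rule.
  let G : FreeLieSum m n →ₗ[ℂ] FreeLieSum m n →ₗ[ℂ] Form (FreeLieSum m n) i :=
    LinearMap.mk₂ ℂ (fun x y => B (toAssoc (proj c x) * (toAssoc (proj c y) * u)))
      (by intros; simp [add_mul]) (by intros; simp) (by intros; simp [add_mul, mul_add])
      (by intros; simp)
  have h1 : lieFamily (coeffAct c B u) = G - G.flip := by
    refine LinearMap.ext fun x => LinearMap.ext fun y => ?_
    change B (toAssoc (proj c ⁅x, y⁆) * u) = B _ - B _
    rw [proj_lie, toAssoc_lie, sub_mul, map_sub, mul_assoc, mul_assoc]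
  have h2 : coeffAct c (twDiff c B) u =
      differential i ∘ₗ coeffAct c B u - wedge ∘ₗ G.flip := by
    refine LinearMap.ext fun y => ?_
    rfl
  rw [twDiff_apply, twDiff_apply, map_sub, differential_differential, differential_wedge, h1, h2,
    half_wedge_wedge, map_sub, wedge_wedge_eq_neg G.flip, LinearMap.flip_flip, LinearMap.zero_apply]
  abel

/-- Contraction of a form with `ad(u) v`, as a function of `u`. -/
def contractAd {i : ℕ} (c : Fin n) (v : FreeLie m) :
    Form (FreeLieSum m n) (i + 1) →ₗ[ℂ] FreeAssoc m →ₗ[ℂ] Form (FreeLieSum m n) i :=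
  LinearMap.mk₂ ℂ (fun f u => contract (inc c (adHom u v)) f)
    (by intros; simp) (by intros; simp)
    (by intros; simp [contract_add]) (by intros; simp [contract_smul])

theorem contractAd_apply {i : ℕ} (c : Fin n) (v : FreeLie m) (f : Form (FreeLieSum m n) (i + 1))
    (u : FreeAssoc m) : contractAd c v f u = contract (inc c (adHom u v)) f := rfl

/-- Cartan's formula along the vector `inc c (adHom u v)`: the action on the coefficient `u` moves
this vector by brackets, so the coefficient part of `twDiff` supplies the Lie derivative. -/
theorem twDiff_contractAd {i : ℕ} (c : Fin n) (v : FreeLie m)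
    (f : Form (FreeLieSum m n) (i + 1)) :
    twDiff c (contractAd c v f) = -contractAd c v (differential (i + 1) f) := by
  ext1 u
  have h : coeffAct c (contractAd c v f) u = -contractLie (inc c (adHom u v)) f := by
    refine LinearMap.ext fun y => ?_
    change contract (inc c (adHom (toAssoc (proj c y) * u) v)) f =
      -contract ⁅inc c (adHom u v), y⁆ f
    rw [map_mul, Module.End.mul_apply, adHom_toAssoc, ← lie_inc, ← lie_skew, contract_neg]
  rw [twDiff_apply, h, LinearMap.neg_apply, contractAd_apply, contractAd_apply,
    contract_differential, map_neg, lieDer_succ]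
  abel

/-- The operator lowering coefficients by means of the Fox derivatives. -/
def foxFamily {i : ℕ} (c : Fin n) :
    (Fin m → FreeAssoc m →ₗ[ℂ] Form (FreeLieSum m n) i) →ₗ[ℂ]
      FreeLieSum m n →ₗ[ℂ] Form (FreeLieSum m n) i where
  toFun B := ∑ j, B j ∘ₗ fox j ∘ₗ toAssoc ∘ₗ proj c
  map_add' B B' := by simp [LinearMap.add_comp, Finset.sum_add_distrib]
  map_smul' a B := by simp [LinearMap.smul_comp, Finset.smul_sum]

theorem foxFamily_apply {i : ℕ} (c : Fin n)
    (B : Fin m → FreeAssoc m →ₗ[ℂ] Form (FreeLieSum m n) i) (y : FreeLieSum m n) :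
    foxFamily c B y = ∑ j, B j (fox j (toAssoc (proj c y))) := by
  simp [foxFamily]

/-- The Fox rule `fox_toAssoc_lie` converts the bracket term of the Leibniz rule into the
coefficient term of `twDiff`. -/
theorem differential_wedge_foxFamily {i : ℕ} (c : Fin n)
    (B : Fin m → FreeAssoc m →ₗ[ℂ] Form (FreeLieSum m n) i) :
    differential (i + 1) (wedge (foxFamily c B)) =
      -wedge (foxFamily c fun j => twDiff c (B j)) := by
  let G : FreeLieSum m n →ₗ[ℂ] FreeLieSum m n →ₗ[ℂ] Form (FreeLieSum m n) i :=
    LinearMap.mk₂ ℂ (fun x y => ∑ j, B j (toAssoc (proj c x) * fox j (toAssoc (proj c y))))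
      (by intros; simp [add_mul, Finset.sum_add_distrib]) (by intros; simp [Finset.smul_sum])
      (by intros; simp [mul_add, Finset.sum_add_distrib]) (by intros; simp [Finset.smul_sum])
  have h1 : lieFamily (foxFamily c B) = G - G.flip := by
    refine LinearMap.ext fun x => LinearMap.ext fun y => ?_
    change foxFamily c B ⁅x, y⁆ = ∑ j, _ - ∑ j, _
    rw [foxFamily_apply, ← Finset.sum_sub_distrib]
    refine Finset.sum_congr rfl fun j _ => ?_
    rw [proj_lie, fox_toAssoc_lie, map_sub]
  have h2 : foxFamily c (fun j => twDiff c (B j)) =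
      differential i ∘ₗ foxFamily c B - wedge ∘ₗ G.flip := by
    refine LinearMap.ext fun y => ?_
    rw [LinearMap.sub_apply, LinearMap.comp_apply, LinearMap.comp_apply, foxFamily_apply,
      foxFamily_apply, map_sum]
    simp only [twDiff_apply, Finset.sum_sub_distrib]
    congr 1
    rw [← map_sum]
    congr 1
    refine LinearMap.ext fun x => ?_
    rw [LinearMap.sum_apply]
    rfl
  rw [differential_wedge, h1, h2, half_wedge_wedge, map_sub, wedge_wedge_eq_neg G.flip,
    LinearMap.flip_flip]
  abel

theorem sum_foxFamily_contractAd {i : ℕ} (f : Form (FreeLieSum m n) (i + 1)) :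
    ∑ c, foxFamily c (fun j => contractAd c (FreeLieAlgebra.of ℂ j) f) =
      f.curryLeft ∘ₗ gEuler := by
  refine LinearMap.ext fun y => ?_
  rw [LinearMap.sum_apply]
  simp only [foxFamily_apply, contractAd_apply]
  rw [LinearMap.comp_apply, gEuler, LinearMap.sum_apply, map_sum]
  refine Finset.sum_congr rfl fun c _ => ?_
  rw [LinearMap.comp_apply, LinearMap.comp_apply, euler_apply, map_sum, map_sum]
  rfl

end Twisted

end

end FreeLieResolution

namespace FreeLieResolution

noncomputable section

theorem form_sum_apply {𝔤 ι : Type} [AddCommGroup 𝔤] [Module ℂ 𝔤] {i : ℕ} (t : Finset ι)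
    (f : ι → Form 𝔤 i) (v : Fin i → 𝔤) : (∑ k ∈ t, f k) v = ∑ k ∈ t, f k v :=
  map_sum (⟨⟨fun f : Form 𝔤 i => f v, rfl⟩, fun _ _ => rfl⟩ : Form 𝔤 i →+ ℂ) f t

/-! ### Equivariant families of cochains -/

section Equivariant

variable {m n : ℕ} {S : Type} [AddCommGroup S] [Module ℂ S]

/-- Equivariance of a family of forms on the sum of free Lie algebras. -/
def IsEquivariant {i : ℕ} (σ : Representation ℂ (GL (Fin m) ℂ) S)
    (f : S →ₗ[ℂ] Form (FreeLieSum m n) i) : Prop :=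
  ∀ A s, (f (σ A s)).compLinearMap (glVRep m n A) = f s

/-- Equivariance of a family of forms with coefficients in the free associative algebra. -/
def IsTwEquivariant {i : ℕ} (σ : Representation ℂ (GL (Fin m) ℂ) S)
    (F : S →ₗ[ℂ] FreeAssoc m →ₗ[ℂ] Form (FreeLieSum m n) i) : Prop :=
  ∀ A s u, (F (σ A s) (assocMap A.val u)).compLinearMap (glVRep m n A) = F s u

/-- The scalar `2` acts by `2⁻ʷ`. -/
def HasWeight (σ : Representation ℂ (GL (Fin m) ℂ) S) (w : ℕ) : Prop :=
  ∀ s, σ (twoGL m) s = ((2 : ℂ) ^ w)⁻¹ • s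

/-- The representation `V ⊗ S`, on `S^m`. -/
def vecRep (σ : Representation ℂ (GL (Fin m) ℂ) S) :
    Representation ℂ (GL (Fin m) ℂ) (Fin m → S) where
  toFun A := LinearMap.pi fun i => ∑ j, A.val i j • (σ A ∘ₗ LinearMap.proj j)
  map_one' := by
    refine LinearMap.ext fun s => funext fun i => ?_
    simp [Matrix.one_apply]
  map_mul' A B := by
    refine LinearMap.ext fun s => funext fun i => ?_
    simp only [LinearMap.pi_apply, LinearMap.sum_apply, LinearMap.smul_apply, LinearMap.comp_apply,
      LinearMap.proj_apply, Module.End.mul_apply, map_sum, map_smul, Units.val_mul,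
      Matrix.mul_apply, Finset.sum_smul, Finset.smul_sum, map_mul, smul_smul]
    exact Finset.sum_comm

theorem vecRep_apply (σ : Representation ℂ (GL (Fin m) ℂ) S) (A : GL (Fin m) ℂ) (s : Fin m → S)
    (i : Fin m) : vecRep σ A s i = ∑ j, A.val i j • σ A (s j) := by
  simp [vecRep]

theorem vecRep_single (σ : Representation ℂ (GL (Fin m) ℂ) S) (A : GL (Fin m) ℂ) (l : Fin m)
    (s : S) : vecRep σ A (Pi.single l s) = ∑ j, A.val j l • Pi.single j (σ A s) := by
  funext i
  rw [vecRep_apply, Finset.sum_apply, Finset.sum_eq_single l, Finset.sum_eq_single i]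
  · simp
  · intro j _ hj; simp [hj.symm]
  · simp
  · intro j _ hj; simp [hj]
  · simp

theorem HasWeight.vecRep {σ : Representation ℂ (GL (Fin m) ℂ) S} {w : ℕ}
    (h : HasWeight σ (w + 1)) : HasWeight (vecRep σ) w := by
  intro s
  funext i
  rw [vecRep_apply, Finset.sum_eq_single i]
  · rw [twoGL_apply, if_pos rfl, h, smul_smul, Pi.smul_apply, pow_succ, mul_inv, mul_comm,
      mul_assoc, inv_mul_cancel₀ two_ne_zero, mul_one]
  · intro j _ hj; rw [twoGL_apply, if_neg hj.symm, zero_smul]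
  · simp

theorem glVRep_twoGL_words {i : ℕ} (p : Fin i → Fin n × Fin m × List (Fin m)) :
    (fun a => glVRep m n (twoGL m) (inc (p a).1 (lieWord (p a).2.1 (p a).2.2))) =
      fun a => (2 : ℂ) ^ ((p a).2.2.length + 1) • (inc (p a).1 (lieWord (p a).2.1 (p a).2.2)) := by
  funext a
  rw [glVRep_inc, freeMap_twoGL_lieWord, map_smul]

theorem two_pow_injective : Function.Injective fun k : ℕ => (2 : ℂ) ^ k := by
  intro a b h
  have : ((2 ^ a : ℕ) : ℂ) = ((2 ^ b : ℕ) : ℂ) := by push_cast; exact h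
  exact Nat.pow_right_injective le_rfl (Nat.cast_injective this)

/-- The scalar 2 multiplies the word arguments and the coefficient by 2 to their total degree, and
`s` by `2^{-w}`. Equivariance makes the product of these factors 1 wherever the value is nonzero. -/
theorem IsTwEquivariant.weight_eq {i : ℕ} {σ : Representation ℂ (GL (Fin m) ℂ) S} {w : ℕ}
    (hσ : HasWeight σ w) {F : S →ₗ[ℂ] FreeAssoc m →ₗ[ℂ] Form (FreeLieSum m n) i}
    (hF : IsTwEquivariant σ F) (s : S) (v : List (Fin m))
    (p : Fin i → Fin n × Fin m × List (Fin m))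
    (h : F s (assocWord v) (fun a => inc (p a).1 (lieWord (p a).2.1 (p a).2.2)) ≠ 0) :
    v.length + ∑ a, ((p a).2.2.length + 1) = w := by
  have h1 := congrArg (fun f : Form (FreeLieSum m n) i =>
    f (fun a => inc (p a).1 (lieWord (p a).2.1 (p a).2.2))) (hF (twoGL m) s (assocWord v))
  simp only [AlternatingMap.compLinearMap_apply] at h1
  rw [glVRep_twoGL_words, hσ, assocMap_twoGL_assocWord] at h1
  have h2 := (F (((2 : ℂ) ^ w)⁻¹ • s) ((2 : ℂ) ^ v.length • assocWord v)).toMultilinearMap.map_smul_univ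
    (fun a => (2 : ℂ) ^ ((p a).2.2.length + 1))
    (fun a => inc (p a).1 (lieWord (p a).2.1 (p a).2.2))
  rw [AlternatingMap.coe_multilinearMap] at h2
  rw [h2, map_smul, map_smul, LinearMap.smul_apply, AlternatingMap.smul_apply,
    AlternatingMap.smul_apply, smul_smul, smul_smul, Finset.prod_pow_eq_pow_sum] at h1
  set X := F s (assocWord v) (fun a => inc (p a).1 (lieWord (p a).2.1 (p a).2.2)) with hX
  refine two_pow_injective ?_
  have h3 := mul_right_cancel₀ h (h1.trans (one_mul X).symm)
  have h4 : (2 : ℂ) ^ w ≠ 0 := pow_ne_zero _ two_ne_zero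
  field_simp at h3
  change (2 : ℂ) ^ (_ + _) = 2 ^ w
  rw [pow_add, mul_comm]
  simpa [mul_comm] using h3

/-- A family of forms as a family with coefficients, through the augmentation. -/
def augFamily {i : ℕ} (f : S →ₗ[ℂ] Form (FreeLieSum m n) i) :
    S →ₗ[ℂ] FreeAssoc m →ₗ[ℂ] Form (FreeLieSum m n) i :=
  (LinearMap.lsmul ℂ (Form (FreeLieSum m n) i) ∘ₗ (aug (m := m)).toLinearMap).flip ∘ₗ f

theorem augFamily_apply {i : ℕ} (f : S →ₗ[ℂ] Form (FreeLieSum m n) i) (s : S) (u : FreeAssoc m) :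
    augFamily f s u = aug u • f s := rfl

theorem IsEquivariant.augFamily {i : ℕ} {σ : Representation ℂ (GL (Fin m) ℂ) S}
    {f : S →ₗ[ℂ] Form (FreeLieSum m n) i} (hf : IsEquivariant σ f) :
    IsTwEquivariant σ (augFamily f) := by
  intro A s u
  rw [augFamily_apply, augFamily_apply, aug_assocMap, ← hf A s]
  rfl

theorem twDiff_augFamily {i : ℕ} (c : Fin n) (f : S →ₗ[ℂ] Form (FreeLieSum m n) i) (s : S)
    (u : FreeAssoc m) : twDiff c (augFamily f s) u = aug u • differential i (f s) := by
  have : coeffAct c (augFamily f s) u = 0 := by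
    refine LinearMap.ext fun y => ?_
    rw [coeffAct_apply, augFamily_apply, map_mul, aug_toAssoc, zero_mul, zero_smul]
    rfl
  rw [twDiff_apply, this, _root_.map_zero, sub_zero, augFamily_apply, map_smul]

theorem IsEquivariant.weight_eq {i : ℕ} {σ : Representation ℂ (GL (Fin m) ℂ) S} {w : ℕ}
    (hσ : HasWeight σ w) {f : S →ₗ[ℂ] Form (FreeLieSum m n) i}
    (hf : IsEquivariant σ f) (s : S) (p : Fin i → Fin n × Fin m × List (Fin m))
    (h : f s (fun a => inc (p a).1 (lieWord (p a).2.1 (p a).2.2)) ≠ 0) :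
    ∑ a, ((p a).2.2.length + 1) = w := by
  -- The empty word is the coefficient `1`, of degree 0 and augmentation 1.
  have := hf.augFamily.weight_eq hσ s [] p (by simpa [augFamily_apply, assocWord] using h)
  simpa using this

/-- `gEuler` scales each word argument by its length; antisymmetrizing adds the lengths, and their
sum is `w` wherever `f s` does not vanish. -/
theorem wedge_gEuler {i : ℕ} {σ : Representation ℂ (GL (Fin m) ℂ) S} {w : ℕ}
    (hσ : HasWeight σ w) {f : S →ₗ[ℂ] Form (FreeLieSum m n) (i + 1)}
    (hf : IsEquivariant σ f) (s : S) :
    wedge ((f s).curryLeft ∘ₗ gEuler) = (w : ℂ) • f s := by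
  rw [← sub_eq_zero]
  refine form_eq_zero_of_words _ fun p => ?_
  rw [AlternatingMap.sub_apply, wedge_apply, AlternatingMap.smul_apply]
  set x : Fin (i + 1) → FreeLieSum m n :=
    fun a => inc (p a).1 (lieWord (p a).2.1 (p a).2.2) with hx
  have h1 : ∀ a : Fin (i + 1), (-1 : ℤ) ^ (a : ℕ) •
      ((f s).curryLeft ∘ₗ gEuler) (x a) (a.removeNth x) =
        (((p a).2.2.length + 1 : ℕ) : ℂ) • f s x := by
    intro a
    have h2 : gEuler (x a) = (((p a).2.2.length + 1 : ℕ) : ℂ) • x a := gEuler_inc_lieWord _ _ _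
    have h3 := (f s).neg_one_pow_smul_map_insertNth a (x a) (a.removeNth x)
    rw [Fin.insertNth_self_removeNth] at h3
    rw [LinearMap.comp_apply, h2, map_smul, AlternatingMap.smul_apply,
      AlternatingMap.curryLeft_apply_apply, ← h3, smul_comm, smul_smul, ← pow_add,
      Even.neg_one_pow ⟨_, rfl⟩, one_smul]
  rw [Finset.sum_congr rfl fun a _ => h1 a, ← Finset.sum_smul, ← sub_smul]
  by_cases h : f s x = 0
  · rw [h, smul_zero]
  · rw [← Nat.cast_sum, hf.weight_eq hσ s p h, sub_self, zero_smul]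

/-! ### Operations on families -/

/-- Contraction with `ad(u) v` for `v` in the coefficients. -/
def contractFamily {i : ℕ} (c : Fin n) (f : S →ₗ[ℂ] Form (FreeLieSum m n) (i + 1)) :
    (Fin m → S) →ₗ[ℂ] FreeAssoc m →ₗ[ℂ] Form (FreeLieSum m n) i :=
  ∑ j, contractAd c (FreeLieAlgebra.of ℂ j) ∘ₗ f ∘ₗ LinearMap.proj j

theorem contractFamily_apply {i : ℕ} (c : Fin n) (f : S →ₗ[ℂ] Form (FreeLieSum m n) (i + 1))
    (s : Fin m → S) :
    contractFamily c f s = ∑ j, contractAd c (FreeLieAlgebra.of ℂ j) (f (s j)) := by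
  simp [contractFamily]

theorem IsEquivariant.contractFamily {i : ℕ} {σ : Representation ℂ (GL (Fin m) ℂ) S}
    {f : S →ₗ[ℂ] Form (FreeLieSum m n) (i + 1)} (hf : IsEquivariant σ f) (c : Fin n) :
    IsTwEquivariant (vecRep σ) (contractFamily c f) := by
  intro A s u
  refine AlternatingMap.ext fun x => ?_
  have hf' : ∀ s y, f s y = f (σ A s) (fun a => glVRep m n A (y a)) := fun s y =>
    (congrArg (fun g : Form (FreeLieSum m n) (i + 1) => g y) (hf A s)).symm
  rw [AlternatingMap.compLinearMap_apply, contractFamily_apply, contractFamily_apply,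
    LinearMap.sum_apply, LinearMap.sum_apply, form_sum_apply, form_sum_apply]
  have hL : ∀ k, contractAd c (FreeLieAlgebra.of ℂ k) (f (vecRep σ A s k)) (assocMap A.val u)
      (fun a => glVRep m n A (x a)) = ∑ j, A.val k j • f (σ A (s j)) (Matrix.vecCons
        (inc c (adHom (assocMap A.val u) (FreeLieAlgebra.of ℂ k))) fun a => glVRep m n A (x a)) := by
    intro k
    rw [contractAd_apply, contract_apply, vecRep_apply, map_sum, form_sum_apply]
    refine Finset.sum_congr rfl fun j _ => ?_
    rw [map_smul, AlternatingMap.smul_apply]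
  rw [Finset.sum_congr rfl fun k _ => hL k, Finset.sum_comm]
  refine Finset.sum_congr rfl fun j _ => ?_
  rw [contractAd_apply, contract_apply]
  have h1 : (fun a => glVRep m n A (Matrix.vecCons (inc c (adHom u (FreeLieAlgebra.of ℂ j))) x a)) =
      Matrix.vecCons (∑ i, A.val i j • inc c (adHom (assocMap A.val u) (FreeLieAlgebra.of ℂ i)))
        (fun a => glVRep m n A (x a)) := by
    funext a
    refine Fin.cases ?_ (fun b => ?_) a
    · simp only [Matrix.cons_val_zero]
      rw [glVRep_inc, freeMap_adHom, freeMap_of, map_sum, map_sum]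
      simp only [map_smul]
    · simp
  rw [hf' (s j), h1]
  change _ = contract (∑ i, A.val i j • _) (f (σ A (s j))) _
  rw [contract_eq, map_sum, form_sum_apply]
  simp only [map_smul]
  rfl

theorem twDiff_contractFamily {i : ℕ} (c : Fin n) (f : S →ₗ[ℂ] Form (FreeLieSum m n) (i + 1))
    (hf : ∀ s, differential (i + 1) (f s) = 0) (s : Fin m → S) :
    twDiff c (contractFamily c f s) = 0 := by
  rw [contractFamily_apply, map_sum]
  refine Finset.sum_eq_zero fun j _ => ?_
  rw [twDiff_contractAd, hf, _root_.map_zero, neg_zero]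

/-- The operator lowering coefficients, on families. -/
def wedgeFox {i : ℕ} (c : Fin n) (H : (Fin m → S) →ₗ[ℂ] FreeAssoc m →ₗ[ℂ] Form (FreeLieSum m n) i) :
    S →ₗ[ℂ] Form (FreeLieSum m n) (i + 1) :=
  wedge ∘ₗ foxFamily c ∘ₗ LinearMap.pi fun j => H ∘ₗ LinearMap.single ℂ (fun _ => S) j

theorem wedgeFox_apply {i : ℕ} (c : Fin n)
    (H : (Fin m → S) →ₗ[ℂ] FreeAssoc m →ₗ[ℂ] Form (FreeLieSum m n) i) (s : S) :
    wedgeFox c H s = wedge (foxFamily c fun j => H (Pi.single j s)) := rfl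

/-- The same entries `A j l` occur in `fox_assocMap` and in `vecRep_single`, summed over `l` and
over `j` respectively, so `∑ j, e_j ⊗ fox j` is an equivariant combination. -/
theorem IsTwEquivariant.map_sum_single {i : ℕ} {σ : Representation ℂ (GL (Fin m) ℂ) S}
    {H : (Fin m → S) →ₗ[ℂ] FreeAssoc m →ₗ[ℂ] Form (FreeLieSum m n) i}
    (hH : IsTwEquivariant (vecRep σ) H) (A : GL (Fin m) ℂ) (s : S) (u : FreeAssoc m) :
    (∑ j, H (Pi.single j (σ A s)) (fox j (assocMap A.val u))).compLinearMap (glVRep m n A) =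
      ∑ j, H (Pi.single j s) (fox j u) := by
  have h1 : ∑ j, H (Pi.single j (σ A s)) (fox j (assocMap A.val u)) =
      ∑ l, H (vecRep σ A (Pi.single l s)) (assocMap A.val (fox l u)) := by
    simp only [fox_assocMap, vecRep_single, map_sum, map_smul, LinearMap.sum_apply,
      LinearMap.smul_apply]
    exact Finset.sum_comm
  rw [h1]
  refine AlternatingMap.ext fun x => ?_
  rw [AlternatingMap.compLinearMap_apply, form_sum_apply, form_sum_apply]
  refine Finset.sum_congr rfl fun l _ => ?_
  rw [← hH A (Pi.single l s) (fox l u)]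
  rfl

theorem IsTwEquivariant.wedgeFox {i : ℕ} {σ : Representation ℂ (GL (Fin m) ℂ) S}
    {H : (Fin m → S) →ₗ[ℂ] FreeAssoc m →ₗ[ℂ] Form (FreeLieSum m n) i}
    (hH : IsTwEquivariant (vecRep σ) H) (c : Fin n) : IsEquivariant σ (wedgeFox c H) := by
  intro A s
  rw [wedgeFox_apply, wedgeFox_apply]
  refine wedge_compLinearMap _ _ _ fun y => ?_
  rw [foxFamily_apply, foxFamily_apply, proj_glVRep, toAssoc_freeMap, hH.map_sum_single]

theorem differential_wedgeFox {i : ℕ} (c : Fin n)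
    (H : (Fin m → S) →ₗ[ℂ] FreeAssoc m →ₗ[ℂ] Form (FreeLieSum m n) i) (s : S) :
    differential (i + 1) (wedgeFox c H s) = -wedgeFox c (twDiff c ∘ₗ H) s :=
  differential_wedge_foxFamily c _

/-- The homotopy identity: contraction with `ad(u) x_j` followed by substitution of Fox derivatives
for `u` inserts the Euler derivation, hence acts as the weight. -/
theorem sum_wedgeFox_contractFamily {i : ℕ} {σ : Representation ℂ (GL (Fin m) ℂ) S} {w : ℕ}
    (hσ : HasWeight σ w) {f : S →ₗ[ℂ] Form (FreeLieSum m n) (i + 1)}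
    (hf : IsEquivariant σ f) (s : S) :
    ∑ c, wedgeFox c (contractFamily c f) s = (w : ℂ) • f s := by
  rw [← wedge_gEuler hσ hf, ← sum_foxFamily_contractAd, map_sum]
  refine Finset.sum_congr rfl fun c _ => ?_
  rw [wedgeFox_apply]
  congr 2
  funext j
  rw [contractFamily_apply, Finset.sum_eq_single j]
  · rw [Pi.single_eq_same]
  · intro l _ hl; rw [Pi.single_eq_of_ne hl, _root_.map_zero, _root_.map_zero]
  · simp

/-- Restriction of the coefficients to the augmentation ideal. -/
def restrictFamily {i : ℕ} (F : S →ₗ[ℂ] FreeAssoc m →ₗ[ℂ] Form (FreeLieSum m n) i) :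
    (Fin m → S) →ₗ[ℂ] FreeAssoc m →ₗ[ℂ] Form (FreeLieSum m n) i :=
  ∑ j, LinearMap.lcomp ℂ _ (LinearMap.mulRight ℂ (FreeAlgebra.ι ℂ j)) ∘ₗ F ∘ₗ LinearMap.proj j

theorem restrictFamily_apply {i : ℕ} (F : S →ₗ[ℂ] FreeAssoc m →ₗ[ℂ] Form (FreeLieSum m n) i)
    (s : Fin m → S) (u : FreeAssoc m) :
    restrictFamily F s u = ∑ j, F (s j) (u * FreeAlgebra.ι ℂ j) := by
  simp [restrictFamily]

theorem restrictFamily_single {i : ℕ} (F : S →ₗ[ℂ] FreeAssoc m →ₗ[ℂ] Form (FreeLieSum m n) i)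
    (j : Fin m) (s : S) (u : FreeAssoc m) :
    restrictFamily F (Pi.single j s) u = F s (u * FreeAlgebra.ι ℂ j) := by
  rw [restrictFamily_apply, Finset.sum_eq_single j]
  · rw [Pi.single_eq_same]
  · intro l _ hl; rw [Pi.single_eq_of_ne hl, _root_.map_zero]; rfl
  · simp

theorem IsTwEquivariant.restrictFamily {i : ℕ} {σ : Representation ℂ (GL (Fin m) ℂ) S}
    {F : S →ₗ[ℂ] FreeAssoc m →ₗ[ℂ] Form (FreeLieSum m n) i} (hF : IsTwEquivariant σ F) :
    IsTwEquivariant (vecRep σ) (restrictFamily F) := by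
  intro A s u
  refine AlternatingMap.ext fun x => ?_
  rw [AlternatingMap.compLinearMap_apply, restrictFamily_apply, restrictFamily_apply,
    form_sum_apply, form_sum_apply]
  simp only [vecRep_apply, map_sum, map_smul, LinearMap.sum_apply, LinearMap.smul_apply]
  simp only [form_sum_apply, AlternatingMap.smul_apply]
  rw [Finset.sum_comm]
  refine Finset.sum_congr rfl fun j _ => ?_
  rw [← hF A, map_mul, assocMap_ι, Finset.mul_sum, map_sum, AlternatingMap.compLinearMap_apply,
    form_sum_apply]
  refine Finset.sum_congr rfl fun k _ => ?_
  rw [mul_smul_comm, map_smul]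
  rfl

theorem twDiff_restrictFamily {i : ℕ} (c : Fin n)
    (F : S →ₗ[ℂ] FreeAssoc m →ₗ[ℂ] Form (FreeLieSum m n) i) (s : Fin m → S) :
    twDiff c (restrictFamily F s) = restrictFamily (twDiff c ∘ₗ F) s := by
  have h : restrictFamily F s =
      ∑ j, F (s j) ∘ₗ LinearMap.mulRight ℂ (FreeAlgebra.ι ℂ j) := by
    refine LinearMap.ext fun u => ?_
    rw [restrictFamily_apply, LinearMap.sum_apply]
    rfl
  refine LinearMap.ext fun u => ?_
  rw [h, map_sum, restrictFamily_apply, LinearMap.sum_apply]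
  refine Finset.sum_congr rfl fun j _ => ?_
  rw [twDiff_apply, LinearMap.comp_apply, LinearMap.comp_apply, twDiff_apply]
  congr 2
  refine LinearMap.ext fun y => ?_
  change F (s j) (toAssoc (proj c y) * u * FreeAlgebra.ι ℂ j) = F (s j) (_ * (_ * _))
  rw [mul_assoc]
  rfl

/-- Extension of coefficients from the augmentation ideal, by zero at `1`. -/
def extendFamily {i : ℕ} (H : (Fin m → S) →ₗ[ℂ] FreeAssoc m →ₗ[ℂ] Form (FreeLieSum m n) i) :
    S →ₗ[ℂ] FreeAssoc m →ₗ[ℂ] Form (FreeLieSum m n) i :=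
  ∑ j, LinearMap.lcomp ℂ _ (fox j) ∘ₗ H ∘ₗ LinearMap.single ℂ (fun _ => S) j

theorem extendFamily_apply {i : ℕ}
    (H : (Fin m → S) →ₗ[ℂ] FreeAssoc m →ₗ[ℂ] Form (FreeLieSum m n) i) (s : S) (u : FreeAssoc m) :
    extendFamily H s u = ∑ j, H (Pi.single j s) (fox j u) := by
  simp [extendFamily]

theorem IsTwEquivariant.extendFamily {i : ℕ} {σ : Representation ℂ (GL (Fin m) ℂ) S}
    {H : (Fin m → S) →ₗ[ℂ] FreeAssoc m →ₗ[ℂ] Form (FreeLieSum m n) i}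
    (hH : IsTwEquivariant (vecRep σ) H) : IsTwEquivariant σ (extendFamily H) := by
  intro A s u
  rw [extendFamily_apply, extendFamily_apply, hH.map_sum_single]

theorem extendFamily_one {i : ℕ}
    (H : (Fin m → S) →ₗ[ℂ] FreeAssoc m →ₗ[ℂ] Form (FreeLieSum m n) i) (s : S) :
    extendFamily H s 1 = 0 := by
  rw [extendFamily_apply]
  exact Finset.sum_eq_zero fun j _ => by rw [fox_one, _root_.map_zero]

theorem extendFamily_mul_ι {i : ℕ}
    (H : (Fin m → S) →ₗ[ℂ] FreeAssoc m →ₗ[ℂ] Form (FreeLieSum m n) i) (s : S) (u : FreeAssoc m)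
    (j : Fin m) : extendFamily H s (u * FreeAlgebra.ι ℂ j) = H (Pi.single j s) u := by
  rw [extendFamily_apply, Finset.sum_eq_single j]
  · rw [fox_mul_ι, Pi.single_eq_same]
  · intro l _ hl; rw [fox_mul_ι, Pi.single_eq_of_ne hl, _root_.map_zero]
  · simp

/-- Right multiplication by a generator commutes with the left action on coefficients, so extending
a primitive from the augmentation ideal spoils the differential at the coefficient `1` only. -/
theorem twDiff_extendFamily_mul_ι {i : ℕ} (c : Fin n)
    (H : (Fin m → S) →ₗ[ℂ] FreeAssoc m →ₗ[ℂ] Form (FreeLieSum m n) i) (s : S) (u : FreeAssoc m)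
    (j : Fin m) : twDiff c (extendFamily H s) (u * FreeAlgebra.ι ℂ j) =
      twDiff c (H (Pi.single j s)) u := by
  rw [twDiff_apply, twDiff_apply, extendFamily_mul_ι]
  congr 2
  refine LinearMap.ext fun y => ?_
  rw [coeffAct_apply, coeffAct_apply, ← mul_assoc, extendFamily_mul_ι]

theorem IsTwEquivariant.twDiff {i : ℕ} {σ : Representation ℂ (GL (Fin m) ℂ) S}
    {F : S →ₗ[ℂ] FreeAssoc m →ₗ[ℂ] Form (FreeLieSum m n) i} (hF : IsTwEquivariant σ F)
    (c : Fin n) : IsTwEquivariant σ (twDiff c ∘ₗ F) := by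
  intro A s u
  rw [LinearMap.comp_apply, LinearMap.comp_apply, twDiff_apply, twDiff_apply,
    ← wedge_compLinearMap (glVRep m n A) (coeffAct c (F (σ A s)) (assocMap A.val u))
      (coeffAct c (F s) u), ← hF A s u, differential_compLinearMap _ (glVRep_lie A)]
  · rfl
  · intro y
    rw [coeffAct_apply, coeffAct_apply, proj_glVRep, toAssoc_freeMap, ← map_mul, hF]

theorem IsTwEquivariant.sub {i : ℕ} {σ : Representation ℂ (GL (Fin m) ℂ) S}
    {F G : S →ₗ[ℂ] FreeAssoc m →ₗ[ℂ] Form (FreeLieSum m n) i} (hF : IsTwEquivariant σ F)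
    (hG : IsTwEquivariant σ G) : IsTwEquivariant σ (F - G) := by
  intro A s u
  rw [LinearMap.sub_apply, LinearMap.sub_apply, LinearMap.sub_apply, LinearMap.sub_apply,
    ← hF A s u, ← hG A s u]
  rfl

theorem IsTwEquivariant.add {i : ℕ} {σ : Representation ℂ (GL (Fin m) ℂ) S}
    {F G : S →ₗ[ℂ] FreeAssoc m →ₗ[ℂ] Form (FreeLieSum m n) i} (hF : IsTwEquivariant σ F)
    (hG : IsTwEquivariant σ G) : IsTwEquivariant σ (F + G) := by
  intro A s u
  rw [LinearMap.add_apply, LinearMap.add_apply, LinearMap.add_apply, LinearMap.add_apply,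
    ← hF A s u, ← hG A s u]
  rfl

theorem IsTwEquivariant.apply_one {i : ℕ} {σ : Representation ℂ (GL (Fin m) ℂ) S}
    {F : S →ₗ[ℂ] FreeAssoc m →ₗ[ℂ] Form (FreeLieSum m n) i} (hF : IsTwEquivariant σ F) :
    IsEquivariant σ (F.flip 1) := by
  intro A s
  have := hF A s 1
  rwa [map_one] at this

end Equivariant

end

end FreeLieResolution

namespace FreeLieResolution

noncomputable section

/-! ### Acyclicity -/

section Acyclic

variable {m n : ℕ}

/-- The family is the differential of an equivariant family. -/
def IsBoundary {S : Type} [AddCommGroup S] [Module ℂ S]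
    (σ : Representation ℂ (GL (Fin m) ℂ) S) :
    {i : ℕ} → (S →ₗ[ℂ] Form (FreeLieSum m n) i) → Prop
  | 0, f => f = 0
  | i + 1, f => ∃ h : S →ₗ[ℂ] Form (FreeLieSum m n) i,
      IsEquivariant σ h ∧ ∀ s, differential i (h s) = f s

/-- The family with coefficients is the differential of an equivariant family. -/
def IsTwBoundary {S : Type} [AddCommGroup S] [Module ℂ S]
    (σ : Representation ℂ (GL (Fin m) ℂ) S) (c : Fin n) :
    {i : ℕ} → (S →ₗ[ℂ] FreeAssoc m →ₗ[ℂ] Form (FreeLieSum m n) i) → Prop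
  | 0, F => F = 0
  | i + 1, F => ∃ H : S →ₗ[ℂ] FreeAssoc m →ₗ[ℂ] Form (FreeLieSum m n) i,
      IsTwEquivariant σ H ∧ ∀ s, twDiff c (H s) = F s

variable (m n) in
/-- Acyclicity of the equivariant cochains in weight `w`: a cocycle vanishing on generators of
distinct colours is a coboundary. -/
def Acyclic (w : ℕ) : Prop :=
  ∀ (S : Type) [AddCommGroup S] [Module ℂ S] (σ : Representation ℂ (GL (Fin m) ℂ) S),
    HasWeight σ w → ∀ (i : ℕ) (f : S →ₗ[ℂ] Form (FreeLieSum m n) i), IsEquivariant σ f →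
      (∀ s, differential i (f s) = 0) →
      (∀ s (γ : Fin i → Fin n) (v : Fin i → Fin m), Function.Injective γ →
        f s (fun a => gen (γ a) (v a)) = 0) → IsBoundary σ f

variable (m) in
/-- Acyclicity of the equivariant cochains with coefficients in weight `w`. -/
def TwAcyclic (c : Fin n) (w : ℕ) : Prop :=
  ∀ (S : Type) [AddCommGroup S] [Module ℂ S] (σ : Representation ℂ (GL (Fin m) ℂ) S),
    HasWeight σ w → ∀ (i : ℕ) (F : S →ₗ[ℂ] FreeAssoc m →ₗ[ℂ] Form (FreeLieSum m n) i),
      IsTwEquivariant σ F → (∀ s, twDiff c (F s) = 0) →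
      (∀ s (γ : Fin i → Fin n) (v : Fin i → Fin m), Function.Injective γ → (∀ a, γ a ≠ c) →
        F s 1 (fun a => gen (γ a) (v a)) = 0) → IsTwBoundary σ c F

/-- Every argument of a form has positive degree, so weight 0 allows only forms of degree 0; these
are killed by the vanishing hypothesis on the empty tuple. -/
theorem acyclic_zero : Acyclic m n 0 := by
  intro S _ _ σ hσ i f hf _ hv
  cases i with
  | zero =>
    refine LinearMap.ext fun s => AlternatingMap.ext fun x => ?_
    have := hv s Fin.elim0 Fin.elim0 (fun a => a.elim0)
    rw [Subsingleton.elim x fun a => gen (Fin.elim0 a) (Fin.elim0 a), this]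
    rfl
  | succ i =>
    refine ⟨0, fun A s => rfl, fun s => ?_⟩
    rw [LinearMap.zero_apply, _root_.map_zero]
    refine (form_eq_zero_of_words _ fun p => ?_).symm
    by_contra h
    have := hf.weight_eq hσ s p h
    rw [Finset.sum_eq_zero_iff] at this
    exact absurd (this 0 (Finset.mem_univ _)) (Nat.succ_ne_zero _)

theorem cons_gen {i : ℕ} (c : Fin n) (j : Fin m) (γ : Fin i → Fin n) (v : Fin i → Fin m) :
    Matrix.vecCons (gen c j) (fun a => gen (γ a) (v a)) =
      fun a => (gen ((Matrix.vecCons c γ : Fin (i + 1) → Fin n) a)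
        ((Matrix.vecCons j v : Fin (i + 1) → Fin m) a) : FreeLieSum m n) := by
  funext a
  refine Fin.cases ?_ (fun b => ?_) a
  · simp
  · simp

theorem cons_injective {i : ℕ} {c : Fin n} {γ : Fin i → Fin n} (h : Function.Injective γ)
    (hc : ∀ a, γ a ≠ c) : Function.Injective (Matrix.vecCons c γ : Fin (i + 1) → Fin n) :=
  Fin.cons_injective_iff.2 ⟨fun ⟨a, ha⟩ => hc a ha, h⟩

/-- Contraction with a vector of `V` lowers the weight by one. Twisted primitives of the
contractions are reassembled by `wedgeFox` into a primitive of a multiple of `f`. -/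
theorem acyclic_succ {w : ℕ} (hQ : ∀ c : Fin n, TwAcyclic m c w) : Acyclic m n (w + 1) := by
  intro S _ _ σ hσ i f hf hd hv
  cases i with
  | zero =>
    refine LinearMap.ext fun s => AlternatingMap.ext fun x => ?_
    have := hv s Fin.elim0 Fin.elim0 (fun a => a.elim0)
    rw [Subsingleton.elim x fun a => gen (Fin.elim0 a) (Fin.elim0 a), this]
    rfl
  | succ i =>
    have hE : ∀ c, IsTwBoundary (vecRep σ) c (contractFamily c f) := fun c => by
      refine hQ c _ (vecRep σ) hσ.vecRep i _ (hf.contractFamily c)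
        (twDiff_contractFamily c f hd) fun s γ v hγ hc => ?_
      rw [contractFamily_apply, LinearMap.sum_apply, form_sum_apply]
      refine Finset.sum_eq_zero fun j _ => ?_
      -- At the coefficient `1` a generator of colour `c` is inserted before generators of other
      -- distinct colours, so the hypothesis on `f` applies.
      rw [contractAd_apply, contract_apply, map_one, Module.End.one_apply]
      exact (congrArg _ (cons_gen c j γ v)).trans (hv _ _ _ (cons_injective hγ hc))
    have hw : ((w + 1 : ℕ) : ℂ) ≠ 0 := Nat.cast_ne_zero.2 (Nat.succ_ne_zero w)
    have hsum := sum_wedgeFox_contractFamily hσ hf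
    cases i with
    | zero =>
      -- For forms of degree one the contractions have degree 0, where being a boundary means
      -- vanishing; then `f` itself is zero.
      refine ⟨0, fun A s => rfl, fun s => ?_⟩
      have h1 : ∀ c, wedgeFox c (contractFamily c f) s = 0 := fun c => by
        have h2 : contractFamily c f = 0 := hE c
        have h3 : foxFamily c (fun j => (0 : (Fin m → S) →ₗ[ℂ] FreeAssoc m →ₗ[ℂ]
            Form (FreeLieSum m n) 0) (Pi.single j s)) = 0 := map_zero (foxFamily c)
        rw [h2, wedgeFox_apply, h3, map_zero]
      have h2 := hsum s
      rw [Finset.sum_eq_zero fun c _ => h1 c] at h2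
      exact ((smul_eq_zero.1 h2.symm).resolve_left hw).symm
    | succ i =>
      choose H hH hHd using hE
      -- The sign is that of `differential_wedgeFox`, the factor `w + 1` that of the Euler identity.
      refine ⟨-((w + 1 : ℕ) : ℂ)⁻¹ • ∑ c, wedgeFox c (H c), fun A s => ?_, fun s => ?_⟩
      · refine AlternatingMap.ext fun x => ?_
        simp only [AlternatingMap.compLinearMap_apply, LinearMap.smul_apply, LinearMap.sum_apply,
          AlternatingMap.smul_apply, form_sum_apply]
        congr 1
        refine Finset.sum_congr rfl fun c _ => ?_
        rw [← (hH c).wedgeFox c A s]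
        rfl
      · have h1 : ∀ c, differential (i + 1) (wedgeFox c (H c) s) =
            -wedgeFox c (contractFamily c f) s := fun c => by
          rw [differential_wedgeFox]
          congr 3
          exact LinearMap.ext (hHd c)
        rw [LinearMap.smul_apply, LinearMap.sum_apply, map_smul, map_sum,
          Finset.sum_congr rfl fun c _ => h1 c, Finset.sum_neg_distrib, hsum, smul_neg, neg_smul,
          neg_neg, smul_smul, inv_mul_cancel₀ hw, one_smul]

/-! ### From trivial to twisted coefficients. -/

/-- The projection killing the copy of colour `c`. -/
def killColor (c : Fin n) : FreeLieSum m n →ₗ[ℂ] FreeLieSum m n :=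
  LinearMap.id - inc c ∘ₗ proj c

theorem proj_killColor_self (c : Fin n) (x : FreeLieSum m n) : proj c (killColor c x) = 0 := by
  rw [killColor, LinearMap.sub_apply, LinearMap.comp_apply, map_sub, proj_inc, LinearMap.id_apply,
    sub_self]

theorem proj_killColor_ne {c d : Fin n} (h : d ≠ c) (x : FreeLieSum m n) :
    proj d (killColor c x) = proj d x := by
  rw [killColor, LinearMap.sub_apply, LinearMap.comp_apply, map_sub, proj_inc_ne h,
    LinearMap.id_apply, sub_zero]

theorem killColor_lie (c : Fin n) (x y : FreeLieSum m n) :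
    killColor c ⁅x, y⁆ = ⁅killColor c x, killColor c y⁆ := by
  refine freeLieSum_ext fun d => ?_
  rw [proj_lie]
  by_cases h : d = c
  · subst h; simp only [proj_killColor_self, lie_zero]
  · simp only [proj_killColor_ne h, proj_lie]

theorem killColor_glVRep (c : Fin n) (A : GL (Fin m) ℂ) (x : FreeLieSum m n) :
    killColor c (glVRep m n A x) = glVRep m n A (killColor c x) := by
  refine freeLieSum_ext fun d => ?_
  rw [proj_glVRep]
  by_cases h : d = c
  · subst h; simp only [proj_killColor_self, map_zero]
  · simp only [proj_killColor_ne h, proj_glVRep]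

theorem killColor_gen_of_ne {c d : Fin n} (h : d ≠ c) (j : Fin m) :
    killColor c (gen d j : FreeLieSum m n) = gen d j := by
  rw [gen, killColor, LinearMap.sub_apply, LinearMap.comp_apply, proj_inc_ne h.symm, map_zero,
    sub_zero, LinearMap.id_apply]

/-- The component of degree one of an element of the free associative algebra. -/
def degreeOne : FreeAssoc m →ₗ[ℂ] FreeLie m :=
  ∑ j, (LinearMap.toSpanSingleton ℂ _ (FreeLieAlgebra.of ℂ j)) ∘ₗ (aug (m := m)).toLinearMap ∘ₗ
    fox j

theorem degreeOne_apply (u : FreeAssoc m) :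
    degreeOne u = ∑ j, aug (fox j u) • (FreeLieAlgebra.of ℂ j : FreeLie m) := by
  simp [degreeOne]

theorem degreeOne_one : degreeOne (1 : FreeAssoc m) = 0 := by
  rw [degreeOne_apply]
  exact Finset.sum_eq_zero fun j _ => by rw [fox_one, map_zero, zero_smul]

theorem degreeOne_mul_ι (u : FreeAssoc m) (j : Fin m) :
    degreeOne (u * FreeAlgebra.ι ℂ j) = aug u • (FreeLieAlgebra.of ℂ j : FreeLie m) := by
  rw [degreeOne_apply, Finset.sum_eq_single j]
  · rw [fox_mul_ι, Pi.single_eq_same]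
  · intro l _ hl; rw [fox_mul_ι, Pi.single_eq_of_ne hl, map_zero, zero_smul]
  · simp

theorem degreeOne_assocMap (A : Matrix (Fin m) (Fin m) ℂ) (u : FreeAssoc m) :
    degreeOne (assocMap A u) = freeMap A (degreeOne u) := by
  simp only [degreeOne_apply, fox_assocMap, map_sum, map_smul, freeMap_of, aug_assocMap,
    Finset.sum_smul, Finset.smul_sum, smul_smul, smul_eq_mul]
  rw [Finset.sum_comm]
  simp only [mul_comm]

variable {S : Type} [AddCommGroup S] [Module ℂ S] {σ : Representation ℂ (GL (Fin m) ℂ) S}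

/-- Contraction of the forms with a generator of colour `c`, the other arguments being projected to
the other colours. -/
def shiftFamily {i : ℕ} (c : Fin n) (f : S →ₗ[ℂ] Form (FreeLieSum m n) (i + 1)) :
    S →ₗ[ℂ] FreeAssoc m →ₗ[ℂ] Form (FreeLieSum m n) i :=
  LinearMap.mk₂ ℂ (fun s u => (contract (inc c (degreeOne u)) (f s)).compLinearMap (killColor c))
    (by intros; rw [map_add, map_add]; rfl) (by intros; rw [map_smul, map_smul]; rfl)
    (by intros; rw [map_add, map_add, contract_add]; rfl)
    (by intros; rw [map_smul, map_smul, contract_smul]; rfl)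

theorem shiftFamily_apply {i : ℕ} (c : Fin n) (f : S →ₗ[ℂ] Form (FreeLieSum m n) (i + 1)) (s : S)
    (u : FreeAssoc m) : shiftFamily c f s u =
      (contract (inc c (degreeOne u)) (f s)).compLinearMap (killColor c) := rfl

theorem IsEquivariant.shiftFamily {i : ℕ} {f : S →ₗ[ℂ] Form (FreeLieSum m n) (i + 1)}
    (hf : IsEquivariant σ f) (c : Fin n) : IsTwEquivariant σ (shiftFamily c f) := by
  intro A s u
  rw [shiftFamily_apply, shiftFamily_apply, ← hf A s, contract_compLinearMap, degreeOne_assocMap,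
    glVRep_inc]
  refine AlternatingMap.ext fun x => ?_
  simp only [AlternatingMap.compLinearMap_apply, killColor_glVRep]

/-- The coefficient part raises the degree beyond one, where `degreeOne` vanishes. For a cocycle the
other part is a Lie derivative along a generator of colour `c`, and `killColor c` leaves only
arguments commuting with it. -/
theorem twDiff_shiftFamily_mul_ι {i : ℕ} (c : Fin n) {f : S →ₗ[ℂ] Form (FreeLieSum m n) (i + 1)}
    (hf : ∀ s, differential (i + 1) (f s) = 0) (s : S) (u : FreeAssoc m) (j : Fin m) :
    twDiff c (shiftFamily c f s) (u * FreeAlgebra.ι ℂ j) = 0 := by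
  have h1 : coeffAct c (shiftFamily c f s) (u * FreeAlgebra.ι ℂ j) = 0 := by
    refine LinearMap.ext fun y => ?_
    rw [coeffAct_apply, shiftFamily_apply, ← mul_assoc, degreeOne_mul_ι, map_mul, aug_toAssoc,
      zero_mul, zero_smul, map_zero, contract_zero]
    rfl
  have h2 : (lieDer (inc c (FreeLieAlgebra.of ℂ j)) (i + 1) (f s)).compLinearMap
      (killColor c) = 0 := by
    have h3 := wedge_compLinearMap (killColor c)
      (contractLie (inc c (FreeLieAlgebra.of ℂ j)) (f s)) 0 fun y => by
        rw [LinearMap.comp_apply]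
        change ((f s).curryLeft ⁅(inc c (FreeLieAlgebra.of ℂ j) : FreeLieSum m n),
          killColor c y⁆).compLinearMap _ = _
        rw [← lie_skew, lie_inc, proj_killColor_self, zero_lie, map_zero, neg_zero, map_zero]
        rfl
    rw [map_zero] at h3
    rw [lieDer_succ]
    refine AlternatingMap.ext fun x => ?_
    have := congrArg (fun g : Form (FreeLieSum m n) (i + 1) => g x) h3
    simpa using this
  rw [twDiff_apply, h1, map_zero, sub_zero, shiftFamily_apply, degreeOne_mul_ι, map_smul,
    contract_smul, differential_compLinearMap _ (killColor_lie c), map_smul]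
  have h4 : differential i (contract (inc c (FreeLieAlgebra.of ℂ j)) (f s)) =
      lieDer (inc c (FreeLieAlgebra.of ℂ j)) (i + 1) (f s) := by
    have := contract_differential (inc c (FreeLieAlgebra.of ℂ j)) (f s)
    rw [hf, map_zero] at this
    exact (sub_eq_zero.1 this.symm).symm
  rw [h4]
  refine AlternatingMap.ext fun x => ?_
  have := congrArg (fun g : Form (FreeLieSum m n) (i + 1) => g x) h2
  simp only [AlternatingMap.compLinearMap_apply] at this
  simp [this]

theorem wedge_coeffAct_one_gen_of_ne {i : ℕ} (c : Fin n)
    (B : FreeAssoc m →ₗ[ℂ] Form (FreeLieSum m n) i) (γ : Fin (i + 1) → Fin n)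
    (v : Fin (i + 1) → Fin m) (hc : ∀ a, γ a ≠ c) :
    wedge (coeffAct c B 1) (fun a => gen (γ a) (v a)) = 0 := by
  rw [wedge_apply]
  refine Finset.sum_eq_zero fun a _ => ?_
  rw [coeffAct_apply, gen, proj_inc_ne (hc a).symm, map_zero, zero_mul, map_zero]
  simp

theorem wedge_coeffAct_one_gen {i : ℕ} (c : Fin n)
    (B : FreeAssoc m →ₗ[ℂ] Form (FreeLieSum m n) i) (γ : Fin (i + 1) → Fin n)
    (v : Fin (i + 1) → Fin m) (hγ : Function.Injective γ) (b : Fin (i + 1)) (hb : γ b = c) :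
    wedge (coeffAct c B 1) (fun a => gen (γ a) (v a)) =
      (-1 : ℤ) ^ (b : ℕ) • B (FreeAlgebra.ι ℂ (v b)) (b.removeNth fun a => gen (γ a) (v a)) := by
  rw [wedge_apply, Finset.sum_eq_single b]
  · rw [coeffAct_apply, gen, hb, proj_inc, toAssoc_of, mul_one]
  · intro a _ ha
    have : γ a ≠ c := fun h => ha (hγ (h.trans hb.symm))
    rw [coeffAct_apply, gen, proj_inc_ne this.symm, map_zero, zero_mul, map_zero]
    simp
  · simp

theorem differential_gen_eq_zero {i : ℕ} (f : Form (FreeLieSum m n) i) (γ : Fin (i + 1) → Fin n)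
    (v : Fin (i + 1) → Fin m) (hγ : Function.Injective γ) :
    differential i f (fun a => gen (γ a) (v a)) = 0 :=
  differential_eq_zero_of_lie_eq_zero _ _ fun _ _ hab => lie_inc_inc_of_ne (hγ.ne hab) _ _

theorem eq_of_apply_one_of_mul_ι {E : Type} [AddCommGroup E] [Module ℂ E]
    {B : FreeAssoc m →ₗ[ℂ] E} (h : ∀ u j, B (u * FreeAlgebra.ι ℂ j) = 0) (u : FreeAssoc m) :
    B u = aug u • B 1 := by
  conv_lhs => rw [eq_aug_add_sum_fox u, map_add, map_sum, Finset.sum_eq_zero fun j _ => h _ j,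
    add_zero, Algebra.algebraMap_eq_smul_one, map_smul]

/-- Evaluate the cocycle identity at the coefficient `1` on the tuple with a generator of colour `c`
put in front. All brackets vanish, and only the term where the coefficient absorbs that generator
survives. -/
theorem restrictFamily_one_gen {i : ℕ} (c : Fin n)
    {F : S →ₗ[ℂ] FreeAssoc m →ₗ[ℂ] Form (FreeLieSum m n) i} (hd : ∀ s, twDiff c (F s) = 0)
    (s : Fin m → S) (γ : Fin i → Fin n) (v : Fin i → Fin m) (hγ : Function.Injective γ)
    (hc : ∀ a, γ a ≠ c) : restrictFamily F s 1 (fun a => gen (γ a) (v a)) = 0 := by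
  rw [restrictFamily_apply, form_sum_apply]
  refine Finset.sum_eq_zero fun j _ => ?_
  have h1 := congrArg (fun B : FreeAssoc m →ₗ[ℂ] Form (FreeLieSum m n) (i + 1) =>
    B 1 (Matrix.vecCons (gen c j) fun a => gen (γ a) (v a))) (hd (s j))
  simp only [twDiff_apply, AlternatingMap.sub_apply] at h1
  rw [cons_gen, differential_gen_eq_zero _ _ _ (cons_injective hγ hc),
    wedge_coeffAct_one_gen c _ _ _ (cons_injective hγ hc) 0 rfl] at h1
  simp only [LinearMap.zero_apply, zero_sub, AlternatingMap.zero_apply] at h1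
  rw [one_mul]
  simp only [Fin.val_zero, pow_zero, one_smul, neg_eq_zero] at h1
  exact h1

/-- This is the long exact sequence of `0 → U^m → U → ℂ → 0` on cochains. A primitive on the
augmentation ideal is extended to `U`, leaving a cocycle with trivial coefficients. Its values on
distinct colours including `c` need not vanish, but become coboundaries over `U`; `shiftFamily`
removes them. -/
theorem isTwBoundary_of_restrictFamily {w : ℕ} (hP : Acyclic m n w) (hσ : HasWeight σ w)
    (c : Fin n) {i : ℕ} {F : S →ₗ[ℂ] FreeAssoc m →ₗ[ℂ] Form (FreeLieSum m n) i}
    (hF : IsTwEquivariant σ F) (hd : ∀ s, twDiff c (F s) = 0)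
    (hv : ∀ s (γ : Fin i → Fin n) (v : Fin i → Fin m), Function.Injective γ → (∀ a, γ a ≠ c) →
        F s 1 (fun a => gen (γ a) (v a)) = 0)
    (hR : IsTwBoundary (vecRep σ) c (restrictFamily F)) : IsTwBoundary σ c F := by
  cases i with
  | zero =>
    have hR' : restrictFamily F = 0 := hR
    refine LinearMap.ext fun s => LinearMap.ext fun u => ?_
    have h0 : F s 1 = 0 := AlternatingMap.ext fun x => by
      have := hv s Fin.elim0 Fin.elim0 (fun a => a.elim0) (fun a => a.elim0)
      rw [Subsingleton.elim x fun a => gen (Fin.elim0 a) (Fin.elim0 a), this]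
      rfl
    rw [eq_of_apply_one_of_mul_ι (B := F s), h0, smul_zero]
    · rfl
    · intro u j
      rw [← restrictFamily_single, hR']
      rfl
  | succ i =>
    obtain ⟨H', hH', hHd⟩ := hR
    set H := extendFamily H' with hH
    have hHe : IsTwEquivariant σ H := hH'.extendFamily
    -- `F2` vanishes on the augmentation ideal, hence factors through the augmentation and is
    -- determined by the trivial-coefficient cocycle `f`.
    set F2 := F - twDiff c ∘ₗ H with hF2
    have hF2e : IsTwEquivariant σ F2 := hF.sub (hHe.twDiff c)
    have hF2d : ∀ s, twDiff c (F2 s) = 0 := fun s => by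
      rw [hF2, LinearMap.sub_apply, map_sub, hd, LinearMap.comp_apply, twDiff_twDiff, sub_zero]
    have hF2ι : ∀ s u j, F2 s (u * FreeAlgebra.ι ℂ j) = 0 := fun s u j => by
      rw [hF2, LinearMap.sub_apply, LinearMap.sub_apply, LinearMap.comp_apply, hH,
        twDiff_extendFamily_mul_ι, hHd, restrictFamily_single, sub_self]
    set f := F2.flip 1 with hf
    have hfe : IsEquivariant σ f := hF2e.apply_one
    have hfs : ∀ s, f s = F2 s 1 := fun s => rfl
    have hfd : ∀ s, differential (i + 1) (f s) = 0 := fun s => by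
      have h1 : coeffAct c (F2 s) 1 = 0 := by
        refine LinearMap.ext fun y => ?_
        rw [coeffAct_apply, eq_of_apply_one_of_mul_ι (hF2ι s), map_mul, aug_toAssoc, zero_mul,
          zero_smul]
        rfl
      have h2 := twDiff_apply c (F2 s) 1
      rw [hF2d, h1, map_zero, sub_zero] at h2
      exact h2.symm
    set G := shiftFamily c f with hG
    have hGe : IsTwEquivariant σ G := hfe.shiftFamily c
    -- Adding this coboundary keeps the vanishing on the augmentation ideal and subtracts from `f`,
    -- on a tuple of distinct colours with `c` in place `b`, the value `(-1)^b f(x_b, …)`, which is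
    -- the value of `f` itself.
    set F3 := F2 + twDiff c ∘ₗ G with hF3
    have hF3e : IsTwEquivariant σ F3 := hF2e.add (hGe.twDiff c)
    have hF3ι : ∀ s u j, F3 s (u * FreeAlgebra.ι ℂ j) = 0 := fun s u j => by
      rw [hF3, LinearMap.add_apply, LinearMap.add_apply, hF2ι, LinearMap.comp_apply, hG,
        twDiff_shiftFamily_mul_ι c hfd, add_zero]
    have hG1 : ∀ s, twDiff c (G s) 1 = -wedge (coeffAct c (G s) 1) := fun s => by
      have : G s 1 = 0 := by
        rw [hG, shiftFamily_apply, degreeOne_one, map_zero, contract_zero]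
        rfl
      rw [twDiff_apply, this, map_zero, zero_sub]
    have hF3s : ∀ s, F3.flip 1 s = f s - wedge (coeffAct c (G s) 1) := fun s => by
      rw [sub_eq_add_neg, ← hG1]
      rfl
    obtain ⟨h, hhe, hhd⟩ := hP S σ hσ (i + 1) (F3.flip 1) hF3e.apply_one (fun s => by
      have h1 : F3.flip 1 s = F2 s 1 + twDiff c (G s) 1 := rfl
      have h2 := twDiff_apply c (twDiff c (G s)) 1
      have h3 : coeffAct c (twDiff c (G s)) 1 = 0 := by
        refine LinearMap.ext fun y => ?_
        rw [coeffAct_apply, eq_of_apply_one_of_mul_ι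
          (twDiff_shiftFamily_mul_ι c hfd s), map_mul, aug_toAssoc, zero_mul, zero_smul]
        rfl
      rw [twDiff_twDiff, h3, map_zero, sub_zero, LinearMap.zero_apply] at h2
      rw [h1, map_add, ← hfs, hfd, ← h2, add_zero]) (fun s γ v hγ => by
      rw [hF3s, AlternatingMap.sub_apply]
      by_cases hc : ∀ a, γ a ≠ c
      · rw [wedge_coeffAct_one_gen_of_ne c _ _ _ hc, sub_zero, hfs, hF2, LinearMap.sub_apply,
          LinearMap.sub_apply, AlternatingMap.sub_apply, hv s γ v hγ hc, LinearMap.comp_apply,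
          twDiff_apply, AlternatingMap.sub_apply, wedge_coeffAct_one_gen_of_ne c _ _ _ hc, hH,
          extendFamily_one, map_zero]
        simp
      · push Not at hc
        obtain ⟨b, hb⟩ := hc
        rw [wedge_coeffAct_one_gen c _ _ _ hγ b hb, hG, shiftFamily_apply, sub_eq_zero]
        have h1 := (f s).neg_one_pow_smul_map_insertNth b (gen (γ b) (v b))
          (b.removeNth fun a => gen (γ a) (v a))
        have h2 : b.insertNth (gen (γ b) (v b)) (b.removeNth fun a => gen (γ a) (v a)) =
            fun a => (gen (γ a) (v a) : FreeLieSum m n) :=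
          Fin.insertNth_self_removeNth b fun a => (gen (γ a) (v a) : FreeLieSum m n)
        rw [h2] at h1
        have h3 : degreeOne (FreeAlgebra.ι ℂ (v b)) = FreeLieAlgebra.of ℂ (v b) := by
          simpa using degreeOne_mul_ι 1 (v b)
        have h4 : (fun a => killColor c (b.removeNth (fun a => gen (γ a) (v a)) a)) =
            b.removeNth fun a => (gen (γ a) (v a) : FreeLieSum m n) := by
          funext a
          refine killColor_gen_of_ne (fun h => ?_) _
          exact Fin.succAbove_ne b a (hγ (h.trans hb.symm))
        rw [AlternatingMap.compLinearMap_apply]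
        change _ = (-1 : ℤ) ^ (b : ℕ) • (contract _ (f s)) (fun a => killColor c _)
        rw [h4, contract_apply, h3, ← hb]
        change _ = (-1 : ℤ) ^ (b : ℕ) • f s (Matrix.vecCons (gen (γ b) (v b)) _)
        rw [← h1, smul_smul, ← pow_add, Even.neg_one_pow ⟨_, rfl⟩, one_smul])
    refine ⟨augFamily h - G + H, (hhe.augFamily.sub hGe).add hHe, fun s => ?_⟩
    have h1 : twDiff c (augFamily h s) = F3 s := by
      refine LinearMap.ext fun u => ?_
      rw [twDiff_augFamily, hhd, eq_of_apply_one_of_mul_ι (hF3ι s) u]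
      rfl
    rw [LinearMap.add_apply, LinearMap.sub_apply, map_add, map_sub, h1, hF3, hF2]
    simp only [LinearMap.add_apply, LinearMap.sub_apply, LinearMap.comp_apply]
    abel

/-- In weight 0 a coefficient given by a nonempty word is already too heavy, so the restriction to
the augmentation ideal is zero. -/
theorem twAcyclic_zero (c : Fin n) : TwAcyclic m c 0 := by
  intro S _ _ σ hσ i F hF hd hv
  refine isTwBoundary_of_restrictFamily acyclic_zero hσ c hF hd hv ?_
  have h0 : restrictFamily F = 0 := by
    have h1 : ∀ s j, F s ∘ₗ LinearMap.mulRight ℂ (FreeAlgebra.ι ℂ j) = 0 := fun s j => by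
      refine LinearMap.ext_on span_assocWord ?_
      rintro _ ⟨v, rfl⟩
      refine form_eq_zero_of_words _ fun p => ?_
      by_contra h
      have h2 : assocWord v * FreeAlgebra.ι ℂ j = assocWord (v ++ [j]) := by simp [assocWord]
      rw [LinearMap.comp_apply, LinearMap.mulRight_apply, h2] at h
      have := hF.weight_eq hσ s _ p h
      simp at this
    refine LinearMap.ext fun s => LinearMap.ext fun u => ?_
    rw [restrictFamily_apply]
    exact Finset.sum_eq_zero fun j _ => congrArg (fun B : FreeAssoc m →ₗ[ℂ] _ => B u) (h1 (s j) j)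
  cases i with
  | zero => exact h0
  | succ i => exact ⟨0, fun A s u => rfl, fun s => by rw [h0, LinearMap.zero_apply, map_zero]; rfl⟩

theorem twAcyclic (c : Fin n) (w : ℕ) : TwAcyclic m c w := by
  -- The trivial-coefficient statement in weight `w + 1` uses the twisted one in weight `w` for all
  -- colours at once.
  induction w generalizing c with
  | zero => exact twAcyclic_zero c
  | succ w ih =>
    intro S _ _ σ hσ i F hF hd hv
    refine isTwBoundary_of_restrictFamily (acyclic_succ ih) hσ c hF hd hv ?_
    refine ih c _ (vecRep σ) hσ.vecRep i _ hF.restrictFamily (fun s => ?_)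
      (restrictFamily_one_gen c hd)
    rw [twDiff_restrictFamily]
    have : twDiff c ∘ₗ F = 0 := LinearMap.ext hd
    rw [this]
    refine LinearMap.ext fun u => ?_
    rw [restrictFamily_apply]
    exact Finset.sum_eq_zero fun j _ => rfl

theorem acyclic (w : ℕ) : Acyclic m n w := by
  cases w with
  | zero => exact acyclic_zero
  | succ w => exact acyclic_succ fun c => twAcyclic c w

end Acyclic

end

end FreeLieResolution

namespace FreeLieResolution

noncomputable section

/-! ### Young symmetrizers -/

section GroupAlgebra

variable {G : Type} [Group G]

theorem trace_mulRight [Fintype G] (y : MonoidAlgebra ℂ G) :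
    LinearMap.trace ℂ _ (LinearMap.mulRight ℂ y) = Fintype.card G * y.coeff 1 := by
  classical
  rw [LinearMap.trace_eq_matrix_trace ℂ (MonoidAlgebra.basis G ℂ), Matrix.trace]
  have h : ∀ g : G, (MonoidAlgebra.basis G ℂ).repr (MonoidAlgebra.single g 1 * y) g =
      y.coeff 1 := by
    intro g
    change (MonoidAlgebra.single g 1 * y).coeff g = _
    simp
  simp [LinearMap.toMatrix_apply, h]

/-- Right multiplication by `y` is nilpotent, so its trace, `|G|` times the coefficient at 1,
vanishes. -/
theorem coeff_one_eq_zero_of_mul_self [Fintype G] {y : MonoidAlgebra ℂ G} (h : y * y = 0) :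
    y.coeff 1 = 0 := by
  have hn : IsNilpotent (LinearMap.mulRight ℂ y) :=
    ⟨2, LinearMap.ext fun x => by simp [pow_two, mul_assoc, h]⟩
  have := (LinearMap.isNilpotent_trace_of_isNilpotent hn).eq_zero
  rw [trace_mulRight] at this
  simpa using this

theorem eq_zero_of_coeff_one_mul {y : MonoidAlgebra ℂ G} (h : ∀ x, (x * y).coeff 1 = 0) :
    y = 0 := by
  ext g
  simpa using h (MonoidAlgebra.single g⁻¹ 1)

theorem mul_mem_span_of_single {a b z : MonoidAlgebra ℂ G}
    (h : ∀ g, ∃ r : ℂ, a * MonoidAlgebra.single g 1 * b = r • z) (x : MonoidAlgebra ℂ G) :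
    ∃ r : ℂ, a * x * b = r • z := by
  induction x using MonoidAlgebra.induction_linear with
  | zero => exact ⟨0, by simp⟩
  | add x y hx hy =>
    obtain ⟨r, hr⟩ := hx
    obtain ⟨s, hs⟩ := hy
    exact ⟨r + s, by rw [mul_add, add_mul, hr, hs, add_smul]⟩
  | single g t =>
    obtain ⟨r, hr⟩ := h g
    refine ⟨t * r, ?_⟩
    have : MonoidAlgebra.single g t = t • MonoidAlgebra.single g (1 : ℂ) := by simp
    rw [this, mul_smul_comm, smul_mul_assoc, hr, smul_smul]

end GroupAlgebra

/-! ### Von Neumann's lemma and irreducibility of the Specht module. -/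

section Young

variable (μ : YoungDiagram)

theorem single_mul_rowSum {p : Perm μ.cells} (hp : ∀ c, (p c).1.1 = c.1.1) :
    MonoidAlgebra.single p 1 * rowSum μ = rowSum μ := by
  simp only [rowSum, Finset.mul_sum, MonoidAlgebra.single_mul_single, mul_one]
  refine Finset.sum_bij' (fun q _ => p * q) (fun q _ => p⁻¹ * q) ?_ ?_ ?_ ?_ ?_
  · intro q hq
    simp only [Finset.mem_filter, Finset.mem_univ, true_and] at hq ⊢
    intro c
    rw [Perm.mul_apply, hp, hq]
  · intro q hq
    simp only [Finset.mem_filter, Finset.mem_univ, true_and] at hq ⊢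
    intro c
    rw [Perm.mul_apply, ← hp, ← Perm.mul_apply, mul_inv_cancel, Perm.one_apply, hq]
  all_goals simp

theorem rowSum_mul_single {p : Perm μ.cells} (hp : ∀ c, (p c).1.1 = c.1.1) :
    rowSum μ * MonoidAlgebra.single p 1 = rowSum μ := by
  simp only [rowSum, Finset.sum_mul, MonoidAlgebra.single_mul_single, mul_one]
  refine Finset.sum_bij' (fun q _ => q * p) (fun q _ => q * p⁻¹) ?_ ?_ ?_ ?_ ?_
  · intro q hq
    simp only [Finset.mem_filter, Finset.mem_univ, true_and] at hq ⊢
    intro c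
    rw [Perm.mul_apply, hq, hp]
  · intro q hq
    simp only [Finset.mem_filter, Finset.mem_univ, true_and] at hq ⊢
    intro c
    rw [Perm.mul_apply, hq, ← hp, ← Perm.mul_apply, mul_inv_cancel, Perm.one_apply]
  all_goals simp

theorem single_mul_colSum {p : Perm μ.cells} (hp : ∀ c, (p c).1.2 = c.1.2) :
    MonoidAlgebra.single p 1 * colSum μ = ((Perm.sign p : ℤ) : ℂ) • colSum μ := by
  simp only [colSum, Finset.mul_sum, MonoidAlgebra.single_mul_single, one_mul, Finset.smul_sum,
    MonoidAlgebra.smul_single]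
  refine Finset.sum_bij' (fun q _ => p * q) (fun q _ => p⁻¹ * q) ?_ ?_ ?_ ?_ ?_
  · intro q hq
    simp only [Finset.mem_filter, Finset.mem_univ, true_and] at hq ⊢
    intro c
    rw [Perm.mul_apply, hp, hq]
  · intro q hq
    simp only [Finset.mem_filter, Finset.mem_univ, true_and] at hq ⊢
    intro c
    rw [Perm.mul_apply, ← hp, ← Perm.mul_apply, mul_inv_cancel, Perm.one_apply, hq]
  · simp
  · simp
  · intro q _
    have h := Int.units_mul_self (Perm.sign p)
    congr 1
    rw [Perm.sign_mul, smul_eq_mul, ← Int.cast_mul, ← Units.val_mul, ← mul_assoc, h, one_mul]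

/-- The order of the group of row permutations. -/
def rowCard : ℕ := (Finset.univ.filter fun p : Perm μ.cells => ∀ c, (p c).1.1 = c.1.1).card

theorem rowCard_ne_zero : (rowCard μ : ℂ) ≠ 0 := by
  rw [Nat.cast_ne_zero]
  exact Finset.card_ne_zero_of_mem (a := 1) (by simp)

theorem rowSum_mul_rowSum : rowSum μ * rowSum μ = (rowCard μ : ℂ) • rowSum μ := by
  have h : rowSum μ * rowSum μ =
      ∑ p : Perm μ.cells with ∀ c, (p c).1.1 = c.1.1, MonoidAlgebra.single p 1 * rowSum μ := by
    conv_lhs => rw [rowSum, Finset.sum_mul]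
    rfl
  rw [h, Finset.sum_congr rfl (g := fun _ => rowSum μ), Finset.sum_const, rowCard,
    Nat.cast_smul_eq_nsmul]
  intro p hp
  exact single_mul_rowSum μ (by simpa using hp)

theorem coeff_one_youngSymmetrizer : (youngSymmetrizer μ).coeff 1 = 1 := by
  classical
  simp only [youngSymmetrizer, rowSum, colSum, Finset.sum_mul, Finset.mul_sum,
    MonoidAlgebra.single_mul_single, MonoidAlgebra.coeff_sum, Finsupp.finsetSum_apply, one_mul]
  rw [Finset.sum_eq_single_of_mem 1 (by simp)]
  · rw [Finset.sum_eq_single_of_mem 1 (by simp)]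
    · simp
    · intro p _ hp
      simp [hp]
  · intro q hq hq1
    refine Finset.sum_eq_zero fun p hp => ?_
    simp only [Finset.mem_filter, Finset.mem_univ, true_and] at hp hq
    simp only [MonoidAlgebra.coeff_single]
    rw [Finsupp.single_apply_eq_zero]
    intro h1
    refine absurd ?_ hq1
    ext c : 1
    refine Subtype.ext (Prod.ext ?_ (hq c))
    rw [← hp (q c), ← Perm.mul_apply, ← h1]

/-- Let `r` be the length of the column of `c`. Column by column, the boxes sent by `g` to the first
`r` rows are at most as many as the boxes lying there, because `g` separates the rows of a column.
The totals agree since `g` is bijective, so equality holds in each column, and the column of `c`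
lies entirely in the first `r` rows. -/
theorem row_lt_of_column_injective (g : Perm μ.cells)
    (h : ∀ c d : μ.cells, c.1.2 = d.1.2 → (g c).1.1 = (g d).1.1 → c = d) (c : μ.cells) :
    ((g c).1.1, c.1.2) ∈ μ.cells := by
  classical
  set r := μ.colLen c.1.2 with hr
  let A : ℕ → Finset μ.cells := fun j => {d | (g d).1.1 < r ∧ d.1.2 = j}
  let B : ℕ → Finset μ.cells := fun j => {d | d.1.1 < r ∧ d.1.2 = j}
  let J : Finset ℕ := Finset.univ.image fun d : μ.cells => d.1.2
  have hle : ∀ j ∈ J, (A j).card ≤ (B j).card := by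
    intro j _
    by_cases hj : μ.colLen j ≤ r
    · refine Finset.card_le_card fun d hd => ?_
      simp only [A, B, Finset.mem_filter, Finset.mem_univ, true_and] at hd ⊢
      refine ⟨lt_of_lt_of_le ?_ hj, hd.2⟩
      rw [← hd.2, ← YoungDiagram.mem_iff_lt_colLen]
      exact (YoungDiagram.mem_cells _).1 d.2
    · push Not at hj
      have h1 : (A j).card ≤ (Finset.range r).card := by
        refine Finset.card_le_card_of_injOn (fun d => (g d).1.1) ?_ ?_
        · intro d hd
          simp only [A, Finset.coe_filter, Finset.mem_univ, true_and, Set.mem_ofPred_eq] at hd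
          simpa using hd.1
        · intro d hd e he hde
          simp only [A, Finset.coe_filter, Finset.mem_univ, true_and, Set.mem_ofPred_eq] at hd he
          exact h d e (hd.2.trans he.2.symm) hde
      refine h1.trans ?_
      refine Finset.card_le_card_of_surjOn (fun d : μ.cells => d.1.1) ?_
      intro i hi
      simp only [Finset.coe_range, Set.mem_Iio] at hi
      have hm : (i, j) ∈ μ.cells :=
        (YoungDiagram.mem_cells _).2 (YoungDiagram.mem_iff_lt_colLen.2 (hi.trans hj))
      exact ⟨⟨(i, j), hm⟩, by simp [B, hi], rfl⟩
  have hsum : ∑ j ∈ J, (A j).card = ∑ j ∈ J, (B j).card := by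
    have h1 := Finset.card_eq_sum_card_fiberwise (f := fun d : μ.cells => d.1.2)
      (s := {d : μ.cells | (g d).1.1 < r}) (t := J) (fun d _ => by simp [J])
    have h2 := Finset.card_eq_sum_card_fiberwise (f := fun d : μ.cells => d.1.2)
      (s := {d : μ.cells | d.1.1 < r}) (t := J) (fun d _ => by simp [J])
    simp only [Finset.filter_filter] at h1 h2
    rw [← h1, ← h2]
    refine Finset.card_bij (fun d _ => g d) ?_ ?_ ?_
    · intro d hd
      simpa using hd
    · intro d _ e _ hde
      exact g.injective hde
    · intro d hd
      exact ⟨g.symm d, by simpa using hd, by simp⟩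
  have heq := (Finset.sum_eq_sum_iff_of_le hle).1 hsum c.1.2
    (Finset.mem_image_of_mem _ (Finset.mem_univ c))
  have hB : B c.1.2 = Finset.univ.filter fun d : μ.cells => d.1.2 = c.1.2 := by
    ext d
    simp only [B, Finset.mem_filter, Finset.mem_univ, true_and, and_iff_right_iff_imp]
    intro hd
    rw [hr, ← hd, ← YoungDiagram.mem_iff_lt_colLen]
    exact (YoungDiagram.mem_cells _).1 d.2
  have hA : A c.1.2 = Finset.univ.filter fun d : μ.cells => d.1.2 = c.1.2 := by
    refine Finset.eq_of_subset_of_card_le ?_ ?_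
    · intro d hd
      simp only [A, Finset.mem_filter, Finset.mem_univ, true_and] at hd ⊢
      exact hd.2
    · rw [← hB, heq]
  have hc : c ∈ A c.1.2 := by
    rw [hA]
    simp
  simp only [A, Finset.mem_filter, Finset.mem_univ, true_and] at hc
  exact (YoungDiagram.mem_cells _).2 (YoungDiagram.mem_iff_lt_colLen.2 hc.1)

/-- `q` moves each box within its column to the row of its image under `g`; what remains of `g`
preserves rows. -/
theorem exists_row_mul_column (g : Perm μ.cells)
    (h : ∀ c d : μ.cells, c.1.2 = d.1.2 → (g c).1.1 = (g d).1.1 → c = d) :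
    ∃ p q : Perm μ.cells, (∀ c, (p c).1.1 = c.1.1) ∧ (∀ c, (q c).1.2 = c.1.2) ∧ g = p * q := by
  let f : μ.cells → μ.cells := fun c => ⟨_, row_lt_of_column_injective μ g h c⟩
  have hf : Function.Injective f := by
    intro c d hcd
    have h1 := congrArg (fun e : μ.cells => e.1) hcd
    simp only [f, Prod.mk.injEq] at h1
    exact h c d h1.2 h1.1
  let q : Perm μ.cells := Equiv.ofBijective f (Finite.injective_iff_bijective.1 hf)
  refine ⟨g * q⁻¹, q, ?_, fun c => rfl, by simp⟩
  intro c
  obtain ⟨d, rfl⟩ := q.surjective c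
  rw [← Perm.mul_apply, inv_mul_cancel_right]
  rfl

/-- Von Neumann's lemma. If `g` is not a row permutation times a column permutation, it sends two
boxes of one column into one row. The transposition of the two boxes is absorbed with sign `-1` by
`colSum`, its conjugate with sign `+1` by `rowSum`, so the product is its own negative. -/
theorem rowSum_mul_single_mul_colSum (g : Perm μ.cells) :
    ∃ r : ℂ, rowSum μ * MonoidAlgebra.single g 1 * colSum μ = r • youngSymmetrizer μ := by
  classical
  by_cases h : ∀ c d : μ.cells, c.1.2 = d.1.2 → (g c).1.1 = (g d).1.1 → c = d
  · obtain ⟨p, q, hp, hq, rfl⟩ := exists_row_mul_column μ g h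
    refine ⟨((Perm.sign q : ℤ) : ℂ), ?_⟩
    have : MonoidAlgebra.single (p * q) (1 : ℂ) =
        MonoidAlgebra.single p 1 * MonoidAlgebra.single q 1 := by
      simp [MonoidAlgebra.single_mul_single]
    rw [this, ← mul_assoc, rowSum_mul_single μ hp, mul_assoc, single_mul_colSum μ hq,
      mul_smul_comm, youngSymmetrizer]
  · push Not at h
    obtain ⟨c, d, hcol, hrow, hne⟩ := h
    have ht : ∀ e, (Equiv.swap c d e).1.2 = e.1.2 := by
      intro e
      rw [Equiv.swap_apply_def]
      split_ifs with h1 h2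
      · rw [h1, hcol]
      · rw [h2, hcol]
      · rfl
    have hs : ∀ e, (Equiv.swap (g c) (g d) e).1.1 = e.1.1 := by
      intro e
      rw [Equiv.swap_apply_def]
      split_ifs with h1 h2
      · rw [h1, hrow]
      · rw [h2, hrow]
      · rfl
    have hcomm : MonoidAlgebra.single (Equiv.swap (g c) (g d)) (1 : ℂ) *
        MonoidAlgebra.single g 1 = MonoidAlgebra.single g 1 *
          MonoidAlgebra.single (Equiv.swap c d) 1 := by
      rw [MonoidAlgebra.single_mul_single, MonoidAlgebra.single_mul_single,
        Equiv.mul_swap_eq_swap_mul]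
    have hneg : rowSum μ * MonoidAlgebra.single g 1 * colSum μ =
        -(rowSum μ * MonoidAlgebra.single g 1 * colSum μ) := by
      conv_lhs => rw [← rowSum_mul_single μ hs, mul_assoc (rowSum μ), hcomm, mul_assoc,
        mul_assoc, single_mul_colSum μ ht]
      simp [Perm.sign_swap hne, mul_assoc]
    refine ⟨0, ?_⟩
    rw [zero_smul]
    have h2 : (2 : ℂ) • (rowSum μ * MonoidAlgebra.single g 1 * colSum μ) = 0 := by
      rw [two_smul, add_eq_zero_iff_eq_neg]
      exact hneg
    exact (smul_eq_zero.1 h2).resolve_left two_ne_zero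

theorem rowSum_mul_mul_colSum (x : MonoidAlgebra ℂ (Perm μ.cells)) :
    ∃ r : ℂ, rowSum μ * x * colSum μ = r • youngSymmetrizer μ :=
  mul_mem_span_of_single (rowSum_mul_single_mul_colSum μ) x

theorem youngSymmetrizer_mul_mul (x : MonoidAlgebra ℂ (Perm μ.cells)) :
    ∃ r : ℂ, youngSymmetrizer μ * x * youngSymmetrizer μ = r • youngSymmetrizer μ := by
  obtain ⟨r, hr⟩ := rowSum_mul_mul_colSum μ (colSum μ * x * rowSum μ)
  exact ⟨r, by rw [← hr, youngSymmetrizer]; simp only [mul_assoc]⟩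

/-- If `α` were 0 the symmetrizer would have square zero, yet its coefficient at the identity is 1.
-/
theorem youngSymmetrizer_mul_self : ∃ α : ℂ, α ≠ 0 ∧
    youngSymmetrizer μ * youngSymmetrizer μ = α • youngSymmetrizer μ := by
  obtain ⟨α, h⟩ := youngSymmetrizer_mul_mul μ 1
  rw [mul_one] at h
  refine ⟨α, ?_, h⟩
  rintro rfl
  rw [zero_smul] at h
  have := coeff_one_eq_zero_of_mul_self h
  rw [coeff_one_youngSymmetrizer] at this
  exact one_ne_zero this

theorem mem_range_mulYoungSymmetrizer {x : MonoidAlgebra ℂ (Perm μ.cells)} :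
    x ∈ (mulYoungSymmetrizer μ).range.toSubmodule ↔ ∃ y, y * youngSymmetrizer μ = x :=
  Iff.rfl

theorem leftRegular_apply {G : Type} [Group G] (g : G) (x : MonoidAlgebra ℂ G) :
    Representation.leftRegular ℂ G g x = MonoidAlgebra.single g 1 * x := by
  induction x using MonoidAlgebra.induction_linear with
  | zero => simp
  | add a b ha hb => rw [map_add, ha, hb, mul_add]
  | single a r => simp [MonoidAlgebra.single_mul_single]

theorem boxSpecht_apply (g : Perm μ.cells) (x : (mulYoungSymmetrizer μ).range.toSubmodule) :
    (boxSpecht μ g x : MonoidAlgebra ℂ (Perm μ.cells)) = MonoidAlgebra.single g 1 * x.1 :=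
  leftRegular_apply g x.1

theorem boxSpecht_generates {U : Submodule ℂ (mulYoungSymmetrizer μ).range.toSubmodule}
    (hU : ∀ g, ∀ x ∈ U, boxSpecht μ g x ∈ U) (hne : U ≠ ⊥) : U = ⊤ := by
  set c := youngSymmetrizer μ with hc
  have hmul : ∀ (y : MonoidAlgebra ℂ (Perm μ.cells)) (x) (hx : x ∈ U),
      ∃ z ∈ U, (z : MonoidAlgebra ℂ (Perm μ.cells)) = y * x.1 := by
    intro y x hx
    induction y using MonoidAlgebra.induction_linear with
    | zero => exact ⟨0, U.zero_mem, by simp⟩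
    | add a b ha hb =>
      obtain ⟨z, hz, h1⟩ := ha
      obtain ⟨w, hw, h2⟩ := hb
      exact ⟨z + w, U.add_mem hz hw, by simp [h1, h2, add_mul]⟩
    | single g t =>
      refine ⟨t • boxSpecht μ g x, U.smul_mem _ (hU g x hx), ?_⟩
      rw [Submodule.coe_smul, boxSpecht_apply, ← smul_mul_assoc]
      simp
  obtain ⟨x, hx, hx0⟩ := (Submodule.ne_bot_iff _).1 hne
  -- If `c` kills `U`, then each multiple `yx` of an element `x` of `U` has square zero, since `x`
  -- ends in `c`. So all its coefficients at 1 vanish and `x = 0`. Otherwise `cu` is a nonzero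
  -- multiple of `c`, which generates the module.
  by_cases h : ∀ u ∈ U, c * u.1 = 0
  · exfalso
    apply hx0
    apply Subtype.ext
    refine eq_zero_of_coeff_one_mul fun y => coeff_one_eq_zero_of_mul_self ?_
    obtain ⟨w, hw⟩ := (mem_range_mulYoungSymmetrizer μ).1 x.2
    obtain ⟨z, hz, h1⟩ := hmul y x hx
    rw [← h1]
    conv_lhs => enter [1]; rw [h1, ← hw]
    rw [← hc, mul_assoc, mul_assoc, h z hz, mul_zero, mul_zero]
  · push Not at h
    obtain ⟨u, hu, hcu⟩ := h
    obtain ⟨w, hw⟩ := (mem_range_mulYoungSymmetrizer μ).1 u.2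
    obtain ⟨r, hr⟩ := youngSymmetrizer_mul_mul μ w
    rw [← hc] at hr hw
    rw [← hw, ← mul_assoc, hr] at hcu
    have hr0 : r ≠ 0 := by
      rintro rfl
      simp at hcu
    rw [eq_top_iff]
    intro v _
    obtain ⟨y, hy⟩ := (mem_range_mulYoungSymmetrizer μ).1 v.2
    obtain ⟨z, hz, h1⟩ := hmul (r⁻¹ • (y * c)) u hu
    have : v = z := by
      apply Subtype.ext
      rw [h1, ← hy, ← hw, smul_mul_assoc, mul_assoc, ← mul_assoc c, hr, mul_smul_comm, smul_smul,
        inv_mul_cancel₀ hr0, one_smul]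
    rw [this]
    exact hz

theorem youngSymmetrizer_ne_zero : youngSymmetrizer μ ≠ 0 := by
  intro h
  have := coeff_one_youngSymmetrizer μ
  rw [h] at this
  simp at this

theorem specht_generates (T : μ.cells ≃ Fin μ.card)
    {U : Submodule ℂ (mulYoungSymmetrizer μ).range.toSubmodule}
    (hU : ∀ g, ∀ x ∈ U, specht μ T g x ∈ U) (hne : U ≠ ⊥) : U = ⊤ := by
  refine boxSpecht_generates μ (fun g x hx => ?_) hne
  have := hU (T.permCongrHom g) x hx
  have h2 : specht μ T (T.permCongrHom g) = boxSpecht μ g := by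
    change boxSpecht μ (T.symm.permCongrHom (T.permCongrHom g)) = _
    congr 1
    exact T.permCongrHom.symm_apply_apply g
  rwa [h2] at this

theorem specht_isIrreducible (T : μ.cells ≃ Fin μ.card) : (specht μ T).IsIrreducible := by
  have hnt : Nontrivial (Subrepresentation (specht μ T)) := by
    refine ⟨⊥, ⊤, fun h => ?_⟩
    have h1 : (⟨youngSymmetrizer μ, 1, one_mul _⟩ : (mulYoungSymmetrizer μ).range.toSubmodule) ∈
        (⊥ : Subrepresentation (specht μ T)).toSubmodule := by
      rw [h]
      exact Submodule.mem_top
    exact youngSymmetrizer_ne_zero μ (congrArg Subtype.val ((Submodule.mem_bot ℂ).1 h1))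
  refine { eq_bot_or_eq_top := fun U => ?_ }
  by_cases h : U.toSubmodule = ⊥
  · left
    exact Subrepresentation.toSubmodule_injective h
  · right
    exact Subrepresentation.toSubmodule_injective
      (specht_generates μ T (fun g x hx => U.apply_mem_toSubmodule g hx) h)

end Young

end

end FreeLieResolution

namespace FreeLieResolution

noncomputable section

/-! ### Schur–Weyl duality -/

section Polarization

variable {ι E F : Type} [Fintype ι] [DecidableEq ι] [AddCommGroup E] [Module ℂ E]
  [AddCommGroup F] [Module ℂ F]

/-- A multilinear map vanishing on the diagonal outside finitely many points of every line through
a fixed point vanishes on the diagonal. -/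
theorem multilinear_diagonal_eq_zero (f : MultilinearMap ℂ (fun _ : ι => E) F) (e : E) (x : E)
    (h : {s : ℂ | f (fun _ => x + s • e) = 0}.Infinite) : f (fun _ => x) = 0 := by
  rw [← Module.forall_dual_apply_eq_zero_iff ℂ]
  intro l
  -- Multilinear expansion of `l (f (x + s e, …))` as a polynomial in `s`; `t` is the set of places
  -- taken by `x`.
  let p : Polynomial ℂ := ∑ t : Finset ι,
    Polynomial.C (l (f (t.piecewise (fun _ => x) fun _ => e))) * Polynomial.X ^ tᶜ.card
  have hp : ∀ s, p.eval s = l (f fun _ => x + s • e) := by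
    intro s
    have h1 : (fun _ : ι => x + s • e) = (fun _ => x) + fun _ => s • e := rfl
    rw [h1, f.map_add_univ, map_sum, Polynomial.eval_finsetSum]
    refine Finset.sum_congr rfl fun t _ => ?_
    have h2 : t.piecewise (fun _ => x) (fun _ => s • e) =
        fun i => (if i ∈ t then (1 : ℂ) else s) • t.piecewise (fun _ => x) (fun _ => e) i := by
      funext i
      by_cases hi : i ∈ t <;> simp [hi]
    rw [h2, f.map_smul_univ, map_smul, Finset.prod_ite]
    simp only [Finset.prod_const, one_pow, one_mul, Polynomial.eval_mul, Polynomial.eval_C,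
      Polynomial.eval_pow, Polynomial.eval_X, smul_eq_mul]
    rw [mul_comm]
    congr 3
    ext i
    simp
  have h0 : p = 0 := by
    refine Polynomial.eq_zero_of_infinite_isRoot p (h.mono fun s hs => ?_)
    change p.eval s = 0
    rw [hp, show f (fun _ => x + s • e) = 0 from hs, map_zero]
  have := hp 0
  rw [h0] at this
  simpa using this.symm

/-- Polarization: a multilinear map vanishing on the diagonal has zero symmetrization. -/
theorem multilinear_symmetrization_eq_zero (f : MultilinearMap ℂ (fun _ : ι => E) F)
    (h : ∀ x, f (fun _ => x) = 0) (N : ι → E) : ∑ σ : Perm ι, f (fun i => N (σ i)) = 0 := by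
  rw [← Module.forall_dual_apply_eq_zero_iff ℂ]
  intro l
  let P : MvPolynomial ι ℂ := ∑ r : ι → ι,
    MvPolynomial.C (l (f fun i => N (r i))) * ∏ i, MvPolynomial.X (r i)
  have hP : P = 0 := by
    refine MvPolynomial.funext fun t => ?_
    have h1 := h (∑ j, t j • N j)
    rw [f.map_sum] at h1
    have h2 := congrArg l h1
    rw [map_sum, map_zero] at h2
    rw [map_zero, ← h2]
    simp only [P, map_sum, map_mul, map_prod, MvPolynomial.eval_C, MvPolynomial.eval_X]
    refine Finset.sum_congr rfl fun r _ => ?_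
    rw [f.map_smul_univ (fun i => t (r i)) (fun i => N (r i)), map_smul, smul_eq_mul, mul_comm]
  -- The polynomial `P` is the diagonal value at `∑ t_j N_j`. Its coefficient at the squarefree
  -- monomial in all variables collects exactly the bijective index maps.
  let ones : ι →₀ ℕ := ∑ i, Finsupp.single i 1
  have hmon : ∀ r : ι → ι, (∏ i, MvPolynomial.X (r i) : MvPolynomial ι ℂ) =
      MvPolynomial.monomial (∑ i, Finsupp.single (r i) 1) 1 := by
    intro r
    rw [MvPolynomial.monomial_sum_one]
    rfl
  have hones : ∀ j, ones j = 1 := by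
    intro j
    simp [ones, Finsupp.single_apply]
  have hbij : ∀ r : ι → ι, (∑ i, Finsupp.single (r i) 1 : ι →₀ ℕ) = ones ↔
      Function.Bijective r := by
    intro r
    constructor
    · intro hr
      refine Finite.surjective_iff_bijective.1 fun j => ?_
      by_contra hj
      push Not at hj
      have := hones j
      rw [← hr] at this
      simp [hj] at this
    · intro hr
      exact (Equiv.ofBijective r hr).sum_comp fun j => (Finsupp.single j 1 : ι →₀ ℕ)
  have hc := congrArg (MvPolynomial.coeff ones) hP
  simp only [P, MvPolynomial.coeff_sum, hmon, MvPolynomial.coeff_C_mul,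
    MvPolynomial.coeff_monomial, hbij, MvPolynomial.coeff_zero, mul_ite, mul_one, mul_zero] at hc
  rw [← Finset.sum_filter] at hc
  rw [map_sum, ← hc]
  refine Finset.sum_bij' (fun σ _ => (σ : ι → ι))
    (fun r hr => Equiv.ofBijective r (by simpa using hr)) ?_ ?_ ?_ ?_ ?_
  · intro σ _
    simp
  · simp
  · intro σ _
    ext
    rfl
  · intro r _
    rfl
  · intro σ _
    rfl

end Polarization

/-! ### Schur–Weyl duality through the double commutant. -/

section SchurWeyl

variable {ι U : Type} [AddCommGroup U] [Module ℂ U]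

theorem permTensor_tprod (σ : Perm ι) (u : ι → U) :
    permTensor ι U σ (PiTensorProduct.tprod ℂ u) =
      PiTensorProduct.tprod ℂ fun i => u (σ⁻¹ i) :=
  PiTensorProduct.reindex_tprod σ u

theorem permTensor_map (σ : Perm ι) (N : ι → U →ₗ[ℂ] U) :
    permTensor ι U σ ∘ₗ PiTensorProduct.map N ∘ₗ permTensor ι U σ⁻¹ =
      PiTensorProduct.map fun i => N (σ⁻¹ i) := by
  refine PiTensorProduct.ext (MultilinearMap.ext fun u => ?_)
  simp only [LinearMap.compMultilinearMap_apply, LinearMap.comp_apply, permTensor_tprod,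
    PiTensorProduct.map_tprod, inv_inv, ← Perm.mul_apply, mul_inv_cancel, Perm.one_apply]

/-- The matrix units of a tensor-product basis are tensor products of matrix units. -/
theorem linearMap_ext_map [Finite ι] [FiniteDimensional ℂ U] {F : Type} [AddCommGroup F] [Module ℂ F]
    {K K' : ((⨂[ℂ] _ : ι, U) →ₗ[ℂ] ⨂[ℂ] _ : ι, U) →ₗ[ℂ] F}
    (h : ∀ N : ι → U →ₗ[ℂ] U, K (PiTensorProduct.map N) = K' (PiTensorProduct.map N)) : K = K' := by
  classical
  have := Fintype.ofFinite ι
  let b := Module.finBasis ℂ U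
  let B := Basis.piTensorProduct fun _ : ι => b
  refine (B.linearMap B).ext fun fg => ?_
  have : B.linearMap B fg = PiTensorProduct.map fun i => b.linearMap b (fg.1 i, fg.2 i) := by
    refine B.ext fun k => ?_
    rw [Module.Basis.linearMap_apply_apply]
    simp only [B, Basis.piTensorProduct_apply, PiTensorProduct.map_tprod,
      Module.Basis.linearMap_apply_apply]
    split_ifs with hk
    · subst hk
      simp
    · obtain ⟨i, hi⟩ := Function.ne_iff.1 hk
      exact ((PiTensorProduct.tprod ℂ).map_coord_zero i (by simp [hi])).symm
  rw [this, h]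

variable [Fintype ι] [DecidableEq ι]

/-- The average of an endomorphism of a tensor power over the permutations of the factors,
up to a factor. -/
def tensorAverage : ((⨂[ℂ] _ : ι, U) →ₗ[ℂ] ⨂[ℂ] _ : ι, U) →ₗ[ℂ]
    (⨂[ℂ] _ : ι, U) →ₗ[ℂ] ⨂[ℂ] _ : ι, U :=
  ∑ σ : Perm ι, LinearMap.compRight ℂ (permTensor ι U σ) ∘ₗ
    LinearMap.lcomp ℂ _ (permTensor ι U σ⁻¹)

theorem tensorAverage_apply (D : (⨂[ℂ] _ : ι, U) →ₗ[ℂ] ⨂[ℂ] _ : ι, U) :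
    tensorAverage D = ∑ σ : Perm ι, permTensor ι U σ ∘ₗ D ∘ₗ permTensor ι U σ⁻¹ := by
  simp only [tensorAverage, LinearMap.sum_apply]
  rfl

/-- The commutator with `Φ` vanishes on `N ⊗ ⋯ ⊗ N` for invertible `N`, then for all `N` because `N
+ s` is invertible for all but finitely many `s`. By polarization it vanishes on symmetrized tensors
of endomorphisms. -/
theorem commute_tensorAverage [FiniteDimensional ℂ U] {Φ : (⨂[ℂ] _ : ι, U) →ₗ[ℂ] ⨂[ℂ] _ : ι, U}
    (hΦ : ∀ N : Module.End ℂ U, IsUnit N →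
      Φ ∘ₗ PiTensorProduct.map (fun _ => N) = PiTensorProduct.map (fun _ => N) ∘ₗ Φ)
    (D : (⨂[ℂ] _ : ι, U) →ₗ[ℂ] ⨂[ℂ] _ : ι, U) :
    Φ ∘ₗ tensorAverage D = tensorAverage D ∘ₗ Φ := by
  let K : ((⨂[ℂ] _ : ι, U) →ₗ[ℂ] ⨂[ℂ] _ : ι, U) →ₗ[ℂ] (⨂[ℂ] _ : ι, U) →ₗ[ℂ] ⨂[ℂ] _ : ι, U :=
    LinearMap.compRight ℂ Φ - LinearMap.lcomp ℂ _ Φ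
  have hK : ∀ D, K D = Φ ∘ₗ D - D ∘ₗ Φ := fun _ => rfl
  let f := K.compMultilinearMap (PiTensorProduct.mapMultilinear ℂ (fun _ : ι => U) fun _ => U)
  have hf : ∀ N : ι → U →ₗ[ℂ] U, f N = K (PiTensorProduct.map N) := fun _ => rfl
  have hdiag : ∀ N : U →ₗ[ℂ] U, f (fun _ => N) = 0 := by
    intro N
    refine multilinear_diagonal_eq_zero f 1 N ?_
    have hfin := (Module.End.finite_spectrum (-N : Module.End ℂ U)).infinite_compl
    refine hfin.mono fun s hs => ?_
    change f _ = 0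
    rw [Set.mem_compl_iff, spectrum.mem_iff, not_not, sub_neg_eq_add, add_comm] at hs
    rw [hf, hK, sub_eq_zero]
    refine hΦ (N + s • 1) ?_
    rwa [← Algebra.algebraMap_eq_smul_one]
  have hz : K ∘ₗ tensorAverage = 0 := by
    refine linearMap_ext_map fun N => ?_
    rw [LinearMap.comp_apply, tensorAverage_apply, LinearMap.zero_apply, map_sum]
    simp only [permTensor_map, ← hf]
    rw [← multilinear_symmetrization_eq_zero f hdiag N]
    exact Fintype.sum_equiv (Equiv.inv (Perm ι)) _ _ fun σ => rfl
  have := LinearMap.congr_fun hz D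
  rw [LinearMap.comp_apply, hK, LinearMap.zero_apply, sub_eq_zero] at this
  exact this

theorem tensorAverage_of_commute {D : (⨂[ℂ] _ : ι, U) →ₗ[ℂ] ⨂[ℂ] _ : ι, U}
    (hD : ∀ σ, permTensor ι U σ ∘ₗ D = D ∘ₗ permTensor ι U σ) :
    tensorAverage D = (Fintype.card (Perm ι) : ℂ) • D := by
  rw [tensorAverage_apply, Finset.sum_congr rfl (g := fun _ => D), Finset.sum_const,
    Finset.card_univ, Nat.cast_smul_eq_nsmul]
  intro σ _
  have h : permTensor ι U σ ∘ₗ permTensor ι U σ⁻¹ = LinearMap.id := by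
    rw [← Module.End.mul_eq_comp, ← map_mul, mul_inv_cancel, map_one]
    rfl
  rw [← LinearMap.comp_assoc, hD, LinearMap.comp_assoc, h, LinearMap.comp_id]

/-- Schur–Weyl duality: an endomorphism of a tensor power commuting with the general linear group
comes from the group algebra of the symmetric group. -/
theorem exists_asAlgebraHom_eq [FiniteDimensional ℂ U]
    {Φ : (⨂[ℂ] _ : ι, U) →ₗ[ℂ] ⨂[ℂ] _ : ι, U}
    (hΦ : ∀ N : Module.End ℂ U, IsUnit N →
      Φ ∘ₗ PiTensorProduct.map (fun _ => N) = PiTensorProduct.map (fun _ => N) ∘ₗ Φ) :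
    ∃ a : MonoidAlgebra ℂ (Perm ι), (permTensor ι U).asAlgebraHom a = Φ := by
  classical
  let ρ := permTensor ι U
  let R := MonoidAlgebra ℂ (Perm ι)
  have hlin : ∀ (D : Module.End R ρ.asModule) (r : R) (x : ρ.asModule),
      D (ρ.asAlgebraHom r x) = ρ.asAlgebraHom r (D x) := fun D r x => D.map_smul r x
  have hcomm : ∀ (D : Module.End R ρ.asModule) (x : ρ.asModule), Φ (D x) = D (Φ x) := by
    intro D x
    let D' : (⨂[ℂ] _ : ι, U) →ₗ[ℂ] ⨂[ℂ] _ : ι, U :=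
      { toFun := fun x => D x
        map_add' := fun x y => D.map_add x y
        map_smul' := fun t x => by
          have h1 := hlin D (algebraMap ℂ R t) x
          rw [AlgHom.commutes] at h1
          exact h1 }
    have hD' : ∀ σ, permTensor ι U σ ∘ₗ D' = D' ∘ₗ permTensor ι U σ := by
      intro σ
      refine LinearMap.ext fun y => ?_
      have h1 := hlin D (MonoidAlgebra.single σ 1 : R) y
      rw [Representation.asAlgebraHom_single_one] at h1
      exact h1.symm
    have h2 := commute_tensorAverage hΦ D'
    rw [tensorAverage_of_commute hD', LinearMap.comp_smul, LinearMap.smul_comp] at h2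
    have h3 : (Fintype.card (Perm ι) : ℂ) ≠ 0 := Nat.cast_ne_zero.2 Fintype.card_ne_zero
    exact LinearMap.congr_fun (smul_right_injective _ h3 h2) x
  let f : Module.End (Module.End R ρ.asModule) ρ.asModule :=
    { toFun := fun x => Φ x
      map_add' := fun x y => Φ.map_add x y
      map_smul' := fun D x => hcomm D x }
  let B := Module.finBasis ℂ (⨂[ℂ] _ : ι, U)
  -- The tensor power is semisimple over the group algebra, and `Φ` commutes with its commutant;
  -- density gives one group algebra element agreeing with `Φ` on a whole basis.
  obtain ⟨r, hr⟩ := jacobson_density (R := R) f (Finset.univ.image B)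
  refine ⟨r, B.ext fun i => ?_⟩
  exact (hr (B i) (Finset.mem_image_of_mem _ (Finset.mem_univ i))).symm

end SchurWeyl

end

end FreeLieResolution

namespace FreeLieResolution

noncomputable section

/-! ### The Specht module as a multiplicity space of the multilinear forms on `V` -/

section Transposition

variable (μ : YoungDiagram)

/-- The bijection between the boxes of a Young diagram and those of its transpose. -/
def transposeCells : μ.cells ≃ μ.transpose.cells where
  toFun c := ⟨c.1.swap, by
    rw [YoungDiagram.mem_cells, YoungDiagram.mem_transpose, ← YoungDiagram.mem_cells]
    exact c.2⟩
  invFun c := ⟨c.1.swap, by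
    have := c.2
    rwa [YoungDiagram.mem_cells, YoungDiagram.mem_transpose] at this⟩
  left_inv _ := rfl
  right_inv _ := rfl

/-- The isomorphism of group algebras transposing the boxes, twisted by the sign. -/
def signTranspose :
    MonoidAlgebra ℂ (Perm μ.cells) →ₐ[ℂ] MonoidAlgebra ℂ (Perm μ.transpose.cells) :=
  MonoidAlgebra.lift ℂ _ _
    { toFun := fun σ => MonoidAlgebra.single ((transposeCells μ).permCongrHom σ)
        ((Perm.sign σ : ℤ) : ℂ)
      map_one' := by
        rw [map_one, map_one]
        simp [MonoidAlgebra.one_def]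
      map_mul' := fun σ τ => by
        rw [MonoidAlgebra.single_mul_single, map_mul, map_mul]
        push_cast
        rfl }

theorem signTranspose_single (σ : Perm μ.cells) (t : ℂ) :
    signTranspose μ (MonoidAlgebra.single σ t) =
      MonoidAlgebra.single ((transposeCells μ).permCongrHom σ) (t * ((Perm.sign σ : ℤ) : ℂ)) := by
  simp [signTranspose]

theorem sign_sq {ι : Type} [Fintype ι] [DecidableEq ι] (σ : Perm ι) :
    ((Perm.sign σ : ℤ) : ℂ) * ((Perm.sign σ : ℤ) : ℂ) = 1 := by
  rw [← Int.cast_mul, ← Units.val_mul, Int.units_mul_self]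
  simp

theorem signTranspose_surjective : Function.Surjective (signTranspose μ) := by
  intro x
  induction x using MonoidAlgebra.induction_linear with
  | zero => exact ⟨0, map_zero _⟩
  | add a b ha hb =>
    obtain ⟨y, rfl⟩ := ha
    obtain ⟨z, rfl⟩ := hb
    exact ⟨y + z, map_add _ _ _⟩
  | single σ t =>
    refine ⟨MonoidAlgebra.single ((transposeCells μ).permCongrHom.symm σ)
      (t * ((Perm.sign ((transposeCells μ).permCongrHom.symm σ) : ℤ) : ℂ)), ?_⟩
    rw [signTranspose_single, MulEquiv.apply_symm_apply, mul_assoc, sign_sq, mul_one]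

/-- Transposing turns rows into columns, and the sign twist turns the plain sum into the signed one.
-/
theorem signTranspose_rowSum : signTranspose μ (rowSum μ) = colSum μ.transpose := by
  simp only [rowSum, colSum, map_sum, signTranspose_single, one_mul]
  refine Finset.sum_equiv (transposeCells μ).permCongrHom.toEquiv ?_ ?_
  · intro σ
    simp only [Finset.mem_filter, Finset.mem_univ, true_and]
    constructor
    · intro h c
      exact h ((transposeCells μ).symm c)
    · intro h c
      exact h (transposeCells μ c)
  · intro σ _
    congr 3
    exact (Perm.sign_permCongr (transposeCells μ) σ).symm

theorem signTranspose_colSum : signTranspose μ (colSum μ) = rowSum μ.transpose := by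
  simp only [rowSum, colSum, map_sum, signTranspose_single, sign_sq]
  refine Finset.sum_equiv (transposeCells μ).permCongrHom.toEquiv ?_ ?_
  · intro σ
    simp only [Finset.mem_filter, Finset.mem_univ, true_and]
    constructor
    · intro h c
      exact h ((transposeCells μ).symm c)
    · intro h c
      exact h (transposeCells μ c)
  · intro σ _
    rfl

end Transposition

/-! ### Tensor powers of the dual space as spaces of multilinear forms. -/

section MultilinearForms

variable (ι : Type) (m : ℕ)

/-- The multilinear forms on `V = ℂ^m` in variables indexed by `ι`. -/
abbrev MultiForm : Type := MultilinearMap ℂ (fun _ : ι => Fin m → ℂ) ℂ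

/-- The tensor power of `V^*`. -/
abbrev DualPower : Type := ⨂[ℂ] _ : ι, Module.Dual ℂ (Fin m → ℂ)

/-- A tensor power of `V^*` as the space of multilinear forms on `V`. -/
def tensorForm [Finite ι] : DualPower ι m ≃ₗ[ℂ] MultiForm ι m :=
  PiTensorProduct.dualDistribEquiv.trans (PiTensorProduct.lift).symm

variable {ι m}

/-- Evaluation of multilinear forms. -/
def evalForm (v : ι → Fin m → ℂ) : MultiForm ι m →ₗ[ℂ] ℂ where
  toFun f := f v
  map_add' _ _ := rfl
  map_smul' _ _ := rfl

theorem tensorForm_tprod [Fintype ι] (ξ : ι → Module.Dual ℂ (Fin m → ℂ)) (v : ι → Fin m → ℂ) :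
    tensorForm ι m (PiTensorProduct.tprod ℂ ξ) v = ∏ b, ξ b (v b) :=
  PiTensorProduct.dualDistrib_apply ξ v

theorem dualPower_hom_ext {F : Type} [AddCommGroup F] [Module ℂ F] {f g : DualPower ι m →ₗ[ℂ] F}
    (h : ∀ ξ, f (PiTensorProduct.tprod ℂ ξ) = g (PiTensorProduct.tprod ℂ ξ)) : f = g :=
  PiTensorProduct.ext (MultilinearMap.ext h)

theorem tensorForm_permTensor [Finite ι] (σ : Perm ι) (w : DualPower ι m) (v : ι → Fin m → ℂ) :
    tensorForm ι m (permTensor ι _ σ w) v = tensorForm ι m w (v ∘ σ) := by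
  have := Fintype.ofFinite ι
  have : evalForm v ∘ₗ (tensorForm ι m).toLinearMap ∘ₗ permTensor ι _ σ =
      evalForm (v ∘ σ) ∘ₗ (tensorForm ι m).toLinearMap := by
    refine dualPower_hom_ext fun ξ => ?_
    change tensorForm ι m (permTensor ι _ σ (PiTensorProduct.tprod ℂ ξ)) v =
      tensorForm ι m (PiTensorProduct.tprod ℂ ξ) (v ∘ σ)
    rw [permTensor_tprod, tensorForm_tprod, tensorForm_tprod, ← Equiv.prod_comp σ]
    simp
  exact LinearMap.congr_fun this w

theorem tensorForm_diagTensor [Finite ι] (A : GL (Fin m) ℂ) (w : DualPower ι m) (v : ι → Fin m → ℂ) :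
    tensorForm ι m (diagTensor ι (stdRep m).dual A w) (fun b => stdRep m A (v b)) =
      tensorForm ι m w v := by
  have := Fintype.ofFinite ι
  have : evalForm (fun b => stdRep m A (v b)) ∘ₗ (tensorForm ι m).toLinearMap ∘ₗ
      diagTensor ι (stdRep m).dual A =
      evalForm v ∘ₗ (tensorForm ι m).toLinearMap := by
    refine dualPower_hom_ext fun ξ => ?_
    change tensorForm ι m (diagTensor ι _ A (PiTensorProduct.tprod ℂ ξ))
      (fun b => stdRep m A (v b)) = tensorForm ι m (PiTensorProduct.tprod ℂ ξ) v
    have h : diagTensor ι (stdRep m).dual A (PiTensorProduct.tprod ℂ ξ) =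
        PiTensorProduct.tprod ℂ fun b => (stdRep m).dual A (ξ b) :=
      PiTensorProduct.map_tprod _ _
    rw [h, tensorForm_tprod, tensorForm_tprod]
    refine Finset.prod_congr rfl fun b _ => ?_
    change ξ b (stdRep m A⁻¹ (stdRep m A (v b))) = _
    rw [Representation.inv_self_apply]
  exact LinearMap.congr_fun this w

theorem exists_dual_stdRep {N : Module.End ℂ (Module.Dual ℂ (Fin m → ℂ))} (hN : IsUnit N) :
    ∃ A : GL (Fin m) ℂ, (stdRep m).dual A = N := by
  obtain ⟨u, rfl⟩ := hN
  let e := Module.evalEquiv ℂ (Fin m → ℂ)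
  let f : Module.End ℂ (Module.Dual ℂ (Fin m → ℂ)) → Module.End ℂ (Fin m → ℂ) :=
    fun N => e.symm.toLinearMap ∘ₗ N.dualMap ∘ₗ e.toLinearMap
  have hf : ∀ (N : Module.End ℂ (Module.Dual ℂ (Fin m → ℂ))) (ξ : Module.Dual ℂ (Fin m → ℂ))
      (v : Fin m → ℂ), ξ (f N v) = N ξ v := by
    intro N ξ v
    simp [f, e]
  have hmul : ∀ M N : Module.End ℂ (Module.Dual ℂ (Fin m → ℂ)), M * N = 1 → f N * f M = 1 := by
    intro M N h
    refine LinearMap.ext fun v => ?_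
    rw [← sub_eq_zero, ← Module.forall_dual_apply_eq_zero_iff ℂ]
    intro ξ
    rw [map_sub, Module.End.mul_apply, hf, hf, ← Module.End.mul_apply, h]
    simp
  -- The transpose of `u` is taken as the inverse of `B`, since the dual representation acts through
  -- inverses.
  let B : (Module.End ℂ (Fin m → ℂ))ˣ := ⟨f u.inv, f u.val, hmul _ _ u.val_inv, hmul _ _ u.inv_val⟩
  refine ⟨Matrix.GeneralLinearGroup.toLin.symm B, ?_⟩
  refine LinearMap.ext fun ξ => LinearMap.ext fun v => ?_
  rw [← hf u.val]
  change ξ (((Matrix.GeneralLinearGroup.toLin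
    (Matrix.GeneralLinearGroup.toLin.symm B)⁻¹ : (Module.End ℂ (Fin m → ℂ))ˣ) :
      Module.End ℂ (Fin m → ℂ)) v) = _
  rw [map_inv, MulEquiv.apply_symm_apply]
  rfl

end MultilinearForms

/-! ### The Specht module as the space of equivariant families of multilinear forms. -/

section SpechtIso

variable (μ : YoungDiagram) (m : ℕ)

/-- The space of the representation `𝕊^{μ'}(V^*)`. -/
abbrev SchurSpace : Type :=
  (tensorYoungSymmetrizer μ.transpose (stdRep m).dual).range.toSubmodule

/-- The space of the Specht module. -/
abbrev SpechtSpace : Type := (mulYoungSymmetrizer μ).range.toSubmodule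

/-- The action of the group algebra of permutations of the transposed boxes. -/
abbrev boxAction : MonoidAlgebra ℂ (Perm μ.transpose.cells) →ₐ[ℂ]
    Module.End ℂ (DualPower μ.transpose.cells m) :=
  (permTensor μ.transpose.cells (Module.Dual ℂ (Fin m → ℂ))).asAlgebraHom

/-- The map from the Specht module to the families of multilinear forms. -/
def spechtForm : SpechtSpace μ →ₗ[ℂ] SchurSpace μ m →ₗ[ℂ] MultiForm μ.transpose.cells m :=
  LinearMap.mk₂ ℂ (fun x s => tensorForm _ m (boxAction μ m (signTranspose μ x.1) s.1))
    (by intros; simp) (by intros; simp) (by intros; simp) (by intros; simp)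

variable {μ m}

theorem spechtForm_apply (x : SpechtSpace μ) (s : SchurSpace μ m) :
    spechtForm μ m x s = tensorForm _ m (boxAction μ m (signTranspose μ x.1) s.1) := rfl

theorem schurSpace_eq (s : SchurSpace μ m) :
    ∃ w, boxAction μ m (youngSymmetrizer μ.transpose) w = s.1 := s.2

/-- The element of the Schur functor defined by a tensor. -/
def toSchurSpace : DualPower μ.transpose.cells m →ₗ[ℂ] SchurSpace μ m :=
  (boxAction μ m (youngSymmetrizer μ.transpose)).codRestrict _ fun w => ⟨w, rfl⟩

theorem boxAction_diagTensor (a : MonoidAlgebra ℂ (Perm μ.transpose.cells)) (A : GL (Fin m) ℂ)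
    (w : DualPower μ.transpose.cells m) :
    boxAction μ m a (diagTensor _ (stdRep m).dual A w) =
      diagTensor _ (stdRep m).dual A (boxAction μ m a w) := by
  induction a using MonoidAlgebra.induction_linear with
  | zero => simp
  | add a b ha hb => rw [map_add, LinearMap.add_apply, ha, hb, LinearMap.add_apply, map_add]
  | single σ t =>
    rw [Representation.asAlgebraHom_single, LinearMap.smul_apply, LinearMap.smul_apply, map_smul]
    congr 1
    have : permTensor μ.transpose.cells _ σ ∘ₗ diagTensor _ (stdRep m).dual A =
        diagTensor _ (stdRep m).dual A ∘ₗ permTensor μ.transpose.cells _ σ := by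
      refine dualPower_hom_ext fun ξ => ?_
      simp [permTensor, diagTensor, PiTensorProduct.map_tprod, PiTensorProduct.reindex_tprod]
    exact LinearMap.congr_fun this w

/-- Equivariance of a family of multilinear forms. -/
def IsFormEquivariant (ψ : SchurSpace μ m →ₗ[ℂ] MultiForm μ.transpose.cells m) : Prop :=
  ∀ A s v, ψ (schurDual μ m A s) (fun b => stdRep m A (v b)) = ψ s v

theorem spechtForm_isFormEquivariant (x : SpechtSpace μ) :
    IsFormEquivariant (spechtForm μ m x) := by
  intro A s v
  rw [spechtForm_apply, spechtForm_apply]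
  change tensorForm _ m (boxAction μ m _ (diagTensor _ (stdRep m).dual A s.1)) _ = _
  rw [boxAction_diagTensor, tensorForm_diagTensor]

theorem spechtForm_boxSpecht (σ : Perm μ.cells) (x : SpechtSpace μ) (s : SchurSpace μ m)
    (v : μ.transpose.cells → Fin m → ℂ) :
    spechtForm μ m (boxSpecht μ σ x) s v = ((Perm.sign σ : ℤ) : ℂ) *
      spechtForm μ m x s (v ∘ (transposeCells μ).permCongrHom σ) := by
  rw [spechtForm_apply, spechtForm_apply, boxSpecht_apply, map_mul, map_mul, signTranspose_single,
    Representation.asAlgebraHom_single, Module.End.mul_apply, LinearMap.smul_apply, map_smul,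
    smul_apply, tensorForm_permTensor, one_mul, smul_eq_mul]

theorem boxAction_youngSymmetrizer_ne_zero (hm : μ.rowLen 0 ≤ m) :
    boxAction μ m (youngSymmetrizer μ.transpose) ≠ 0 := by
  intro h0
  have hlt : ∀ b : μ.transpose.cells, b.1.1 < m := by
    intro b
    have h1 := b.2
    rw [YoungDiagram.mem_cells, YoungDiagram.mem_transpose] at h1
    have h2 := μ.up_left_mem (Nat.zero_le _) le_rfl h1
    exact (YoungDiagram.mem_iff_lt_rowLen.1 h2).trans_le hm
  -- The test vectors and covectors are indexed by the row of the box, which is possible because the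
  -- transpose has at most `m` rows. Row permutations fix `v`, while only the trivial column
  -- permutation pairs `w` with `v` nontrivially.
  let v : μ.transpose.cells → Fin m → ℂ := fun b => Pi.single ⟨b.1.1, hlt b⟩ 1
  let ξ : μ.transpose.cells → Module.Dual ℂ (Fin m → ℂ) := fun b => LinearMap.proj ⟨b.1.1, hlt b⟩
  let w : DualPower μ.transpose.cells m := PiTensorProduct.tprod ℂ ξ
  have hrow : ∀ u, tensorForm _ m (boxAction μ m (rowSum μ.transpose) u) v =
      rowCard μ.transpose * tensorForm _ m u v := by
    intro u
    simp only [rowSum, map_sum, Representation.asAlgebraHom_single_one, LinearMap.sum_apply,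
      sum_apply, tensorForm_permTensor]
    rw [Finset.sum_congr rfl (g := fun _ => tensorForm _ m u v), Finset.sum_const, nsmul_eq_mul]
    · rfl
    · intro p hp
      simp only [Finset.mem_filter, Finset.mem_univ, true_and] at hp
      congr 1
      funext b
      simp only [v, Function.comp_apply, hp b]
  have hcol : tensorForm _ m (boxAction μ m (colSum μ.transpose) w) v = 1 := by
    simp only [colSum, map_sum, Representation.asAlgebraHom_single, LinearMap.sum_apply,
      sum_apply, LinearMap.smul_apply, map_smul, smul_apply,
      tensorForm_permTensor, w, tensorForm_tprod]
    rw [Finset.sum_eq_single_of_mem 1 (by simp)]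
    · simp [ξ, v]
    · intro q hq hq1
      simp only [Finset.mem_filter, Finset.mem_univ, true_and] at hq
      obtain ⟨b, hb⟩ : ∃ b, (q b).1.1 ≠ b.1.1 := by
        by_contra hcon
        push Not at hcon
        exact hq1 (Equiv.ext fun b => Subtype.ext (Prod.ext (hcon b) (hq b)))
      rw [Finset.prod_eq_zero (Finset.mem_univ b), smul_zero]
      simp [ξ, v, hb.symm]
  have h1 : tensorForm _ m (boxAction μ m (youngSymmetrizer μ.transpose) w) v =
      rowCard μ.transpose := by
    rw [youngSymmetrizer, map_mul, Module.End.mul_apply, hrow, hcol, mul_one]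
  rw [h0] at h1
  simp only [LinearMap.zero_apply, map_zero, zero_apply] at h1
  exact rowCard_ne_zero _ h1.symm

/-- Write `a`, `b` for the row and column sums of the transpose. The image of `c_μ` is `b a`, and
`(b a)(a b)` is a nonzero multiple of `b c` with `c = a b`. If `b c` acted by zero, so would `c c =
a (b c)`, a nonzero multiple of `c`. -/
theorem spechtForm_ne_zero (hm : μ.rowLen 0 ≤ m) : spechtForm μ m ≠ 0 := by
  intro h0
  apply boxAction_youngSymmetrizer_ne_zero hm
  obtain ⟨α, hα, hsq⟩ := youngSymmetrizer_mul_self μ.transpose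
  have hzero : boxAction μ m (colSum μ.transpose * youngSymmetrizer μ.transpose) = 0 := by
    refine LinearMap.ext fun w => ?_
    have h1 := LinearMap.congr_fun (LinearMap.congr_fun h0
      ⟨youngSymmetrizer μ, 1, one_mul _⟩) (toSchurSpace w)
    rw [spechtForm_apply, LinearMap.zero_apply, LinearMap.zero_apply] at h1
    have h2 := (tensorForm μ.transpose.cells m).map_eq_zero_iff.1 h1
    change boxAction μ m (signTranspose μ (youngSymmetrizer μ))
      (boxAction μ m (youngSymmetrizer μ.transpose) w) = 0 at h2
    rw [youngSymmetrizer, map_mul, signTranspose_rowSum, signTranspose_colSum,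
      ← Module.End.mul_apply, ← map_mul, youngSymmetrizer, mul_assoc, ← mul_assoc (rowSum _),
      rowSum_mul_rowSum, smul_mul_assoc, mul_smul_comm, map_smul, LinearMap.smul_apply] at h2
    exact (smul_eq_zero.1 h2).resolve_left (rowCard_ne_zero _)
  have h3 : boxAction μ m (youngSymmetrizer μ.transpose * youngSymmetrizer μ.transpose) = 0 := by
    conv_lhs => enter [2, 1]; rw [youngSymmetrizer]
    rw [mul_assoc, map_mul, hzero, mul_zero]
  rw [hsq, map_smul] at h3
  exact (smul_eq_zero.1 h3).resolve_left hα

/-- The kernel is a subrepresentation of an irreducible representation. -/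
theorem spechtForm_injective (hm : μ.rowLen 0 ≤ m) : Function.Injective (spechtForm μ m) := by
  rw [← LinearMap.ker_eq_bot]
  by_contra hne
  have htop := boxSpecht_generates μ (U := LinearMap.ker (spechtForm μ m)) (fun σ x hx => by
    rw [LinearMap.mem_ker] at hx ⊢
    refine LinearMap.ext fun s => MultilinearMap.ext fun v => ?_
    rw [spechtForm_boxSpecht, hx]
    simp) hne
  exact spechtForm_ne_zero hm (LinearMap.ker_eq_top.1 htop)

theorem exists_spechtForm_eq {ψ : SchurSpace μ m →ₗ[ℂ] MultiForm μ.transpose.cells m}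
    (hψ : IsFormEquivariant ψ) : ∃ x, spechtForm μ m x = ψ := by
  let Φ : DualPower μ.transpose.cells m →ₗ[ℂ] DualPower μ.transpose.cells m :=
    (tensorForm _ m).symm.toLinearMap ∘ₗ ψ ∘ₗ toSchurSpace
  have hΦ : ∀ w, tensorForm _ m (Φ w) = ψ (toSchurSpace w) := fun w =>
    (tensorForm _ m).apply_symm_apply _
  -- Precomposing `ψ` with the symmetrizer gives an equivariant endomorphism of the whole tensor
  -- power, to which Schur–Weyl duality applies.
  obtain ⟨z, hz⟩ := exists_asAlgebraHom_eq (Φ := Φ) (by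
    intro N hN
    obtain ⟨A, rfl⟩ := exists_dual_stdRep hN
    refine LinearMap.ext fun w => (tensorForm _ m).injective (MultilinearMap.ext fun v => ?_)
    obtain ⟨u, rfl⟩ : ∃ u : μ.transpose.cells → Fin m → ℂ, v = fun b => stdRep m A (u b) :=
      ⟨fun b => stdRep m A⁻¹ (v b), funext fun b => (Representation.self_inv_apply _ _ _).symm⟩
    change tensorForm _ m (Φ (diagTensor _ (stdRep m).dual A w)) (fun b => stdRep m A (u b)) =
      tensorForm _ m (diagTensor _ (stdRep m).dual A (Φ w)) (fun b => stdRep m A (u b))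
    have h1 : toSchurSpace (diagTensor _ (stdRep m).dual A w) =
        schurDual μ m A (toSchurSpace w) := Subtype.ext (boxAction_diagTensor _ A w)
    rw [tensorForm_diagTensor, hΦ, hΦ, h1, hψ])
  obtain ⟨α, hα, hsq⟩ := youngSymmetrizer_mul_self μ.transpose
  set c := youngSymmetrizer μ.transpose with hc
  set r : ℂ := ((rowCard μ.transpose : ℕ) : ℂ) with hr
  have hr0 : r ≠ 0 := rowCard_ne_zero _
  -- With `a`, `b` the row and column sums, the resulting element acts by a multiple of `z a b a = z
  -- c a`. On the image of `c` the factors `a` and `c` act by `r` and `α`, and `ψ` is `α⁻¹ z` there;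
  -- this fixes the constant.
  obtain ⟨y, hy⟩ := signTranspose_surjective μ ((α⁻¹ * α⁻¹ * r⁻¹) • (z * rowSum μ.transpose))
  refine ⟨⟨y * youngSymmetrizer μ, y, rfl⟩, LinearMap.ext fun s => ?_⟩
  have hs : boxAction μ m c s.1 = α • s.1 := by
    obtain ⟨w, hw⟩ := schurSpace_eq s
    rw [← hw, ← Module.End.mul_apply, ← map_mul, hsq, map_smul, LinearMap.smul_apply]
  have hs' : boxAction μ m (rowSum μ.transpose) s.1 = r • s.1 := by
    obtain ⟨w, hw⟩ := schurSpace_eq s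
    rw [← hw, ← Module.End.mul_apply, ← map_mul, youngSymmetrizer, ← mul_assoc,
      rowSum_mul_rowSum, smul_mul_assoc, map_smul, LinearMap.smul_apply]
  have h1 : toSchurSpace s.1 = α • s := Subtype.ext hs
  have h2 : ψ s = α⁻¹ • tensorForm _ m (boxAction μ m z s.1) := by
    have h3 := hΦ s.1
    rw [← hz, h1, map_smul] at h3
    rw [h3, smul_smul, inv_mul_cancel₀ hα, one_smul]
  rw [spechtForm_apply, h2, map_mul (signTranspose μ), hy, youngSymmetrizer,
    map_mul (signTranspose μ), signTranspose_rowSum, signTranspose_colSum]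
  have h4 : boxAction μ m ((α⁻¹ * α⁻¹ * r⁻¹) • (z * rowSum μ.transpose) *
      (colSum μ.transpose * rowSum μ.transpose)) s.1 = α⁻¹ • boxAction μ m z s.1 := by
    rw [smul_mul_assoc, ← mul_assoc, mul_assoc z, ← youngSymmetrizer, ← hc, map_smul, map_mul,
      LinearMap.smul_apply, Module.End.mul_apply, hs', map_smul, map_mul, Module.End.mul_apply, hs,
      map_smul, smul_smul, smul_smul]
    congr 1
    field_simp
  rw [h4, map_smul]

end SpechtIso

end

end FreeLieResolution

namespace FreeLieResolution

noncomputable section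

/-! ### Maps to induced representations -/

section Induced

variable {G H X A : Type} [Group G] [Group H] [AddCommGroup X] [Module ℂ X] [AddCommGroup A]
  [Module ℂ A] {j : H →* G} {ρ : Representation ℂ H A}

theorem indV_mk_eq (u : G) (h : H) (a : A) :
    Representation.IndV.mk j ρ (j h * u) (ρ h a) = Representation.IndV.mk j ρ u a := by
  have := Representation.Coinvariants.mk_self_apply
    (Representation.tprod ((Representation.leftRegular ℂ G).comp j) ρ) h
    (MonoidAlgebra.single u (1 : ℂ) ⊗ₜ[ℂ] a)
  refine Eq.trans ?_ this
  change Representation.Coinvariants.mk _ (MonoidAlgebra.single (j h * u) (1 : ℂ) ⊗ₜ[ℂ] ρ h a) =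
    Representation.Coinvariants.mk _ (Representation.leftRegular ℂ G (j h)
      (MonoidAlgebra.single u 1) ⊗ₜ[ℂ] ρ h a)
  rw [leftRegular_apply, MonoidAlgebra.single_mul_single, one_mul]

/-- The map to an induced representation with prescribed components. -/
def toInd [Fintype G] (j : H →* G) (ρ : Representation ℂ H A) (β : G → X →ₗ[ℂ] A) :
    X →ₗ[ℂ] Representation.IndV j ρ :=
  ∑ g, Representation.IndV.mk j ρ g⁻¹ ∘ₗ β g

theorem toInd_apply [Fintype G] (β : G → X →ₗ[ℂ] A) (x : X) :
    toInd j ρ β x = ∑ g, Representation.IndV.mk j ρ g⁻¹ (β g x) := by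
  simp only [toInd, LinearMap.sum_apply, LinearMap.comp_apply]

theorem toInd_equivariant [Fintype G] {τ : Representation ℂ G X} {β : G → X →ₗ[ℂ] A}
    (h : ∀ u g x, β g (τ u x) = β (u⁻¹ * g) x) (u : G) (x : X) :
    toInd j ρ β (τ u x) = Representation.ind j ρ u (toInd j ρ β x) := by
  rw [toInd_apply, toInd_apply, map_sum]
  refine Fintype.sum_equiv (Equiv.mulLeft u⁻¹) _ _ fun g => ?_
  rw [Representation.ind_mk, h]
  simp

variable [DecidableEq G] [Fintype H]

/-- The component at `g` of an element of the tensor product defining an induced representation,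
viewed as a coinduced representation. -/
def indComponentAux (j : H →* G) (ρ : Representation ℂ H A) (g : G) :
    MonoidAlgebra ℂ G ⊗[ℂ] A →ₗ[ℂ] A :=
  TensorProduct.lift ((MonoidAlgebra.basis G ℂ).constr ℂ fun u =>
    ∑ h : H with u = j h * g⁻¹, ρ h⁻¹)

theorem indComponentAux_tmul (g u : G) (a : A) :
    indComponentAux j ρ g (MonoidAlgebra.single u 1 ⊗ₜ a) =
      ∑ h : H with u = j h * g⁻¹, ρ h⁻¹ a := by
  rw [indComponentAux, TensorProduct.lift.tmul, ← MonoidAlgebra.basis_apply,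
    Module.Basis.constr_basis, LinearMap.sum_apply]

/-- The component at `g` of an element of an induced representation, viewed as a coinduced
representation. -/
def indComponent (j : H →* G) (ρ : Representation ℂ H A) (g : G) :
    Representation.IndV j ρ →ₗ[ℂ] A :=
  Representation.Coinvariants.lift _ (indComponentAux j ρ g) (by
    intro h₀
    refine TensorProduct.ext (MonoidAlgebra.lhom_ext' fun u => LinearMap.ext_ring
      (LinearMap.ext fun a => ?_))
    change indComponentAux j ρ g (Representation.leftRegular ℂ G (j h₀)
      (MonoidAlgebra.single u 1) ⊗ₜ ρ h₀ a) = indComponentAux j ρ g (MonoidAlgebra.single u 1 ⊗ₜ a)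
    rw [leftRegular_apply, MonoidAlgebra.single_mul_single, one_mul, indComponentAux_tmul,
      indComponentAux_tmul]
    refine Finset.sum_bij' (fun h _ => h₀⁻¹ * h) (fun h _ => h₀ * h) ?_ ?_ ?_ ?_ ?_
    · intro h hh
      simp only [Finset.mem_filter, Finset.mem_univ, true_and] at hh ⊢
      rw [map_mul, mul_assoc, ← hh, map_inv, inv_mul_cancel_left]
    · intro h hh
      simp only [Finset.mem_filter, Finset.mem_univ, true_and] at hh ⊢
      rw [hh, map_mul, mul_assoc]
    · simp
    · simp
    · intro h _
      rw [mul_inv_rev, inv_inv, map_mul]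
      rfl)

theorem indComponent_mk (g u : G) (a : A) :
    indComponent j ρ g (Representation.IndV.mk j ρ u a) =
      ∑ h : H with u = j h * g⁻¹, ρ h⁻¹ a := by
  exact indComponentAux_tmul g u a

variable [Fintype G]

/-- Viewed in the coinduced module, the component of `toInd j ρ β x` at `g` is `|H|` times `β g x`:
each `h` contributes through the single index `g * j h⁻¹`. -/
theorem toInd_eq_zero_iff {β : G → X →ₗ[ℂ] A} (hβ : ∀ g h x, β (g * j h) x = ρ h⁻¹ (β g x))
    (x : X) : toInd j ρ β x = 0 ↔ ∀ g, β g x = 0 := by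
  constructor
  · intro hx g
    have h1 := congrArg (indComponent j ρ g) hx
    rw [toInd_apply, map_sum, map_zero] at h1
    simp only [indComponent_mk] at h1
    have h2 : ∑ g' : G, ∑ h : H with g'⁻¹ = j h * g⁻¹, ρ h⁻¹ (β g' x) = ∑ _h : H, β g x := by
      simp only [Finset.sum_filter]
      rw [Finset.sum_comm]
      refine Finset.sum_congr rfl fun h _ => ?_
      rw [Finset.sum_eq_single (g * j h⁻¹)]
      · rw [if_pos (by simp), hβ, inv_inv, ← Module.End.mul_apply, ← map_mul, inv_mul_cancel,
          map_one, Module.End.one_apply]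
      · intro g' _ hg'
        rw [if_neg]
        intro h3
        apply hg'
        rw [← inv_inv g', h3, mul_inv_rev, inv_inv, map_inv]
      · simp
    rw [h2, Finset.sum_const, Finset.card_univ, ← Nat.cast_smul_eq_nsmul ℂ] at h1
    exact (smul_eq_zero.1 h1).resolve_left (Nat.cast_ne_zero.2 Fintype.card_ne_zero)
  · intro h
    rw [toInd_apply]
    simp [h]

/-- An `x` supported on one coset maps to the generator for that coset multiplied by the size `N` of
the coset, as all its summands coincide. -/
theorem toInd_surjective {β : G → X →ₗ[ℂ] A} (hβ : ∀ g h x, β (g * j h) x = ρ h⁻¹ (β g x))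
    (hsurj : ∀ g a, ∃ x, β g x = a ∧ ∀ g', (∀ h, g' ≠ g * j h) → β g' x = 0) :
    Function.Surjective (toInd j ρ β) := by
  classical
  rw [← LinearMap.range_eq_top, ← Submodule.ker_mkQ (LinearMap.range (toInd j ρ β)),
    LinearMap.ker_eq_top]
  refine Representation.IndV.hom_ext j ρ fun u => LinearMap.ext fun a => ?_
  rw [LinearMap.zero_comp, LinearMap.zero_apply, LinearMap.comp_apply, Submodule.mkQ_apply,
    Submodule.Quotient.mk_eq_zero]
  obtain ⟨x, hx, h0⟩ := hsurj u⁻¹ a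
  let N := (Finset.univ.filter fun g : G => ∃ h, g = u⁻¹ * j h).card
  have hN : (N : ℂ) ≠ 0 := by
    rw [Nat.cast_ne_zero]
    exact Finset.card_ne_zero_of_mem (a := u⁻¹) (by simpa using ⟨1, map_one j⟩)
  refine ⟨(N : ℂ)⁻¹ • x, ?_⟩
  rw [map_smul, inv_smul_eq_iff₀ hN, toInd_apply, Nat.cast_smul_eq_nsmul, ← Finset.sum_const,
    Finset.sum_filter]
  refine Finset.sum_congr rfl fun g _ => ?_
  split_ifs with hg
  · obtain ⟨h, rfl⟩ := hg
    rw [hβ, hx, mul_inv_rev, inv_inv, ← map_inv, indV_mk_eq]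
  · push Not at hg
    rw [h0 g hg, map_zero]

end Induced

end

end FreeLieResolution

namespace FreeLieResolution

noncomputable section

/-! ### The multilinear components of a family of cochains -/

section VecLie

variable {m : ℕ}

/-- The inclusion of `V` in the free Lie algebra. -/
def vecLie : (Fin m → ℂ) →ₗ[ℂ] FreeLie m :=
  ∑ j, LinearMap.toSpanSingleton ℂ _ (FreeLieAlgebra.of ℂ j) ∘ₗ LinearMap.proj j

theorem vecLie_apply (v : Fin m → ℂ) : vecLie v = ∑ j, v j • (FreeLieAlgebra.of ℂ j : FreeLie m) := by
  simp [vecLie]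

theorem vecLie_single (j : Fin m) : vecLie (Pi.single j 1) = (FreeLieAlgebra.of ℂ j : FreeLie m) := by
  rw [vecLie_apply, Finset.sum_eq_single j]
  · simp
  · intro l _ hl
    simp [hl]
  · simp

/-- The component in `V` of an element of the free Lie algebra. -/
def lieVec : FreeLie m →ₗ[ℂ] Fin m → ℂ :=
  LinearMap.pi fun j => (aug (m := m)).toLinearMap ∘ₗ fox j ∘ₗ toAssoc

theorem lieVec_vecLie (v : Fin m → ℂ) : lieVec (vecLie v) = v := by
  have : lieVec ∘ₗ vecLie = (LinearMap.id : (Fin m → ℂ) →ₗ[ℂ] Fin m → ℂ) := by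
    refine (Pi.basisFun ℂ (Fin m)).ext fun j => funext fun i => ?_
    rw [Pi.basisFun_apply, LinearMap.comp_apply, vecLie_single]
    change aug (fox i (toAssoc (FreeLieAlgebra.of ℂ j))) = (Pi.single j 1 : Fin m → ℂ) i
    rw [toAssoc_of, fox_ι]
    by_cases h : i = j
    · subst h; simp
    · simp [h]
  exact LinearMap.congr_fun this v

theorem vecLie_lieVec (x : FreeLie m) : vecLie (lieVec x) = degreeOne (toAssoc x) := by
  rw [vecLie_apply, degreeOne_apply]
  rfl

theorem stdRep_apply (A : GL (Fin m) ℂ) (v : Fin m → ℂ) : stdRep m A v = A.val.mulVec v := rfl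

theorem freeMap_vecLie (A : GL (Fin m) ℂ) (v : Fin m → ℂ) :
    freeMap A.val (vecLie v) = vecLie (stdRep m A v) := by
  simp only [vecLie_apply, map_sum, map_smul, freeMap_of, stdRep_apply, Matrix.mulVec, dotProduct,
    Finset.sum_smul, Finset.smul_sum, smul_smul]
  rw [Finset.sum_comm]
  simp only [mul_comm]

theorem lieVec_freeMap (A : GL (Fin m) ℂ) (x : FreeLie m) :
    lieVec (freeMap A.val x) = stdRep m A (lieVec x) := by
  have h : Function.Injective (vecLie (m := m)) := Function.LeftInverse.injective lieVec_vecLie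
  apply h
  rw [vecLie_lieVec, toAssoc_freeMap, degreeOne_assocMap, ← freeMap_vecLie, vecLie_lieVec]

end VecLie

/-! ### Components on vectors of prescribed colours, with values in the Specht module. -/

section ColorForm

variable {μ : YoungDiagram} (T : μ.cells ≃ Fin μ.card) {m n : ℕ}

/-- The numbering of the boxes of the transpose of a tableau. -/
def transposeNumbering : μ.transpose.cells ≃ Fin μ.card := (transposeCells μ).symm.trans T

/-- The multilinear form on `V` given by the values of a form on vectors of prescribed colours. -/
def colorPart (g : Fin μ.card → Fin n) :
    Form (FreeLieSum m n) μ.card →ₗ[ℂ] MultiForm μ.transpose.cells m where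
  toFun f := (f.toMultilinearMap.compLinearMap fun a => inc (g a) ∘ₗ vecLie).domDomCongr
    (transposeNumbering T).symm
  map_add' _ _ := rfl
  map_smul' _ _ := rfl

theorem colorPart_apply (g : Fin μ.card → Fin n) (f : Form (FreeLieSum m n) μ.card)
    (v : μ.transpose.cells → Fin m → ℂ) :
    colorPart T g f v = f fun a => inc (g a) (vecLie (v ((transposeNumbering T).symm a))) := rfl

/-- Equivariance of a family of cochains indexed by the Schur functor. -/
abbrev IsMultFamily {i : ℕ} (f : SchurSpace μ m →ₗ[ℂ] Form (FreeLieSum m n) i) : Prop :=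
  IsEquivariant (S := SchurSpace μ m) (schurDual μ m) f

theorem mult_isEquivariant {i : ℕ} (φ : Mult μ m n i) :
    IsMultFamily φ.toLinearMap := by
  intro A s
  have h := φ.isIntertwining _ _ A s
  change φ (schurDual μ m A s) = formRep (glVRep m n) i A (φ s) at h
  change (φ (schurDual μ m A s)).compLinearMap _ = φ s
  rw [h]
  change ((φ s).compLinearMap (glVRep m n A⁻¹)).compLinearMap (glVRep m n A) = φ s
  ext x
  simp only [AlternatingMap.compLinearMap_apply, Representation.inv_self_apply]

/-- An equivariant family as an element of the multiplicity space. -/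
def IsMultFamily.toMult {i : ℕ} {f : SchurSpace μ m →ₗ[ℂ] Form (FreeLieSum m n) i}
    (hf : IsMultFamily f) : Mult μ m n i :=
  LinearMap.intertwiningMap_of_isIntertwiningMap _ _ f (by
    intro A s
    rw [← hf A s]
    change f _ = ((f (schurDual μ m A s)).compLinearMap (glVRep m n A)).compLinearMap
      (glVRep m n A⁻¹)
    ext x
    simp only [AlternatingMap.compLinearMap_apply, Representation.self_inv_apply])

theorem IsMultFamily.toMult_apply {i : ℕ}
    {f : SchurSpace μ m →ₗ[ℂ] Form (FreeLieSum m n) i}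
    (hf : IsMultFamily f) (s : SchurSpace μ m) : hf.toMult s = f s := rfl

theorem colorPart_isFormEquivariant (g : Fin μ.card → Fin n) (φ : Mult μ m n μ.card) :
    IsFormEquivariant (colorPart T g ∘ₗ φ.toLinearMap) := by
  intro A s v
  rw [LinearMap.comp_apply, LinearMap.comp_apply, colorPart_apply, colorPart_apply]
  rw [← mult_isEquivariant φ A s, AlternatingMap.compLinearMap_apply]
  simp only [glVRep_inc, freeMap_vecLie]

variable (μ m) in
/-- The equivariant families of multilinear forms. -/
def equivariantForms : Submodule ℂ (SchurSpace μ m →ₗ[ℂ] MultiForm μ.transpose.cells m) where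
  carrier := {ψ | IsFormEquivariant ψ}
  add_mem' := fun {ψ χ} hψ hχ A s v => by
    change ψ _ _ + χ _ _ = ψ s v + χ s v
    rw [hψ, hχ]
  zero_mem' := fun _ _ _ => rfl
  smul_mem' := fun t ψ hψ A s v => by
    change t • ψ _ _ = t • ψ s v
    rw [hψ]

/-- The Specht module is the space of equivariant families of multilinear forms. -/
def spechtEquiv (hm : μ.rowLen 0 ≤ m) : SpechtSpace μ ≃ₗ[ℂ] equivariantForms μ m :=
  LinearEquiv.ofBijective ((spechtForm μ m).codRestrict _ spechtForm_isFormEquivariant)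
    ⟨fun x y h => spechtForm_injective hm (congrArg Subtype.val h), fun ψ => by
      obtain ⟨x, hx⟩ := exists_spechtForm_eq ψ.2
      exact ⟨x, Subtype.ext hx⟩⟩

/-- The element of the Specht module given by the values of an element of the multiplicity space
on vectors of prescribed colours. -/
def colorSpecht (hm : μ.rowLen 0 ≤ m) (g : Fin μ.card → Fin n) :
    Mult μ m n μ.card →ₗ[ℂ] SpechtSpace μ :=
  (spechtEquiv hm).symm.toLinearMap ∘ₗ LinearMap.codRestrict (equivariantForms μ m)
    { toFun := fun φ => colorPart T g ∘ₗ φ.toLinearMap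
      map_add' := fun φ ψ => LinearMap.ext fun s => map_add (colorPart T g) (φ s) (ψ s)
      map_smul' := fun t φ => LinearMap.ext fun s => map_smul (colorPart T g) t (φ s) }
    (colorPart_isFormEquivariant T g)

variable (hm : μ.rowLen 0 ≤ m)

theorem spechtForm_colorSpecht (g : Fin μ.card → Fin n) (φ : Mult μ m n μ.card)
    (s : SchurSpace μ m) (v : μ.transpose.cells → Fin m → ℂ) :
    spechtForm μ m (colorSpecht T hm g φ) s v =
      φ s fun a => inc (g a) (vecLie (v ((transposeNumbering T).symm a))) := by
  have h := (spechtEquiv hm).apply_symm_apply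
    ⟨colorPart T g ∘ₗ φ.toLinearMap, colorPart_isFormEquivariant T g φ⟩
  exact congrArg (fun ψ : SchurSpace μ m →ₗ[ℂ] MultiForm μ.transpose.cells m => ψ s v)
    (congrArg Subtype.val h)

theorem specht_ext (hm : μ.rowLen 0 ≤ m) {x y : SpechtSpace μ}
    (h : ∀ s v, spechtForm μ m x s v = spechtForm μ m y s v) : x = y :=
  spechtForm_injective hm (LinearMap.ext fun s => MultilinearMap.ext fun v => h s v)

/-- The sign from permuting the arguments of an alternating form cancels the sign built into
`signTranspose`. This is why `𝕊^{μ'}` leads to the Specht module of `μ`. -/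
theorem colorSpecht_comp_perm (g : Fin μ.card → Fin n) (σ : Perm (Fin μ.card))
    (φ : Mult μ m n μ.card) :
    colorSpecht T hm (g ∘ σ) φ = specht μ T σ⁻¹ (colorSpecht T hm g φ) := by
  refine specht_ext hm fun s v => ?_
  rw [spechtForm_colorSpecht]
  change _ = spechtForm μ m (boxSpecht μ (T.symm.permCongr σ⁻¹) (colorSpecht T hm g φ)) s v
  rw [spechtForm_boxSpecht, spechtForm_colorSpecht, Perm.sign_permCongr, Perm.sign_inv]
  have h := (φ s).map_perm (fun b => inc (g b)
    (vecLie (v ((transposeNumbering T).symm (σ⁻¹ b))))) σ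
  rw [Units.smul_def, zsmul_eq_mul] at h
  have h1 : ∀ a, σ⁻¹ (σ a) = a := fun a => σ.symm_apply_apply a
  refine Eq.trans (congrArg (φ s) (funext fun a => ?_)) (h.trans ?_)
  · simp only [Function.comp_apply, h1]
  · congr 2
    funext b
    congr 3
    simp [transposeNumbering]

theorem permRep_inc (σ : Perm (Fin n)) (c : Fin n) (x : FreeLie m) :
    permRep m n σ (inc c x) = inc (σ c) x := by
  refine freeLieSum_ext fun d => ?_
  change proj (σ.symm d) (inc c x) = proj d (inc (σ c) x)
  by_cases h : d = σ c
  · subst h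
    rw [σ.symm_apply_apply, proj_inc, proj_inc]
  · rw [proj_inc_ne h, proj_inc_ne]
    intro h1
    exact h (by rw [← h1, σ.apply_symm_apply])

theorem colorSpecht_multPerm (g : Fin μ.card → Fin n) (σ : Perm (Fin n))
    (φ : Mult μ m n μ.card) :
    colorSpecht T hm g (multPerm μ m n μ.card σ φ) = colorSpecht T hm (⇑σ⁻¹ ∘ g) φ := by
  refine specht_ext hm fun s v => ?_
  rw [spechtForm_colorSpecht, spechtForm_colorSpecht]
  change φ s (fun a => permRep m n σ⁻¹ _) = _
  simp only [permRep_inc]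
  rfl

/-- The family of cochains with a prescribed multilinear component. -/
def liftSpecht (h : Fin μ.card → Fin n) (x : SpechtSpace μ) :
    SchurSpace μ m →ₗ[ℂ] Form (FreeLieSum m n) μ.card where
  toFun s := MultilinearMap.alternatization
    (((spechtForm μ m x s).domDomCongr (transposeNumbering T)).compLinearMap
      fun a => lieVec ∘ₗ proj (h a))
  map_add' s t := by
    ext y
    rw [map_add]
    simp only [MultilinearMap.alternatization_apply, AlternatingMap.add_apply,
      ← Finset.sum_add_distrib]
    refine Finset.sum_congr rfl fun σ _ => ?_
    rw [← smul_add]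
    rfl
  map_smul' c s := by
    ext y
    rw [map_smul]
    simp only [MultilinearMap.alternatization_apply, AlternatingMap.smul_apply, RingHom.id_apply,
      Finset.smul_sum]
    refine Finset.sum_congr rfl fun σ _ => ?_
    rw [smul_comm]
    rfl

theorem liftSpecht_apply (h : Fin μ.card → Fin n) (x : SpechtSpace μ) (s : SchurSpace μ m)
    (y : Fin μ.card → FreeLieSum m n) :
    liftSpecht T h x s y = ∑ σ : Perm (Fin μ.card), Perm.sign σ • spechtForm μ m x s
      fun b => lieVec (proj (h (transposeNumbering T b)) (y (σ (transposeNumbering T b)))) := by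
  change MultilinearMap.alternatization _ y = _
  rw [MultilinearMap.alternatization_apply]
  rfl

theorem liftSpecht_isEquivariant (h : Fin μ.card → Fin n) (x : SpechtSpace μ) :
    IsMultFamily (liftSpecht (m := m) T h x) := by
  intro A s
  ext y
  rw [AlternatingMap.compLinearMap_apply, liftSpecht_apply, liftSpecht_apply]
  refine Finset.sum_congr rfl fun σ _ => ?_
  congr 1
  simp only [proj_glVRep, lieVec_freeMap]
  exact spechtForm_isFormEquivariant x A s _

/-- The colours are distinct, so in the alternating sum every nontrivial permutation projects some
argument to a wrong colour. -/
theorem colorSpecht_liftSpecht {h : Fin μ.card → Fin n} (hh : Function.Injective h)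
    (x : SpechtSpace μ) :
    colorSpecht T hm h (liftSpecht_isEquivariant (m := m) T h x).toMult = x := by
  refine specht_ext hm fun s v => ?_
  rw [spechtForm_colorSpecht, IsMultFamily.toMult_apply, liftSpecht_apply,
    Finset.sum_eq_single 1]
  · simp [proj_inc, lieVec_vecLie]
  · intro σ _ hσ
    obtain ⟨a, ha⟩ : ∃ a, σ a ≠ a := by
      by_contra hcon
      push Not at hcon
      exact hσ (Equiv.ext hcon)
    rw [(spechtForm μ m x s).map_coord_zero ((transposeNumbering T).symm a), smul_zero]
    rw [Equiv.apply_symm_apply, proj_inc_ne (hh.ne ha.symm), map_zero]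
  · simp

theorem colorSpecht_liftSpecht_eq_zero {g h : Fin μ.card → Fin n}
    (hg : ∀ σ : Perm (Fin μ.card), h ≠ g ∘ σ) (x : SpechtSpace μ) :
    colorSpecht T hm g (liftSpecht_isEquivariant (m := m) T h x).toMult = 0 := by
  refine specht_ext hm fun s v => ?_
  rw [spechtForm_colorSpecht, IsMultFamily.toMult_apply, liftSpecht_apply, map_zero]
  refine Finset.sum_eq_zero fun σ _ => ?_
  obtain ⟨a, ha⟩ := Function.ne_iff.1 (hg σ)
  rw [(spechtForm μ m x s).map_coord_zero ((transposeNumbering T).symm a), smul_zero]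
  rw [Equiv.apply_symm_apply, proj_inc_ne (d := g (σ a)) ha, map_zero]

end ColorForm

end

end FreeLieResolution

namespace FreeLieResolution

noncomputable section

/-! ### Exactness -/

section Exactness

variable {μ : YoungDiagram} {m n : ℕ}

theorem stdRep_twoGL_inv (v : Fin m → ℂ) : stdRep m (twoGL m)⁻¹ v = (2 : ℂ)⁻¹ • v := by
  have h : stdRep m (twoGL m) v = (2 : ℂ) • v := by
    rw [stdRep_apply]
    ext i
    simp [Matrix.mulVec, dotProduct, twoGL_apply]
  have h1 := Representation.inv_self_apply (stdRep m) (twoGL m) v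
  rw [h, map_smul] at h1
  rw [eq_inv_smul_iff₀ two_ne_zero, h1]

theorem card_transpose_cells : Fintype.card μ.transpose.cells = μ.card := by
  rw [← Fintype.card_congr (transposeCells μ), Fintype.card_coe]

-- `𝕊^{μ'}(V^*)` lies in the `k`-th tensor power of `V^*`, where the scalar 2 acts by `2^{-k}`.
variable (μ m) in
theorem schurDual_hasWeight : HasWeight (S := SchurSpace μ m) (schurDual μ m) μ.card := by
  intro s
  apply Subtype.ext
  change diagTensor _ (stdRep m).dual (twoGL m) s.1 = _ • s.1
  have : diagTensor μ.transpose.cells (stdRep m).dual (twoGL m) =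
      ((2 : ℂ) ^ μ.card)⁻¹ • LinearMap.id := by
    refine dualPower_hom_ext fun ξ => ?_
    have h : diagTensor μ.transpose.cells (stdRep m).dual (twoGL m) (PiTensorProduct.tprod ℂ ξ) =
        PiTensorProduct.tprod ℂ fun b => (stdRep m).dual (twoGL m) (ξ b) :=
      PiTensorProduct.map_tprod _ _
    have h1 : ∀ ξ : Module.Dual ℂ (Fin m → ℂ), (stdRep m).dual (twoGL m) ξ = (2 : ℂ)⁻¹ • ξ := by
      intro ξ
      refine LinearMap.ext fun v => ?_
      change ξ (stdRep m (twoGL m)⁻¹ v) = _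
      rw [stdRep_twoGL_inv, map_smul]
      rfl
    simp only [h, h1]
    rw [MultilinearMap.map_smul_univ, Finset.prod_const, Finset.card_univ, card_transpose_cells,
      inv_pow]
    rfl
  rw [this]
  rfl

theorem mult_weight_eq {i : ℕ} (φ : Mult μ m n i) (s : SchurSpace μ m)
    (p : Fin i → Fin n × Fin m × List (Fin m))
    (h : φ s (fun a => inc (p a).1 (lieWord (p a).2.1 (p a).2.2)) ≠ 0) :
    ∑ a, ((p a).2.2.length + 1) = μ.card :=
  IsEquivariant.weight_eq (schurDual_hasWeight μ m) (mult_isEquivariant φ) s p h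

theorem mult_eq_zero_of_lt {i : ℕ} (hi : μ.card < i) (φ : Mult μ m n i) (s : SchurSpace μ m) :
    φ s = 0 := by
  refine form_eq_zero_of_words _ fun p => ?_
  by_contra h
  have h1 := mult_weight_eq φ s p h
  rw [Finset.sum_add_distrib] at h1
  simp at h1
  omega

theorem mult_gen_eq_zero {i : ℕ} (hi : i ≠ μ.card) (φ : Mult μ m n i) (s : SchurSpace μ m)
    (γ : Fin i → Fin n) (v : Fin i → Fin m) : φ s (fun a => gen (γ a) (v a)) = 0 := by
  by_contra h
  have h1 := mult_weight_eq φ s (fun a => (γ a, v a, [])) h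
  simp at h1
  exact hi h1

theorem multDifferential_apply {i : ℕ} (φ : Mult μ m n i) (s : SchurSpace μ m) :
    multDifferential μ m n i φ s = differential i (φ s) := rfl

theorem mem_incoming_of_isBoundary {i : ℕ} {φ : Mult μ m n i}
    (h : IsBoundary (S := SchurSpace μ m) (schurDual μ m) φ.toLinearMap) :
    φ ∈ incoming (multDifferential μ m n) i := by
  cases i with
  | zero =>
    refine (Submodule.mem_bot ℂ).2 ?_
    ext1
    exact h
  | succ i =>
    obtain ⟨f, hf, hd⟩ := h
    refine ⟨IsMultFamily.toMult hf, ?_⟩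
    ext1
    exact LinearMap.ext hd

theorem mem_incoming_of_gen {i : ℕ} {φ : Mult μ m n i} (hd : ∀ s, differential i (φ s) = 0)
    (h : ∀ s (γ : Fin i → Fin n) (v : Fin i → Fin m), Function.Injective γ →
      φ s (fun a => gen (γ a) (v a)) = 0) : φ ∈ incoming (multDifferential μ m n) i :=
  mem_incoming_of_isBoundary
    (acyclic μ.card (SchurSpace μ m) _ (schurDual_hasWeight μ m) i _ (mult_isEquivariant φ) hd h)

/-- A tuple of `i` generators has total degree `i`, not the weight `k`, so below degree `k` the
vanishing hypothesis of `acyclic` is automatic. -/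
theorem ker_multDifferential {i : ℕ} (hi : i < μ.card) :
    LinearMap.ker (multDifferential μ m n i).toLinearMap =
      incoming (multDifferential μ m n) i := by
  ext φ
  constructor
  · intro h
    refine mem_incoming_of_gen (fun s => ?_) fun s γ v _ => mult_gen_eq_zero hi.ne φ s γ v
    rw [← multDifferential_apply]
    exact congrArg (fun ψ : Mult μ m n (i + 1) => ψ s) h
  · intro h
    cases i with
    | zero =>
      rw [(Submodule.mem_bot ℂ).1 h]
      exact Submodule.zero_mem _
    | succ i =>
      obtain ⟨ψ, rfl⟩ := h
      change multDifferential μ m n (i + 1) (multDifferential μ m n i ψ) = 0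
      ext1
      exact LinearMap.ext fun s => differential_differential (ψ s)

variable (T : μ.cells ≃ Fin μ.card)

/-- Coboundaries vanish on commuting arguments. Conversely every element of degree `k` is a cocycle,
as degree `k + 1` exceeds the weight, so `acyclic` applies once the values on generators of distinct
colours vanish. -/
theorem mem_incoming_iff_colorSpecht (hm : μ.rowLen 0 ≤ m) {φ : Mult μ m n μ.card} :
    φ ∈ incoming (multDifferential μ m n) μ.card ↔
      ∀ g : Fin μ.card → Fin n, Function.Injective g → colorSpecht T hm g φ = 0 := by
  constructor
  · intro h g hg
    refine specht_ext hm fun s v => ?_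
    rw [spechtForm_colorSpecht, map_zero]
    have hgen : ∀ w : Fin μ.card → Fin m, φ s (fun a => gen (g a) (w a)) = 0 := by
      -- `incoming` is defined by cases on the degree, so the degree has to become a variable.
      generalize μ.card = k at *
      cases k with
      | zero =>
        intro w
        rw [(Submodule.mem_bot ℂ).1 h]
        rfl
      | succ k =>
        obtain ⟨ψ, rfl⟩ := h
        intro w
        exact differential_gen_eq_zero (ψ s) g w hg
    have h1 : (φ s).toMultilinearMap.compLinearMap (fun a => inc (g a) ∘ₗ vecLie) = 0 := by
      refine Module.Basis.ext_multilinear (fun _ => Pi.basisFun ℂ (Fin m)) fun w => ?_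
      rw [zero_apply, ← hgen w]
      simp only [Pi.basisFun_apply]
      change φ s (fun a => inc (g a) (vecLie (Pi.single (w a) 1))) = _
      simp only [vecLie_single]
      rfl
    exact DFunLike.congr_fun h1 (fun a => v ((transposeNumbering T).symm a))
  · intro h
    refine mem_incoming_of_gen (fun s => ?_) fun s γ v hγ => ?_
    · exact mult_eq_zero_of_lt (Nat.lt_succ_self _) (multDifferential μ m n μ.card φ) s
    · have h1 := spechtForm_colorSpecht T hm γ φ s
        fun b => Pi.single (v (transposeNumbering T b)) 1
      rw [h γ hγ, map_zero] at h1
      simp only [Equiv.apply_symm_apply, vecLie_single] at h1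
      exact h1.symm

/-- When `n = k` the injective colourings are the permutations, and their components are translates
of the one at the identity, which alone gives the augmentation. -/
theorem isResolution_specht (hm : μ.rowLen 0 ≤ m) :
    IsResolution (multDifferential μ m μ.card) μ.card (specht μ T) := by
  refine ⟨fun i hi => ker_multDifferential hi, ?_⟩
  refine ⟨LinearMap.intertwiningMap_of_isIntertwiningMap _ _ (colorSpecht T hm id)
    (fun σ φ => ?_), ?_, ?_⟩
  · rw [colorSpecht_multPerm, Function.comp_id, ← Function.id_comp (⇑σ⁻¹), colorSpecht_comp_perm,
      inv_inv]
  · ext φ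
    rw [mem_incoming_iff_colorSpecht T hm]
    constructor
    · intro h g hg
      let σ : Perm (Fin μ.card) := Equiv.ofBijective g (Finite.injective_iff_bijective.1 hg)
      have h1 := colorSpecht_comp_perm T hm id σ φ
      rw [show colorSpecht T hm id φ = 0 from h, map_zero] at h1
      exact h1
    · intro h
      exact h id Function.injective_id
  · intro x
    exact ⟨_, colorSpecht_liftSpecht T hm Function.injective_id x⟩

theorem youngEmbedding_castLE {k : ℕ} (hn : k ≤ n) (p : Perm (Fin k) × Perm (Fin (n - k)))
    (a : Fin k) : youngEmbedding hn p (Fin.castLE hn a) = Fin.castLE hn (p.1 a) := by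
  let e : Fin k ⊕ Fin (n - k) ≃ Fin n :=
    finSumFinEquiv.trans (finCongr (Nat.add_sub_of_le hn))
  have he : ∀ b, e (Sum.inl b) = Fin.castLE hn b := fun b => Fin.ext rfl
  change e (Perm.sumCongr p.1 p.2 (e.symm (Fin.castLE hn a))) = _
  rw [← he, Equiv.symm_apply_apply, ← he]
  rfl

theorem exists_youngEmbedding_eq {k : ℕ} (hn : k ≤ n) {u : Perm (Fin n)}
    (hu : ∀ a : Fin k, ∃ b, u (Fin.castLE hn a) = Fin.castLE hn b) :
    ∃ p, youngEmbedding hn p = u := by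
  let e : Fin k ⊕ Fin (n - k) ≃ Fin n :=
    finSumFinEquiv.trans (finCongr (Nat.add_sub_of_le hn))
  have he : ∀ b, e (Sum.inl b) = Fin.castLE hn b := fun b => Fin.ext rfl
  obtain ⟨p, hp⟩ := Perm.mem_sumCongrHom_range_of_perm_mapsTo_inl (σ := e.permCongr.symm u) (by
    rintro _ ⟨a, rfl⟩
    obtain ⟨b, hb⟩ := hu a
    refine ⟨b, ?_⟩
    change _ = e.symm (u (e (Sum.inl a)))
    rw [he, hb, ← he, Equiv.symm_apply_apply])
  refine ⟨p, ?_⟩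
  change e.permCongr (Perm.sumCongrHom _ _ p) = u
  rw [hp, Equiv.apply_symm_apply]

theorem exists_perm_comp_castLE {k : ℕ} (hn : k ≤ n) {g : Fin k → Fin n}
    (hg : Function.Injective g) : ∃ u : Perm (Fin n), ⇑u ∘ Fin.castLE hn = g := by
  classical
  let e := (Equiv.ofInjective _ (Fin.castLE_injective hn)).symm.trans (Equiv.ofInjective g hg)
  refine ⟨Equiv.extendSubtype e, funext fun a => ?_⟩
  rw [Function.comp_apply, Equiv.extendSubtype_apply_of_mem e _ ⟨a, rfl⟩]
  change (Equiv.ofInjective g hg ((Equiv.ofInjective _ (Fin.castLE_injective hn)).symm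
    (Equiv.ofInjective _ (Fin.castLE_injective hn) a)) : Fin n) = g a
  rw [Equiv.symm_apply_apply]
  rfl

/-- The component of an element of the multiplicity space at a permutation of the colours. -/
def blockSpecht (hm : μ.rowLen 0 ≤ m) (hn : μ.card ≤ n) (g : Perm (Fin n)) :
    Mult μ m n μ.card →ₗ[ℂ] SpechtSpace μ :=
  colorSpecht T hm (⇑g ∘ Fin.castLE hn)

theorem blockSpecht_mul (hm : μ.rowLen 0 ≤ m) (hn : μ.card ≤ n) (g : Perm (Fin n))
    (p : Perm (Fin μ.card) × Perm (Fin (n - μ.card))) (φ : Mult μ m n μ.card) :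
    blockSpecht T hm hn (g * youngEmbedding hn p) φ =
      spechtBoxTriv μ T n p⁻¹ (blockSpecht T hm hn g φ) := by
  have h : ⇑(g * youngEmbedding hn p) ∘ Fin.castLE hn = (⇑g ∘ Fin.castLE hn) ∘ ⇑p.1 := by
    funext a
    simp only [Function.comp_apply, Perm.mul_apply, youngEmbedding_castLE]
  rw [blockSpecht, h, colorSpecht_comp_perm]
  rfl

theorem blockSpecht_multPerm (hm : μ.rowLen 0 ≤ m) (hn : μ.card ≤ n) (u g : Perm (Fin n))
    (φ : Mult μ m n μ.card) :
    blockSpecht T hm hn g (multPerm μ m n μ.card u φ) = blockSpecht T hm hn (u⁻¹ * g) φ :=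
  colorSpecht_multPerm T hm _ u φ

/-- Injective colourings are restrictions of permutations to the first `k` letters, so the
components form a function on `S_n` equivariant under the Young subgroup, that is, an element of the
induced representation. -/
theorem isResolution_inducedM (hm : μ.rowLen 0 ≤ m) (hn : μ.card ≤ n) :
    IsResolution (multDifferential μ m n) μ.card (inducedM μ T hn) := by
  refine ⟨fun i hi => ker_multDifferential hi, ?_⟩
  refine ⟨LinearMap.intertwiningMap_of_isIntertwiningMap _ _
    (toInd (youngEmbedding hn) (spechtBoxTriv μ T n)
      (blockSpecht T hm hn)) (toInd_equivariant (blockSpecht_multPerm T hm hn)), ?_, ?_⟩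
  · ext φ
    rw [mem_incoming_iff_colorSpecht T hm]
    refine (toInd_eq_zero_iff (blockSpecht_mul T hm hn) φ).trans ⟨fun h g hg => ?_, fun h g => ?_⟩
    · obtain ⟨u, rfl⟩ := exists_perm_comp_castLE hn hg
      exact h u
    · exact h _ (g.injective.comp (Fin.castLE_injective hn))
  · refine toInd_surjective (blockSpecht_mul T hm hn) fun g x => ?_
    refine ⟨_, colorSpecht_liftSpecht T hm (g.injective.comp (Fin.castLE_injective hn)) x, ?_⟩
    intro g' hg'
    refine colorSpecht_liftSpecht_eq_zero T hm (fun σ hσ => ?_) x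
    -- If `g` and `g'` use the same colours up to order, `g⁻¹ * g'` preserves the first `k` letters
    -- and both lie in one coset of the Young subgroup.
    obtain ⟨p, hp⟩ := exists_youngEmbedding_eq hn (u := g⁻¹ * g') (fun a => by
      refine ⟨σ⁻¹ a, ?_⟩
      have h1 := congrFun hσ (σ⁻¹ a)
      simp only [Function.comp_apply] at h1
      rw [Perm.mul_apply, Perm.inv_eq_iff_eq, h1]
      congr 2
      exact (σ.apply_symm_apply a).symm)
    exact hg' p (by rw [hp, mul_inv_cancel_left])

end Exactness

end

end FreeLieResolution

namespace FreeLieResolution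

noncomputable section

/-! ### Algebraicity of the action of `GL_n` -/

section Algebraic

variable {μ : YoungDiagram} {m n : ℕ}

theorem glnRep_permGL (σ : Perm (Fin n)) : glnRep m n (permGL n σ) = permRep m n σ := by
  refine LinearMap.ext fun x => freeLieSum_ext fun i => ?_
  change matrixMap m (permGL n σ).val x i = x (σ.symm i)
  rw [matrixMap_apply, Finset.sum_eq_single (σ.symm i)]
  · simp [permGL, Equiv.toPEquiv_apply]
  · intro j _ hj
    simp [permGL, Equiv.toPEquiv_apply, hj.symm]
  · simp

theorem multPerm_eq (i : ℕ) : multPerm μ m n i = (multGL μ m n i).comp (permGL n) := by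
  refine MonoidHom.ext fun σ => LinearMap.ext fun φ => ?_
  ext1
  refine LinearMap.ext fun s => ?_
  change (φ s).compLinearMap (permRep m n σ⁻¹) =
    (φ s).compLinearMap (glnRep m n (permGL n σ)⁻¹)
  rw [← map_inv, glnRep_permGL]

theorem glnRep_eq_sum (B : GL (Fin n) ℂ) (x : FreeLieSum m n) :
    glnRep m n B x = ∑ p : Fin n × Fin n, B.val p.1 p.2 • inc p.1 (proj p.2 x) := by
  change matrixMap m B.val x = _
  rw [matrixMap, Fintype.sum_prod_type]
  simp only [LinearMap.sum_apply]
  rfl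

/-- Only words of total degree `k` give nonzero values, and words of length at most `k` are finite
in number. -/
instance finiteDimensional_mult (i : ℕ) : FiniteDimensional ℂ (Mult μ m n i) := by
  let W := {w : List (Fin m) // w.length ≤ μ.card}
  have : Finite W := List.finite_length_le (Fin m) μ.card
  let E := (Fin i → Fin n × Fin m × W) → Module.Dual ℂ (SchurSpace μ m)
  let f : Mult μ m n i →ₗ[ℂ] E :=
    { toFun := fun φ p =>
        { toFun := fun s => φ s fun a => inc (p a).1 (lieWord (p a).2.1 (p a).2.2.1)
          map_add' := fun s t => by rw [map_add]; rfl
          map_smul' := fun c s => by rw [map_smul]; rfl }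
      map_add' := fun _ _ => rfl
      map_smul' := fun _ _ => rfl }
  refine FiniteDimensional.of_injective f ?_
  rw [← LinearMap.ker_eq_bot, LinearMap.ker_eq_bot']
  intro φ hφ
  ext1
  refine LinearMap.ext fun s => form_eq_zero_of_words _ fun p => ?_
  by_contra h
  have h1 := mult_weight_eq φ s p h
  have h2 : ∀ a, (p a).2.2.length ≤ μ.card := by
    intro a
    rw [← h1]
    exact (Nat.le_succ _).trans (Finset.single_le_sum (f := fun a => (p a).2.2.length + 1)
      (fun _ _ => Nat.zero_le _) (Finset.mem_univ a))
  exact h (LinearMap.congr_fun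
    (congrFun hφ fun a => ((p a).1, (p a).2.1, ⟨(p a).2.2, h2 a⟩)) s)

/-- Evaluation of an element of the multiplicity space. -/
def multEval {i : ℕ} (s : SchurSpace μ m) (x : Fin i → FreeLieSum m n) :
    Module.Dual ℂ (Mult μ m n i) where
  toFun φ := φ s x
  map_add' _ _ := rfl
  map_smul' _ _ := rfl

/-- Evaluations separate the points of a finite-dimensional space, hence span its dual. Algebraicity
need only be checked for them. -/
theorem span_multEval (i : ℕ) :
    Submodule.span ℂ (Set.range fun p : SchurSpace μ m × (Fin i → FreeLieSum m n) =>
      multEval p.1 p.2) = (⊤ : Submodule ℂ (Module.Dual ℂ (Mult μ m n i))) := by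
  set M := Submodule.span ℂ (Set.range fun p : SchurSpace μ m × (Fin i → FreeLieSum m n) =>
    (multEval p.1 p.2 : Module.Dual ℂ (Mult μ m n i))) with hM
  have h : M.dualCoannihilator = ⊥ := by
    rw [eq_bot_iff]
    intro φ hφ
    rw [Submodule.mem_dualCoannihilator] at hφ
    refine (Submodule.mem_bot ℂ).2 ?_
    ext1
    refine LinearMap.ext fun s => AlternatingMap.ext fun x => ?_
    exact hφ (multEval s x) (Submodule.subset_span ⟨(s, x), rfl⟩)
  rw [← Subspace.dualCoannihilator_dualAnnihilator_eq (W := M), h,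
    Submodule.dualAnnihilator_bot]

theorem isAlgebraicRep_multGL (i : ℕ) : IsAlgebraicRep (multGL μ m n i) := by
  refine ⟨inferInstance, fun φ l => ?_⟩
  have hl : l ∈ Submodule.span ℂ (Set.range fun p : SchurSpace μ m × (Fin i → FreeLieSum m n) =>
      (multEval p.1 p.2 : Module.Dual ℂ (Mult μ m n i))) := by
    rw [span_multEval]
    exact Submodule.mem_top
  induction hl using Submodule.span_induction with
  | mem l hl =>
    obtain ⟨⟨s, x⟩, rfl⟩ := hl
    -- The action on forms is contragredient, so only the variables `Sum.inr`, the entries of `A⁻¹`,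
    -- appear; `r` picks one matrix entry for each argument.
    refine ⟨∑ r : Fin i → Fin n × Fin n,
      MvPolynomial.C (φ s fun a => inc (r a).1 (proj (r a).2 (x a))) *
        ∏ a, MvPolynomial.X (Sum.inr (r a)), fun A => ?_⟩
    change φ s (fun a => glnRep m n A⁻¹ (x a)) = _
    simp only [glnRep_eq_sum]
    refine ((φ s).toMultilinearMap.map_sum _).trans ?_
    rw [map_sum]
    refine Finset.sum_congr rfl fun r _ => ?_
    rw [MultilinearMap.map_smul_univ]
    simp only [map_mul, MvPolynomial.eval_C, map_prod, MvPolynomial.eval_X, Sum.elim_inr,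
      smul_eq_mul]
    exact mul_comm _ _
  | zero => exact ⟨0, fun A => by simp⟩
  | add l l' _ _ h h' =>
    obtain ⟨P, hP⟩ := h
    obtain ⟨P', hP'⟩ := h'
    exact ⟨P + P', fun A => by rw [LinearMap.add_apply, hP, hP', map_add]⟩
  | smul t l _ h =>
    obtain ⟨P, hP⟩ := h
    exact ⟨MvPolynomial.C t * P, fun A => by
      rw [LinearMap.smul_apply, hP, map_mul, MvPolynomial.eval_C, smul_eq_mul]⟩

end Algebraic

end

end FreeLieResolution

theorem theorem3p2 (μ : YoungDiagram) (T : μ.cells ≃ Fin μ.card) (m : ℕ)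
    (hm : μ.rowLen 0 ≤ m) :
    (∀ (n : ℕ) (hn : μ.card ≤ n),
      IsResolution (multDifferential μ m n) μ.card (inducedM μ T hn) ∧
      ∀ i ≤ μ.card, IsAlgebraicRep (multGL μ m n i) ∧
        multPerm μ m n i = (multGL μ m n i).comp (permGL n)) ∧
    IsResolution (multDifferential μ m μ.card) μ.card (specht μ T) ∧
    (specht μ T).IsIrreducible :=
  ⟨fun _ hn => ⟨isResolution_inducedM T hm hn, fun i _ => ⟨isAlgebraicRep_multGL i, multPerm_eq i⟩⟩,
    isResolution_specht T hm, specht_isIrreducible μ T⟩
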